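/- Consider the following three curves over the field of rational functions $\mathbb{Q}(t)$ (Kubert's general families with torsion $\mathbb{Z}/10\mathbb{Z}$, $\mathbb{Z}/12\mathbb{Z}$ and $\mathbb{Z}/2\mathbb{Z}\times\mathbb{Z}/8\mathbb{Z}$, respectively): $$E_{10}:\; y^2 = x\bigl(x^2 - (2t^2 - 2t + 1)(4t^4 - 12t^3 + 6t^2 + 2t - 1)\,x + 16t^5(t - 1)^5(t^2 - 3t + 1)\bigr),$$ $$E_{12}:\; y^2 = x\bigl(x^2 + (t^8 - 12t^6 - 48t^5 - 162t^4 - 480t^3 - 540t^2 - 624t - 183)\,x + 1024(t^2 + 3)^2(t + 1)^6\bigr),$$ $$E_{2\times 8}:\; y^2 = x\,\bigl(x + (t^2 - 1)^4\bigr)\,\bigl(x + 16t^4\bigr).$$ Each of them is an elliptic curve over $\mathbb{Q}(t)$; the torsion subgroups of their groups of $\mathbb{Q}(t)$-rational points are $$E_{10}(\mathbb{Q}(t))_{\mathrm{tors}}\cong\mathbb{Z}/10\mathbb{Z},\qquad E_{12}(\mathbb{Q}(t))_{\mathrm{tors}}\cong\mathbb{Z}/12\mathbb{Z},\qquad E_{2\times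 8}(\mathbb{Q}(t))_{\mathrm{tors}}\cong\mathbb{Z}/2\mathbb{Z}\times\mathbb{Z}/8\mathbb{Z};$$ and each of the three groups $E_{10}(\mathbb{Q}(t))$, $E_{12}(\mathbb{Q}(t))$, $E_{2\times 8}(\mathbb{Q}(t))$ has rank $0$. -/

import Mathlib

open WeierstrassCurve

noncomputable section

namespace KubertFamilies

/-- The field `ℚ(t)` of rational functions over `ℚ`. -/
abbrev Qt : Type := RatFunc ℚ

/-- The variable `t` of `ℚ(t)`. -/
abbrev t : Qt := RatFunc.X

/-- The Weierstrass curve `y² = x³ + A x² + B x` over `ℚ(t)`. -/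
def curve (A B : Qt) : WeierstrassCurve.Affine Qt where
  a₁ := 0
  a₂ := A
  a₃ := 0
  a₄ := B
  a₆ := 0

/-- Kubert's family with torsion `ℤ/10ℤ`. -/
def E10 : WeierstrassCurve.Affine Qt :=
  curve (-((2 * t ^ 2 - 2 * t + 1) * (4 * t ^ 4 - 12 * t ^ 3 + 6 * t ^ 2 + 2 * t - 1)))
    (16 * t ^ 5 * (t - 1) ^ 5 * (t ^ 2 - 3 * t + 1))

/-- Kubert's family with torsion `ℤ/12ℤ`. -/
def E12 : WeierstrassCurve.Affine Qt :=
  curve (t ^ 8 - 12 * t ^ 6 - 48 * t ^ 5 - 162 * t ^ 4 - 480 * t ^ 3 - 540 * t ^ 2 - 624 * t - 183)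
    (1024 * (t ^ 2 + 3) ^ 2 * (t + 1) ^ 6)

/-- Kubert's family with torsion `ℤ/2ℤ × ℤ/8ℤ`. -/
def E2x8 : WeierstrassCurve.Affine Qt :=
  curve ((t ^ 2 - 1) ^ 4 + 16 * t ^ 4) ((t ^ 2 - 1) ^ 4 * (16 * t ^ 4))

theorem E10_equation_iff (x y : Qt) : E10.Equation x y ↔
    y ^ 2 = x * (x ^ 2
      - (2 * t ^ 2 - 2 * t + 1) * (4 * t ^ 4 - 12 * t ^ 3 + 6 * t ^ 2 + 2 * t - 1) * x
      + 16 * t ^ 5 * (t - 1) ^ 5 * (t ^ 2 - 3 * t + 1)) := by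
  rw [Affine.equation_iff]
  simp only [E10, curve]
  constructor <;> intro h <;> linear_combination h

theorem E12_equation_iff (x y : Qt) : E12.Equation x y ↔
    y ^ 2 = x * (x ^ 2
      + (t ^ 8 - 12 * t ^ 6 - 48 * t ^ 5 - 162 * t ^ 4 - 480 * t ^ 3 - 540 * t ^ 2
          - 624 * t - 183) * x
      + 1024 * (t ^ 2 + 3) ^ 2 * (t + 1) ^ 6) := by
  rw [Affine.equation_iff]
  simp only [E12, curve]
  constructor <;> intro h <;> linear_combination h

theorem E2x8_equation_iff (x y : Qt) : E2x8.Equation x y ↔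
    y ^ 2 = x * (x + (t ^ 2 - 1) ^ 4) * (x + 16 * t ^ 4) := by
  rw [Affine.equation_iff]
  simp only [E2x8, curve]
  constructor <;> intro h <;> linear_combination h

end KubertFamilies

end

open WeierstrassCurve

noncomputable section

namespace KubertFamilies

open WeierstrassCurve.Affine

/-! ### Explicit group law on y² = x(x² + Ax + B) -/

section GroupLaw

variable {A B : Qt}

/-! The plan is to prove that each whole group E(ℚ(t)) is finite and equal to an explicit group G.
Torsion and rank can then be read off from G.

Descent. With D = A² - 4B, a point of y² = x(x² + Ax + B) has a class x modulo squares, represented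
by a squarefree polynomial d dividing B. The dual curve y² = x(x² - 2Ax + D) gives divisors of D in
the same way. At a place where the other factor vanishes (D for the curve, 16B for its dual) the
descent equation degenerates, and the residue of d must be a square or -2A times a square. Testing
this at rational places, at infinity and at a few quadratic places leaves only the classes of known
torsion points (`class₁₀`, `dual_class₁₀` and their analogues). Hence E = H + 2E, with H a finite
group of 2-power torsion.

Heights. Over ℚ(t) the degree of x alone does not satisfy Northcott, because ℚ is infinite. The
degree is therefore combined with the heights of the specializations of x at good rational r. Each
function satisfies the parallelogram law up to a bounded error, and a bound on the degree and on
enough specializations leaves finitely many points (`finite_of_bounded_heights`). Repeated halving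
modulo H must then cycle, so every point has an odd multiple in H (`exists_odd_nsmul_mem`). Finite
generation is never needed.

Odd torsion. If P ≠ 0 has odd order, the coordinates of 2ᵏP form a cycle whose x-coordinates are
periodic. A pole of x would be multiplied by 1/4 at each doubling, up to a bounded error, which
contradicts periodicity; so x is a polynomial of bounded degree. At a node where B vanishes, the
order of x records the component of the fibre, and doubling acts on it by an explicit rule. For the
ℤ/2 × ℤ/8 family this rule admits no cycle. For the other two it fixes x up to a constant, and the
duplication formula then shows that the known point of order 5 or 3 is met, up to sign
(`DoublingCycle.exists_eq_of_ten`, `DoublingCycle.exists_eq_of_twelve`).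

Since some 2-power multiple of rP vanishes whenever rP lies in H, these facts put every P in G
(`mem_of_descent`). -/

theorem curve_equation_iff (x y : Qt) :
    (curve A B).Equation x y ↔ y ^ 2 = x * (x ^ 2 + A * x + B) := by
  rw [Affine.equation_iff]
  simp only [curve]
  constructor <;> intro h <;> linear_combination h

theorem curve_Δ : (curve A B).Δ = 16 * B ^ 2 * (A ^ 2 - 4 * B) := by
  simp only [curve, WeierstrassCurve.Δ, b₂, b₄, b₆, b₈]
  ring

theorem curve_isElliptic (hB : B ≠ 0) (hD : A ^ 2 - 4 * B ≠ 0) : (curve A B).IsElliptic := by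
  constructor
  rw [curve_Δ, isUnit_iff_ne_zero]
  exact mul_ne_zero (mul_ne_zero (by norm_num) (pow_ne_zero _ hB)) hD

theorem B_ne_zero [h : (curve A B).IsElliptic] : B ≠ 0 := by
  rintro rfl
  have := h.isUnit
  rw [curve_Δ] at this
  simp at this

theorem disc_ne_zero [h : (curve A B).IsElliptic] : A ^ 2 - 4 * B ≠ 0 := by
  intro h0
  have := h.isUnit
  rw [curve_Δ, h0] at this
  simp at this

/-- The affine point `(x, y)` of `y² = x³ + A x² + B x`. -/
def pt [(curve A B).IsElliptic] {x y : Qt} (h : y ^ 2 = x * (x ^ 2 + A * x + B)) :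
    (curve A B).Point :=
  Point.mk ((curve_equation_iff x y).2 h)

@[simp]
theorem negY_curve (x y : Qt) : (curve A B).negY x y = -y := by
  simp [negY, curve]

variable [(curve A B).IsElliptic]

theorem eq_zero_or_eq_pt (P : (curve A B).Point) :
    P = 0 ∨ ∃ (x y : Qt) (h : y ^ 2 = x * (x ^ 2 + A * x + B)), P = pt h := by
  match P with
  | 0 => exact .inl rfl
  | .some x y h => exact .inr ⟨x, y, (curve_equation_iff x y).1 h.1, rfl⟩

theorem pt_ne_zero {x y : Qt} (h : y ^ 2 = x * (x ^ 2 + A * x + B)) : pt h ≠ 0 :=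
  Point.some_ne_zero _

theorem pt_congr {x y x' y' : Qt} (h : y ^ 2 = x * (x ^ 2 + A * x + B))
    (h' : y' ^ 2 = x' * (x' ^ 2 + A * x' + B)) (hx : x = x') (hy : y = y') : pt h = pt h' := by
  subst hx hy; rfl

theorem pt_inj {x y x' y' : Qt} {h : y ^ 2 = x * (x ^ 2 + A * x + B)}
    {h' : y' ^ 2 = x' * (x' ^ 2 + A * x' + B)} (e : pt h = pt h') : x = x' ∧ y = y' := by
  simpa [pt, Point.mk] using e

theorem neg_pt {x y : Qt} (h : y ^ 2 = x * (x ^ 2 + A * x + B)) :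
    -pt h = pt (x := x) (y := -y) (by rw [neg_sq, h]) := by
  simp only [pt, Point.mk, Point.neg_some, negY_curve]

theorem xRep_pt {x y : Qt} (h : y ^ 2 = x * (x ^ 2 + A * x + B)) : (pt h).xRep = ![x, 1] := rfl

theorem pt_eq_or_eq_neg {x y y' : Qt} (h : y ^ 2 = x * (x ^ 2 + A * x + B))
    (h' : y' ^ 2 = x * (x ^ 2 + A * x + B)) : pt h = pt h' ∨ pt h = -pt h' :=
  Point.X_eq_iff.1 rfl

variable [DecidableEq Qt]

theorem pt_add_self_of_eq_zero {x y : Qt} (h : y ^ 2 = x * (x ^ 2 + A * x + B)) (hy : y = 0) :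
    pt h + pt h = 0 :=
  Point.add_self_of_Y_eq (by rw [negY_curve, hy, neg_zero])

theorem pt_add_self {x y : Qt} (h : y ^ 2 = x * (x ^ 2 + A * x + B)) (hy : y ≠ 0) :
    ∃ (x' y' : Qt) (h' : y' ^ 2 = x' * (x' ^ 2 + A * x' + B)),
      pt h + pt h = pt h' ∧ x' * (4 * y ^ 2) = (x ^ 2 - B) ^ 2 := by
  have hy' : y ≠ (curve A B).negY x y := by
    rw [negY_curve]
    intro h2
    exact hy (by linear_combination h2 / 2)
  refine ⟨_, _, (curve_equation_iff _ _).1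
    (nonsingular_add ((equation_iff_nonsingular).1 ((curve_equation_iff x y).2 h))
      ((equation_iff_nonsingular).1 ((curve_equation_iff x y).2 h)) fun hxy => hy' hxy.2).1,
    Point.add_self_of_Y_ne hy', ?_⟩
  rw [slope_of_Y_ne rfl hy', negY_curve]
  simp only [addX, curve]
  field_simp
  have h4 : (y ^ 2) = x * (x ^ 2 + A * x + B) := h
  ring_nf
  ring_nf at h4
  rw [show y ^ 2 = x * B + x ^ 2 * A + x ^ 3 by rw [h4]]
  ring

theorem pt_add_pt {x₁ y₁ x₂ y₂ : Qt} (h₁ : y₁ ^ 2 = x₁ * (x₁ ^ 2 + A * x₁ + B))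
    (h₂ : y₂ ^ 2 = x₂ * (x₂ ^ 2 + A * x₂ + B)) (hx : x₁ ≠ x₂) :
    ∃ (x' y' : Qt) (h' : y' ^ 2 = x' * (x' ^ 2 + A * x' + B)),
      pt h₁ + pt h₂ = pt h' ∧ x' = ((y₁ - y₂) / (x₁ - x₂)) ^ 2 - A - x₁ - x₂ := by
  refine ⟨_, _, (curve_equation_iff _ _).1
    (nonsingular_add ((equation_iff_nonsingular).1 ((curve_equation_iff x₁ y₁).2 h₁))
      ((equation_iff_nonsingular).1 ((curve_equation_iff x₂ y₂).2 h₂)) fun hxy => hx hxy.1).1,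
    Point.add_of_X_ne hx, ?_⟩
  rw [slope_of_X_ne hx]
  simp only [addX, curve]
  ring

theorem pt_sub_pt {x₁ y₁ x₂ y₂ : Qt} (h₁ : y₁ ^ 2 = x₁ * (x₁ ^ 2 + A * x₁ + B))
    (h₂ : y₂ ^ 2 = x₂ * (x₂ ^ 2 + A * x₂ + B)) (hx : x₁ ≠ x₂) :
    ∃ (x' y' : Qt) (h' : y' ^ 2 = x' * (x' ^ 2 + A * x' + B)),
      pt h₁ - pt h₂ = pt h' ∧ x' = ((y₁ + y₂) / (x₁ - x₂)) ^ 2 - A - x₁ - x₂ := by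
  obtain ⟨x', y', h', e, hx'⟩ := pt_add_pt h₁ (x₂ := x₂) (y₂ := -y₂) (by rw [neg_sq, h₂]) hx
  exact ⟨x', y', h', by rw [sub_eq_add_neg, neg_pt, e], by rw [hx', sub_neg_eq_add]⟩

/-- The image of an affine point under `P ↦ 2P` has a prescribed `x`-coordinate. -/
theorem exists_two_nsmul_eq {x y x' y' : Qt} (h : y ^ 2 = x * (x ^ 2 + A * x + B))
    (h' : y' ^ 2 = x' * (x' ^ 2 + A * x' + B)) (hy : y ≠ 0)
    (hx : x' * (4 * y ^ 2) = (x ^ 2 - B) ^ 2) : ∃ R : (curve A B).Point, pt h' = 2 • R := by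
  obtain ⟨x₁, y₁, h₁, e, hx₁⟩ := pt_add_self h hy
  have : x₁ = x' := by
    have : (4 * y ^ 2 : Qt) ≠ 0 := mul_ne_zero (by norm_num) (pow_ne_zero 2 hy)
    exact mul_right_cancel₀ this (hx₁.trans hx.symm)
  subst this
  rcases pt_eq_or_eq_neg h' h₁ with h2 | h2
  · exact ⟨pt h, by rw [two_nsmul, e, h2]⟩
  · exact ⟨-pt h, by rw [two_nsmul, ← neg_add, e, h2]⟩

/-- Halving via the two dual 2-isogenies. -/
theorem exists_two_nsmul_of_sq {w v z : Qt} (hz : z ≠ 0)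
    (hv : v ^ 2 = w ^ 4 + A * w ^ 2 + B) (hX : 2 * w ^ 2 + A + 2 * v = z ^ 2)
    {y : Qt} (h : y ^ 2 = (w ^ 2) * ((w ^ 2) ^ 2 + A * (w ^ 2) + B)) :
    ∃ R : (curve A B).Point, pt h = 2 • R := by
  -- The conjugates w² + v ± wz have product B, and their sum plus A is z². So (x, zx) lies on the
  -- curve, and doubling it gives x-coordinate (x - B/x)²/(4z²) = w².
  obtain ⟨x, hxe⟩ : ∃ x, x = w ^ 2 + v + w * z := ⟨_, rfl⟩
  have hA : A = z ^ 2 - 2 * w ^ 2 - 2 * v := by linear_combination hX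
  have hBx : B = (w ^ 2 + v) ^ 2 - (w * z) ^ 2 := by linear_combination -hv - w ^ 2 * hX
  have hx0 : x ≠ 0 := by
    intro h0
    have : B = 0 := by
      rw [hBx]; rw [hxe] at h0
      linear_combination (w ^ 2 + v - w * z) * h0
    exact B_ne_zero (A := A) this
  have hR : (z * x) ^ 2 = x * (x ^ 2 + A * x + B) := by
    rw [hBx, hxe, hA]; ring
  refine exists_two_nsmul_eq hR h (mul_ne_zero hz hx0) ?_
  rw [hBx, hxe]; ring

/-- The class of `x` modulo squares is additive on points. -/
theorem sub_pt_cases {x₁ y₁ x₂ y₂ : Qt} (h₁ : y₁ ^ 2 = x₁ * (x₁ ^ 2 + A * x₁ + B))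
    (h₂ : y₂ ^ 2 = x₂ * (x₂ ^ 2 + A * x₂ + B)) :
    pt h₁ = pt h₂ ∨ pt h₁ = -pt h₂ ∨
      ∃ (x' y' u : Qt) (h' : y' ^ 2 = x' * (x' ^ 2 + A * x' + B)),
        pt h₁ - pt h₂ = pt h' ∧ x₁ * x₂ * x' = u ^ 2 := by
  by_cases hx : x₁ = x₂
  · subst hx
    rcases pt_eq_or_eq_neg h₁ h₂ with h | h
    · exact .inl h
    · exact .inr (.inl h)
  · refine .inr (.inr ?_)
    obtain ⟨x', y', h', e, hx'⟩ := pt_sub_pt h₁ h₂ hx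
    refine ⟨x', y', (x₁ * y₂ + x₂ * y₁) / (x₁ - x₂), h', e, ?_⟩
    have hd : x₁ - x₂ ≠ 0 := sub_ne_zero.2 hx
    rw [hx']
    field_simp
    linear_combination (x₁ * x₂ - x₂ ^ 2) * h₁ - (x₁ ^ 2 - x₁ * x₂) * h₂

end GroupLaw

end KubertFamilies

end

open WeierstrassCurve

noncomputable section

namespace KubertFamilies

open WeierstrassCurve.Affine

/-! ### The map {P, Q} ↦ {P + Q, P - Q} on x-coordinates -/

section Sym

/-- The map `(x(P) x(Q) : x(P) + x(Q) : 1) ↦ (x(P+Q) x(P-Q) : x(P+Q) + x(P-Q) : 1)` for the curve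
`y² = x³ + a x² + b x`. -/
def addSub {R : Type*} [CommRing R] (a b : R) (v : Fin 3 → R) : Fin 3 → R :=
  ![(v 0 - b * v 2) ^ 2, 2 * v 1 * v 0 + 4 * a * v 0 * v 2 + 2 * b * v 1 * v 2,
    v 1 ^ 2 - 4 * v 0 * v 2]

/-- The symmetric product of two pairs of homogeneous coordinates. -/
def symProd {R : Type*} [CommRing R] (u v : Fin 2 → R) : Fin 3 → R :=
  ![u 0 * v 0, u 0 * v 1 + u 1 * v 0, u 1 * v 1]

theorem symProd_comm {R : Type*} [CommRing R] (u v : Fin 2 → R) : symProd u v = symProd v u := by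
  ext i; fin_cases i <;> simp [symProd] <;> ring

variable {A B : Qt} [(curve A B).IsElliptic] [DecidableEq Qt]

theorem addSub_symProd_self (P : (curve A B).Point) :
    ∃ c : Qt, c ≠ 0 ∧ addSub A B (symProd P.xRep P.xRep) =
      c • symProd (P + P).xRep (0 : (curve A B).Point).xRep := by
  rcases eq_zero_or_eq_pt P with rfl | ⟨x, y, h, rfl⟩
  · refine ⟨1, one_ne_zero, ?_⟩
    ext i; fin_cases i <;> simp [addSub, symProd]
  · by_cases hy : y = 0
    · rw [pt_add_self_of_eq_zero h hy]
      -- Here 2P = 0, so the image is a multiple of (1 : 0 : 0). The scalar could vanish only if x²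
      -- = B, which together with y = 0 gives A = -2x and A² = 4B.
      refine ⟨(x ^ 2 - B) ^ 2, pow_ne_zero _ fun h0 => ?_, ?_⟩
      · rw [hy] at h
        have hB : B = x ^ 2 := by linear_combination -h0
        have hx : x ≠ 0 := by
          rintro rfl
          exact B_ne_zero (A := A) (by simpa using hB)
        have h1 : x ^ 2 * (2 * x + A) = 0 := by rw [hB] at h; linear_combination -h
        have h2 : 2 * x + A = 0 := (mul_eq_zero.1 h1).resolve_left (pow_ne_zero 2 hx)
        exact disc_ne_zero (A := A) (B := B)
          (by rw [hB, show A = -2 * x by linear_combination h2]; ring)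
      · ext i; fin_cases i <;> simp [addSub, symProd, xRep_pt]
        · ring
        · rw [hy] at h
          linear_combination -4 * h
        · ring
    · obtain ⟨x', y', h', e, hx'⟩ := pt_add_self h hy
      refine ⟨4 * y ^ 2, mul_ne_zero (by norm_num) (pow_ne_zero 2 hy), ?_⟩
      rw [e]
      ext i; fin_cases i <;> simp [addSub, symProd, xRep_pt]
      · linear_combination -hx'
      · linear_combination -4 * h
      · ring

/-- The sum and product of x(P + Q) and x(P - Q) are rational functions of those of x(P) and x(Q),
because the products y₁y₂ cancel. Working up to a scalar covers the degenerate cases too, and every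
height estimate starts from this identity. -/
theorem addSub_symProd (P Q : (curve A B).Point) :
    ∃ c : Qt, c ≠ 0 ∧ addSub A B (symProd P.xRep Q.xRep) =
      c • symProd (P + Q).xRep (P - Q).xRep := by
  rcases eq_zero_or_eq_pt P with rfl | ⟨x₁, y₁, h₁, rfl⟩
  · refine ⟨1, one_ne_zero, ?_⟩
    rw [zero_add, zero_sub, Point.xRep_neg]
    ext i; fin_cases i <;> simp [addSub, symProd] <;> ring
  rcases eq_zero_or_eq_pt Q with rfl | ⟨x₂, y₂, h₂, rfl⟩
  · refine ⟨1, one_ne_zero, ?_⟩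
    rw [add_zero, sub_zero]
    ext i; fin_cases i <;> simp [addSub, symProd] <;> ring
  by_cases hx : x₁ = x₂
  · subst hx
    rcases pt_eq_or_eq_neg h₂ h₁ with h | h
    · rw [h, sub_self]
      exact addSub_symProd_self _
    · rw [h, add_neg_cancel, sub_neg_eq_add, Point.xRep_neg, symProd_comm (Point.xRep 0)]
      exact addSub_symProd_self _
  · obtain ⟨x₃, y₃, h₃, e₃, hx₃⟩ := pt_add_pt h₁ h₂ hx
    obtain ⟨x₄, y₄, h₄, e₄, hx₄⟩ := pt_sub_pt h₁ h₂ hx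
    have hd : x₁ - x₂ ≠ 0 := sub_ne_zero.2 hx
    refine ⟨(x₁ - x₂) ^ 2, pow_ne_zero 2 hd, ?_⟩
    rw [e₃, e₄]
    have k₃ : (x₁ - x₂) ^ 2 * x₃ = (y₁ - y₂) ^ 2 - (A + x₁ + x₂) * (x₁ - x₂) ^ 2 := by
      rw [hx₃]; field_simp; ring
    have k₄ : (x₁ - x₂) ^ 2 * x₄ = (y₁ + y₂) ^ 2 - (A + x₁ + x₂) * (x₁ - x₂) ^ 2 := by
      rw [hx₄]; field_simp; ring
    ext i; fin_cases i <;> simp [addSub, symProd, xRep_pt]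
    · have : (x₁ - x₂) ^ 2 * ((x₁ * x₂ - B) ^ 2 - (x₁ - x₂) ^ 2 * (x₃ * x₄)) = 0 := by
        have : (x₁ - x₂) ^ 2 * ((x₁ - x₂) ^ 2 * (x₃ * x₄)) =
          (y₁ ^ 2 - y₂ ^ 2) ^ 2 - 2 * (y₁ ^ 2 + y₂ ^ 2) * ((A + x₁ + x₂) * (x₁ - x₂) ^ 2)
            + ((A + x₁ + x₂) * (x₁ - x₂) ^ 2) ^ 2 := by
          rw [show (x₁ - x₂) ^ 2 * ((x₁ - x₂) ^ 2 * (x₃ * x₄)) =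
            ((x₁ - x₂) ^ 2 * x₃) * ((x₁ - x₂) ^ 2 * x₄) by ring, k₃, k₄]
          ring
        rw [mul_sub, this, h₁, h₂]
        ring
      exact sub_eq_zero.1 ((mul_eq_zero.1 this).resolve_left (pow_ne_zero 2 hd))
    · linear_combination -k₃ - k₄ - 2 * h₁ - 2 * h₂
    · ring

end Sym

end KubertFamilies

end

open WeierstrassCurve

noncomputable section

namespace KubertFamilies

open WeierstrassCurve.Affine Polynomial

/-! ### Polynomial coordinates and the common factor in the addition formula -/

section Heights

/-- A polynomial vector whose entries generate the unit ideal. -/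
def IsPrimitiveVec {n : ℕ} (v : Fin n → ℚ[X]) : Prop := Ideal.span (Set.range v) = ⊤

theorem IsPrimitiveVec.exists_sum {n : ℕ} {v : Fin n → ℚ[X]} (hv : IsPrimitiveVec v) :
    ∃ g : Fin n → ℚ[X], ∑ i, g i * v i = 1 :=
  Ideal.mem_span_range_iff_exists_fun.1 ((Ideal.eq_top_iff_one _).1 hv)

/-- Gauss's lemma: the entries are the coefficients of a product of two linear forms, and modulo a
maximal ideal neither form vanishes. -/
theorem isPrimitiveVec_symProd {u v : Fin 2 → ℚ[X]} (hu : IsCoprime (u 0) (u 1))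
    (hv : IsCoprime (v 0) (v 1)) : IsPrimitiveVec (symProd u v) := by
  by_contra h
  obtain ⟨M, hM, hle⟩ := Ideal.exists_le_maximal _ h
  have hp := hM.isPrime
  have hm : ∀ i, symProd u v i ∈ M := fun i => hle (Ideal.subset_span ⟨i, rfl⟩)
  have key : ∀ x : Fin 2 → ℚ[X], IsCoprime (x 0) (x 1) → ¬(x 0 ∈ M ∧ x 1 ∈ M) := by
    rintro x ⟨c, d, hcd⟩ ⟨h0, h1⟩
    exact hp.ne_top ((Ideal.eq_top_iff_one _).2
      (hcd ▸ M.add_mem (M.mul_mem_left c h0) (M.mul_mem_left d h1)))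
  have h0 : u 0 * v 0 ∈ M := hm 0
  have h1 : u 0 * v 1 + u 1 * v 0 ∈ M := hm 1
  have h2 : u 1 * v 1 ∈ M := hm 2
  have ku := key u hu
  have kv := key v hv
  rcases hp.mem_or_mem h0 with a | a
  · have h3 : u 1 * v 0 ∈ M := (M.add_mem_iff_right (M.mul_mem_right _ a)).1 h1
    rcases hp.mem_or_mem h2 with b | b
    · exact ku ⟨a, b⟩
    · rcases hp.mem_or_mem h3 with c | c
      · exact ku ⟨a, c⟩
      · exact kv ⟨c, b⟩
  · have h3 : u 0 * v 1 ∈ M := (M.add_mem_iff_left (M.mul_mem_left _ a)).1 h1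
    rcases hp.mem_or_mem h2 with b | b
    · rcases hp.mem_or_mem h3 with c | c
      · exact ku ⟨c, b⟩
      · exact kv ⟨a, c⟩
    · exact kv ⟨a, b⟩

/-- A Bézout relation ∑ eᵢwᵢ = 1 gives c = ∑ eᵢvᵢ, so the scalar is itself a polynomial. -/
theorem IsPrimitiveVec.exists_eq_mul {n : ℕ} {v w : Fin n → ℚ[X]} (hw : IsPrimitiveVec w) {c : Qt}
    (hc : c ≠ 0) (h : ∀ i, algebraMap ℚ[X] Qt (v i) = c * algebraMap ℚ[X] Qt (w i)) :
    ∃ g : ℚ[X], g ≠ 0 ∧ ∀ i, v i = g * w i := by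
  obtain ⟨e, he⟩ := hw.exists_sum
  have hcg : c = algebraMap ℚ[X] Qt (∑ i, e i * v i) := by
    rw [map_sum]
    simp_rw [map_mul, h]
    have := congrArg (algebraMap ℚ[X] Qt) he
    rw [map_sum, map_one] at this
    simp_rw [map_mul] at this
    conv_lhs => rw [← mul_one c, ← this, Finset.mul_sum]
    exact Finset.sum_congr rfl fun i _ => by ring
  refine ⟨∑ i, e i * v i, ?_, fun i => ?_⟩
  · rintro h0
    exact hc (by rw [hcg, h0, map_zero])
  · apply IsFractionRing.injective ℚ[X] Qt
    rw [h, map_mul, ← hcg]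

theorem IsPrimitiveVec.dvd_of_dvd_mul_pow {n : ℕ} {s : Fin n → ℚ[X]} (hs : IsPrimitiveVec s)
    {g d : ℚ[X]} {k : ℕ} (h : ∀ i, g ∣ d * s i ^ k) : g ∣ d := by
  have h1 : Ideal.span ((· ^ k) '' Set.range s) = ⊤ := Ideal.span_pow_eq_top _ hs k
  have h2 : ∀ x ∈ Ideal.span ((· ^ k) '' Set.range s), g ∣ d * x := by
    intro x hx
    induction hx using Submodule.span_induction with
    | mem x hx => obtain ⟨_, ⟨i, rfl⟩, rfl⟩ := hx; exact h i
    | zero => simp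
    | add x y _ _ hx hy => rw [mul_add]; exact dvd_add hx hy
    | smul c x _ hx => rw [smul_eq_mul, mul_left_comm]; exact hx.mul_left c
  simpa using h2 1 (h1 ▸ Submodule.mem_top)

/-- Coprime polynomial homogeneous coordinates of the `x`-coordinate of a point. -/
def polyRep {W : Affine Qt} : W.Point → Fin 2 → ℚ[X]
  | .zero => ![1, 0]
  | .some x _ _ => ![x.num, x.denom]

theorem isCoprime_polyRep {W : Affine Qt} (P : W.Point) :
    IsCoprime (polyRep P 0) (polyRep P 1) := by
  match P with
  | .zero => exact isCoprime_one_left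
  | .some x _ _ => exact RatFunc.isCoprime_num_denom x

theorem exists_xRep_eq {W : Affine Qt} (P : W.Point) :
    ∃ c : Qt, c ≠ 0 ∧ ∀ i, algebraMap ℚ[X] Qt (polyRep P i) = c * P.xRep i := by
  match P with
  | .zero => exact ⟨1, one_ne_zero, fun i => by fin_cases i <;> simp [polyRep, Point.xRep]⟩
  | .some x _ _ =>
    have h0 : algebraMap ℚ[X] Qt x.denom ≠ 0 := RatFunc.algebraMap_ne_zero x.denom_ne_zero
    refine ⟨algebraMap ℚ[X] Qt x.denom, h0, fun i => ?_⟩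
    fin_cases i
    · simp only [polyRep, Point.xRep, Fin.zero_eta, Matrix.cons_val_zero]
      rw [mul_comm]
      exact (div_eq_iff h0).1 (RatFunc.num_div_denom x)
    · simp [polyRep, Point.xRep]

theorem addSub_map {R S : Type*} [CommRing R] [CommRing S] (f : R →+* S) (a b : R)
    (v : Fin 3 → R) (i : Fin 3) : f (addSub a b v i) = addSub (f a) (f b) (fun j => f (v j)) i := by
  fin_cases i <;> simp [addSub, map_ofNat f]

theorem symProd_map {R S : Type*} [CommRing R] [CommRing S] (f : R →+* S)
    (u v : Fin 2 → R) (i : Fin 3) :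
    f (symProd u v i) = symProd (fun j => f (u j)) (fun j => f (v j)) i := by
  fin_cases i <;> simp [symProd]

theorem addSub_smul {R : Type*} [CommRing R] (a b c : R) (v : Fin 3 → R) :
    addSub a b (fun i => c * v i) = fun i => c ^ 2 * addSub a b v i := by
  ext i; fin_cases i <;> simp [addSub] <;> ring

theorem symProd_smul {R : Type*} [CommRing R] (c d : R) (u v : Fin 2 → R) :
    symProd (fun i => c * u i) (fun i => d * v i) = fun i => c * d * symProd u v i := by
  ext i; fin_cases i <;> simp [symProd] <;> ring

/-- Quadratic forms expressing `Δ · vᵢ⁴` through the forms in `addSub a b v`. -/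
def addSubCoeff {R : Type*} [CommRing R] (a b : R) (v : Fin 3 → R) : Fin 3 → Fin 3 → R :=
  ![![(16 * a ^ 2 * b ^ 2 - 64 * b ^ 3) * v 0 * v 0 + (-16 * a * b ^ 3) * v 0 * v 1 +
        (-12 * b ^ 4) * v 1 * v 1,
      (8 * a * b ^ 3) * v 0 * v 0 + (-10 * b ^ 4) * v 0 * v 1 + (-4 * a * b ^ 4) * v 0 * v 2 +
        (6 * b ^ 5) * v 1 * v 2,
      (32 * b ^ 4) * v 0 * v 0 + (-16 * b ^ 5) * v 0 * v 2],
    ![(64 * b ^ 2) * v 1 * v 1,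
      (-32 * b ^ 2) * v 0 * v 1 + (16 * a * b ^ 2) * v 1 * v 1 + (-32 * b ^ 3) * v 1 * v 2,
      (-32 * a * b ^ 2) * v 0 * v 1 + (16 * a ^ 2 * b ^ 2 - 64 * b ^ 3) * v 1 * v 1 +
        (-32 * a * b ^ 3) * v 1 * v 2],
    ![(-12) * v 1 * v 1 + (-16 * a) * v 1 * v 2 + (16 * a ^ 2 - 64 * b) * v 2 * v 2,
      6 * v 0 * v 1 + (-4 * a) * v 0 * v 2 + (-10 * b) * v 1 * v 2 + (8 * a * b) * v 2 * v 2,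
      (-16 * b) * v 0 * v 2 + (32 * b ^ 2) * v 2 * v 2]]

/-- An explicit Nullstellensatz certificate: the three forms have no common zero as long as the
discriminant does not vanish. It supplies the lower bound for the degree height and bounds the
cancellation in the addition formula. -/
theorem sum_addSubCoeff {R : Type*} [CommRing R] (a b : R) (v : Fin 3 → R) (i : Fin 3) :
    ∑ j, addSubCoeff a b v i j * addSub a b v j = 16 * b ^ 2 * (a ^ 2 - 4 * b) * v i ^ 4 := by
  rw [Fin.sum_univ_three]
  fin_cases i <;> simp [addSub, addSubCoeff] <;> ring

variable {a b : ℚ[X]}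

/-- The curve `y² = x³ + a x² + b x` with polynomial coefficients. -/
abbrev polyCurve (a b : ℚ[X]) : Affine Qt := curve (algebraMap ℚ[X] Qt a) (algebraMap ℚ[X] Qt b)

variable [(polyCurve a b).IsElliptic] [DecidableEq Qt]

/-- The factor g is all that cancels in the addition formula. By the certificate it divides Δ·sᵢ⁴
for every i, hence Δ since s is primitive. So g has bounded degree and does not vanish at a value r
of good reduction. -/
theorem addSub_polyRep (P Q : (polyCurve a b).Point) :
    ∃ g : ℚ[X], g ≠ 0 ∧ g ∣ 16 * b ^ 2 * (a ^ 2 - 4 * b) ∧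
      ∀ i, addSub a b (symProd (polyRep P) (polyRep Q)) i =
        g * symProd (polyRep (P + Q)) (polyRep (P - Q)) i := by
  obtain ⟨c, hc, h⟩ := addSub_symProd P Q
  obtain ⟨c₁, hc₁, h₁⟩ := exists_xRep_eq P
  obtain ⟨c₂, hc₂, h₂⟩ := exists_xRep_eq Q
  obtain ⟨c₃, hc₃, h₃⟩ := exists_xRep_eq (P + Q)
  obtain ⟨c₄, hc₄, h₄⟩ := exists_xRep_eq (P - Q)
  obtain ⟨g, hg, e⟩ := IsPrimitiveVec.exists_eq_mul (c := (c₁ * c₂) ^ 2 * c * (c₃ * c₄)⁻¹)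
    (v := addSub a b (symProd (polyRep P) (polyRep Q)))
    (isPrimitiveVec_symProd (isCoprime_polyRep (P + Q)) (isCoprime_polyRep (P - Q)))
    (by positivity) (fun i => by
      rw [addSub_map, symProd_map]
      simp_rw [symProd_map, h₁, h₂, h₃, h₄, symProd_smul, addSub_smul, h]
      simp only [Pi.smul_apply, smul_eq_mul]
      field_simp)
  refine ⟨g, hg, ?_, e⟩
  refine (isPrimitiveVec_symProd (isCoprime_polyRep P) (isCoprime_polyRep Q)).dvd_of_dvd_mul_pow
    (k := 4) fun i => ?_
  rw [← sum_addSubCoeff]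
  refine Finset.dvd_sum fun j _ => ?_
  rw [e]
  exact (dvd_mul_right g _).mul_left _

end Heights

end KubertFamilies

end

open WeierstrassCurve

noncomputable section

namespace KubertFamilies

open WeierstrassCurve.Affine Polynomial Height

/-! ### The degree height and its parallelogram law -/

section DegreeHeight

/-- The maximal degree of the entries of a polynomial vector. -/
def maxDegree {n : ℕ} (v : Fin n → ℚ[X]) : ℕ := Finset.univ.sup fun i => (v i).natDegree

theorem natDegree_le_maxDegree {n : ℕ} (v : Fin n → ℚ[X]) (i : Fin n) :
    (v i).natDegree ≤ maxDegree v :=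
  Finset.le_sup (f := fun i => (v i).natDegree) (Finset.mem_univ i)

theorem maxDegree_le {n : ℕ} {v : Fin n → ℚ[X]} {d : ℕ} (h : ∀ i, (v i).natDegree ≤ d) :
    maxDegree v ≤ d :=
  Finset.sup_le fun i _ => h i

theorem maxDegree_symProd {u v : Fin 2 → ℚ[X]} (hu : IsCoprime (u 0) (u 1))
    (hv : IsCoprime (v 0) (v 1)) : maxDegree (symProd u v) = maxDegree u + maxDegree v := by
  have key : ∀ w : Fin 2 → ℚ[X], IsCoprime (w 0) (w 1) →
      maxDegree w = max (w 0).natDegree (w 1).natDegree ∧ (w 0 ≠ 0 ∨ w 1 ≠ 0) := by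
    intro w hw
    refine ⟨?_, by simpa [not_and_or] using hw.ne_zero_or_ne_zero⟩
    simp [maxDegree, Fin.univ_succ]
  obtain ⟨eu, nu⟩ := key u hu
  obtain ⟨ev, nv⟩ := key v hv
  have hdeg : ∀ p q : ℚ[X], p ≠ 0 → q ≠ 0 → (p * q).natDegree = p.natDegree + q.natDegree :=
    fun p q hp hq => natDegree_mul hp hq
  have n0 := natDegree_le_maxDegree (symProd u v) 0
  have n1 := natDegree_le_maxDegree (symProd u v) 1
  have n2 := natDegree_le_maxDegree (symProd u v) 2
  have m0 : (u 0 * v 0).natDegree ≤ maxDegree (symProd u v) := n0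
  have m1 : (u 0 * v 1 + u 1 * v 0).natDegree ≤ maxDegree (symProd u v) := n1
  have m2 : (u 1 * v 1).natDegree ≤ maxDegree (symProd u v) := n2
  have l0 := natDegree_mul_le (p := u 0) (q := v 0)
  have l1 := natDegree_mul_le (p := u 0) (q := v 1)
  have l2 := natDegree_mul_le (p := u 1) (q := v 0)
  have l3 := natDegree_mul_le (p := u 1) (q := v 1)
  have l4 := natDegree_add_le (u 0 * v 1) (u 1 * v 0)
  refine le_antisymm (maxDegree_le fun i => ?_) ?_
  · fin_cases i
    · change (u 0 * v 0).natDegree ≤ _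
      omega
    · change (u 0 * v 1 + u 1 * v 0).natDegree ≤ _
      omega
    · change (u 1 * v 1).natDegree ≤ _
      omega
  -- Choose in each vector an entry of largest degree, giving ties to entry 1. With this convention,
  -- when the two choices differ, one summand of the middle entry strictly dominates and nothing
  -- cancels.
  · have pivot : ∀ w : Fin 2 → ℚ[X], (w 0 ≠ 0 ∨ w 1 ≠ 0) →
        maxDegree w = max (w 0).natDegree (w 1).natDegree →
        ((w 0).degree ≤ (w 1).degree ∧ w 1 ≠ 0 ∧ maxDegree w = (w 1).natDegree) ∨
        ((w 1).degree < (w 0).degree ∧ w 0 ≠ 0 ∧ maxDegree w = (w 0).natDegree) := by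
      intro w hw e
      rcases le_or_gt (w 0).degree (w 1).degree with h | h
      · refine .inl ⟨h, ?_, by rw [e, max_eq_right (natDegree_le_natDegree h)]⟩
        rintro h1
        rw [h1, degree_zero, le_bot_iff, degree_eq_bot] at h
        exact hw.elim (· h) (· h1)
      · exact .inr ⟨h, ne_zero_of_degree_gt h,
          by rw [e, max_eq_left (natDegree_le_natDegree h.le)]⟩
    have hlt : ∀ p q r s : ℚ[X], p.degree < q.degree → r.degree ≤ s.degree → s ≠ 0 →
        (p * r).degree < (q * s).degree := by
      intro p q r s h h' hs
      rw [degree_mul, degree_mul]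
      exact (add_le_add_right h' _).trans_lt
        (WithBot.add_lt_add_right (by rwa [Ne, degree_eq_bot]) h)
    rcases pivot u nu eu with ⟨du, u1, eu⟩ | ⟨du, u0, eu⟩ <;>
    rcases pivot v nv ev with ⟨dv, v1, ev⟩ | ⟨dv, v0, ev⟩
    · rw [eu, ev, ← hdeg _ _ u1 v1]
      exact m2
    · rw [eu, ev, ← hdeg _ _ u1 v0, ← natDegree_add_eq_right_of_degree_lt
        (by simpa only [mul_comm] using hlt _ _ _ _ dv du u1)]
      exact m1
    · rw [eu, ev, ← hdeg _ _ u0 v1, ← natDegree_add_eq_left_of_degree_lt (hlt _ _ _ _ du dv v1)]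
      exact m1
    · rw [eu, ev, ← hdeg _ _ u0 v0]
      exact m0

/-- A function on polynomial triples whose degree grows at most like that of a quadratic form. -/
def QuadBound (f : (Fin 3 → ℚ[X]) → ℚ[X]) : Prop :=
  ∃ C : ℕ, ∀ s, (f s).natDegree ≤ C + 2 * maxDegree s

theorem QuadBound.monomial (k : ℚ[X]) (i j : Fin 3) : QuadBound fun s => k * s i * s j := by
  refine ⟨k.natDegree, fun s => ?_⟩
  have h1 := natDegree_mul_le (p := k * s i) (q := s j)
  have h2 := natDegree_mul_le (p := k) (q := s i)
  have h3 := natDegree_le_maxDegree s i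
  have h4 := natDegree_le_maxDegree s j
  beta_reduce
  omega

theorem QuadBound.add {f g : (Fin 3 → ℚ[X]) → ℚ[X]} (hf : QuadBound f) (hg : QuadBound g) :
    QuadBound fun s => f s + g s := by
  obtain ⟨C, hC⟩ := hf
  obtain ⟨D, hD⟩ := hg
  refine ⟨max C D, fun s => ?_⟩
  have h1 := natDegree_add_le (f s) (g s)
  have h2 := hC s
  have h3 := hD s
  beta_reduce
  omega

theorem QuadBound.congr {f g : (Fin 3 → ℚ[X]) → ℚ[X]} (hf : QuadBound f) (h : ∀ s, f s = g s) :
    QuadBound g := by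
  rwa [← show f = g from funext h]

theorem exists_bound_fin {n : ℕ} {p : Fin n → ℕ → Prop} (hp : ∀ i, ∃ C, p i C)
    (hmono : ∀ i C D, C ≤ D → p i C → p i D) : ∃ C, ∀ i, p i C := by
  choose C hC using hp
  exact ⟨Finset.univ.sup C, fun i => hmono i _ _ (Finset.le_sup (Finset.mem_univ i)) (hC i)⟩

theorem exists_natDegree_addSub_le (a b : ℚ[X]) :
    ∃ C : ℕ, ∀ s, maxDegree (addSub a b s) ≤ C + 2 * maxDegree s := by
  have h : ∀ i, QuadBound fun s => addSub a b s i := by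
    intro i
    fin_cases i
    · exact (((QuadBound.monomial 1 0 0).add (.monomial (-2 * b) 0 2)).add
        (.monomial (b ^ 2) 2 2)).congr fun s => by simp [addSub]; ring
    · exact (((QuadBound.monomial 2 1 0).add (.monomial (4 * a) 0 2)).add
        (.monomial (2 * b) 1 2)).congr fun s => by simp [addSub]
    · exact ((QuadBound.monomial 1 1 1).add (.monomial (-4) 0 2)).congr
        fun s => by simp [addSub]; ring
  obtain ⟨C, hC⟩ := exists_bound_fin h fun i C D hCD h s => (h s).trans (by omega)
  exact ⟨C, fun s => maxDegree_le fun i => hC i s⟩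

theorem exists_natDegree_addSubCoeff_le (a b : ℚ[X]) :
    ∃ C : ℕ, ∀ i j s, (addSubCoeff a b s i j).natDegree ≤ C + 2 * maxDegree s := by
  have h : ∀ i j, QuadBound fun s => addSubCoeff a b s i j := by
    intro i j
    have h1 : ∀ k i j, QuadBound fun s => k * s i * s j := .monomial
    have h2 : ∀ k₁ k₂ i₁ j₁ i₂ j₂, QuadBound fun s => k₁ * s i₁ * s j₁ + k₂ * s i₂ * s j₂ :=
      fun _ _ _ _ _ _ => (h1 _ _ _).add (h1 _ _ _)
    have h3 : ∀ k₁ k₂ k₃ i₁ j₁ i₂ j₂ i₃ j₃, QuadBound fun s =>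
        k₁ * s i₁ * s j₁ + k₂ * s i₂ * s j₂ + k₃ * s i₃ * s j₃ :=
      fun _ _ _ _ _ _ _ _ _ => (h2 _ _ _ _ _ _).add (h1 _ _ _)
    have h4 : ∀ k₁ k₂ k₃ k₄ i₁ j₁ i₂ j₂ i₃ j₃ i₄ j₄, QuadBound fun s =>
        k₁ * s i₁ * s j₁ + k₂ * s i₂ * s j₂ + k₃ * s i₃ * s j₃ + k₄ * s i₄ * s j₄ :=
      fun _ _ _ _ _ _ _ _ _ _ _ _ => (h3 _ _ _ _ _ _ _ _ _).add (h1 _ _ _)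
    fin_cases i <;> fin_cases j <;> simp only [addSubCoeff, Fin.zero_eta, Fin.mk_one,
      Fin.reduceFinMk, Matrix.cons_val]
    · exact h3 _ _ _ _ _ _ _ _ _
    · exact h4 _ _ _ _ _ _ _ _ _ _ _ _
    · exact h2 _ _ _ _ _ _
    · exact h1 _ _ _
    · exact h3 _ _ _ _ _ _ _ _ _
    · exact h3 _ _ _ _ _ _ _ _ _
    · exact h3 _ _ _ _ _ _ _ _ _
    · exact h4 _ _ _ _ _ _ _ _ _ _ _ _
    · exact h2 _ _ _ _ _ _
  choose C hC using fun i => exists_bound_fin (h i) fun j C D hCD h s => (h s).trans (by omega)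
  refine ⟨Finset.univ.sup C, fun i j s => (hC i j s).trans ?_⟩
  have := Finset.le_sup (f := C) (Finset.mem_univ i)
  omega

variable {a b : ℚ[X]} [(polyCurve a b).IsElliptic]

theorem disc_poly_ne_zero : 16 * b ^ 2 * (a ^ 2 - 4 * b) ≠ 0 := by
  have h1 := B_ne_zero (A := algebraMap ℚ[X] Qt a) (B := algebraMap ℚ[X] Qt b)
  have h2 := disc_ne_zero (A := algebraMap ℚ[X] Qt a) (B := algebraMap ℚ[X] Qt b)
  refine mul_ne_zero (mul_ne_zero (by norm_num) (pow_ne_zero 2 ?_)) ?_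
  · rintro rfl; simp at h1
  · intro h
    apply h2
    have := congrArg (algebraMap ℚ[X] Qt) h
    simpa [map_ofNat (algebraMap ℚ[X] Qt)] using this

variable [DecidableEq Qt]

variable (a b) in
-- The upper bound holds because the addition formula is quadratic in s, the lower one because of
-- the certificate for Δ·sᵢ⁴. Additivity of the degree on `symProd` turns both into statements about
-- the points.
theorem degree_parallelogram : ∃ C : ℝ, ∀ P Q : (polyCurve a b).Point,
    |(maxDegree (polyRep (P + Q)) : ℝ) + maxDegree (polyRep (P - Q)) -
      2 * (maxDegree (polyRep P) + maxDegree (polyRep Q))| ≤ C := by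
  obtain ⟨C, hC⟩ := exists_natDegree_addSub_le a b
  obtain ⟨D, hD⟩ := exists_natDegree_addSubCoeff_le a b
  obtain ⟨d, hd⟩ : ∃ d, d = 16 * b ^ 2 * (a ^ 2 - 4 * b) := ⟨_, rfl⟩
  have hd0 : d ≠ 0 := hd ▸ disc_poly_ne_zero
  refine ⟨C + D + d.natDegree, fun P Q => ?_⟩
  obtain ⟨g, hg, hgd, e⟩ := addSub_polyRep P Q
  have e1 := maxDegree_symProd (isCoprime_polyRep P) (isCoprime_polyRep Q)
  have e2 := maxDegree_symProd (isCoprime_polyRep (P + Q)) (isCoprime_polyRep (P - Q))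
  set s := symProd (polyRep P) (polyRep Q)
  set w := symProd (polyRep (P + Q)) (polyRep (P - Q))
  have upper : maxDegree w ≤ C + 2 * maxDegree s := by
    refine maxDegree_le fun i => ?_
    by_cases hw : w i = 0
    · simp [hw]
    · have h1 := (natDegree_le_maxDegree (addSub a b s) i).trans (hC s)
      rw [e, natDegree_mul hg hw] at h1
      omega
  have lower : 2 * maxDegree s ≤ D + d.natDegree + maxDegree w := by
    rw [← hd] at hgd
    have hgd' := natDegree_le_of_dvd hgd hd0
    have h1 : ∀ i, 4 * (s i).natDegree ≤ D + 2 * maxDegree s + d.natDegree + maxDegree w := by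
      intro i
      by_cases hs : s i = 0
      · simp [hs]
      · have h2 := sum_addSubCoeff a b s i
        have h3 : (d * s i ^ 4).natDegree = d.natDegree + 4 * (s i).natDegree := by
          rw [natDegree_mul hd0 (pow_ne_zero _ hs), natDegree_pow]
        rw [← hd] at h2
        have h4 : (∑ j, addSubCoeff a b s i j * addSub a b s j).natDegree ≤
            D + 2 * maxDegree s + d.natDegree + maxDegree w := by
          refine natDegree_sum_le_of_forall_le _ _ fun j _ => ?_
          rw [e]
          have k1 := natDegree_mul_le (p := addSubCoeff a b s i j) (q := g * w j)
          have k2 := natDegree_mul_le (p := g) (q := w j)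
          have k3 := hD i j s
          have k4 := natDegree_le_maxDegree w j
          omega
        rw [h2, h3] at h4
        omega
    have h2 : maxDegree s ≤ (D + 2 * maxDegree s + d.natDegree + maxDegree w) / 4 :=
      maxDegree_le fun i => by have := h1 i; omega
    omega
  rw [← Nat.cast_add, ← Nat.cast_add, ← e1, ← e2, abs_le]
  have u' : (maxDegree w : ℝ) ≤ C + 2 * maxDegree s := by exact_mod_cast upper
  have l' : 2 * (maxDegree s : ℝ) ≤ D + d.natDegree + maxDegree w := by exact_mod_cast lower
  have : (0 : ℝ) ≤ C := Nat.cast_nonneg C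
  have : (0 : ℝ) ≤ D := Nat.cast_nonneg D
  have : (0 : ℝ) ≤ d.natDegree := Nat.cast_nonneg _
  constructor <;> linarith

end DegreeHeight

/-! ### Heights of specializations at good rational values -/

section SpecialHeight

variable {a b : ℚ[X]}

/-- The height of the specialization at `r` of the `x`-coordinate of a point. -/
def specHeight (r : ℚ) {W : Affine Qt} (P : W.Point) : ℝ :=
  logHeight fun i => (polyRep P i).eval r

theorem specHeight_nonneg (r : ℚ) {W : Affine Qt} (P : W.Point) : 0 ≤ specHeight r P :=
  logHeight_nonneg _

theorem polyRep_eval_ne_zero (r : ℚ) {W : Affine Qt} (P : W.Point) :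
    ![(polyRep P 0).eval r, (polyRep P 1).eval r] ≠ 0 := by
  obtain ⟨c, d, h⟩ := isCoprime_polyRep P
  intro h0
  have h1 : (polyRep P 0).eval r = 0 := congrFun h0 0
  have h2 : (polyRep P 1).eval r = 0 := congrFun h0 1
  have := congrArg (eval r) h
  simp [h1, h2] at this

/-- The specialization at `r` of the curve `y² = x³ + a x² + b x`. -/
def specCurve (a b : ℚ[X]) (r : ℚ) : WeierstrassCurve ℚ where
  a₁ := 0
  a₂ := a.eval r
  a₃ := 0
  a₄ := b.eval r
  a₆ := 0

theorem specCurve_isElliptic {r : ℚ} (hr : (16 * b ^ 2 * (a ^ 2 - 4 * b)).eval r ≠ 0) :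
    (specCurve a b r).IsElliptic := by
  constructor
  rw [isUnit_iff_ne_zero]
  convert hr using 1
  simp [specCurve, WeierstrassCurve.Δ, b₂, b₄, b₆, b₈]
  ring

theorem addSubMap_specCurve (r : ℚ) (v : Fin 3 → ℚ) :
    (fun i => (addSubMap (specCurve a b r) i).eval v) = addSub (a.eval r) (b.eval r) v := by
  ext i
  fin_cases i <;> simp [addSubMap, specCurve, addSub, b₂, b₄, b₆, b₈] <;> ring

variable [(polyCurve a b).IsElliptic] [DecidableEq Qt]

/-- Only coordinates are specialized, so no reduction homomorphism is needed. Since g(r) ≠ 0, it is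
a scalar to which the projective height is insensitive, and the estimates for the specialized curve
over ℚ apply. -/
theorem specHeight_parallelogram {r : ℚ} (hr : (16 * b ^ 2 * (a ^ 2 - 4 * b)).eval r ≠ 0) :
    ∃ C : ℝ, ∀ P Q : (polyCurve a b).Point,
      |specHeight r (P + Q) + specHeight r (P - Q) -
        2 * (specHeight r P + specHeight r Q)| ≤ C := by
  have hE := specCurve_isElliptic hr
  obtain ⟨C₁, h₁⟩ := (specCurve a b r).abs_logHeight_addSubMap_sub_two_mul_logHeight_le
  obtain ⟨C₂, h₂⟩ := abs_logHeight_sym2_sub_le ℚ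
  have hsym : ∀ P Q : (polyCurve a b).Point,
      |logHeight (fun i => (symProd (polyRep P) (polyRep Q) i).eval r) -
        (specHeight r P + specHeight r Q)| ≤ C₂ := by
    intro P Q
    have h := h₂ (polyRep_eval_ne_zero r P) (polyRep_eval_ne_zero r Q)
    convert h using 3
    · congr 1
      ext i; fin_cases i <;> simp [symProd]
    · congr 1 <;> rw [specHeight] <;> congr 1 <;> ext i <;> (fin_cases i) <;> rfl
  refine ⟨C₁ + 3 * C₂, fun P Q => ?_⟩
  obtain ⟨g, hg, ⟨k, hk⟩, e⟩ := addSub_polyRep P Q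
  have hgr : g.eval r ≠ 0 := by
    intro h0
    apply hr
    rw [hk, eval_mul, h0, zero_mul]
  have h3 := h₁ fun i => (symProd (polyRep P) (polyRep Q) i).eval r
  rw [addSubMap_specCurve] at h3
  have h4 : (addSub (a.eval r) (b.eval r) fun i => (symProd (polyRep P) (polyRep Q) i).eval r) =
      g.eval r • fun i => (symProd (polyRep (P + Q)) (polyRep (P - Q)) i).eval r := by
    ext i
    have := addSub_map (evalRingHom r) a b (symProd (polyRep P) (polyRep Q)) i
    rw [e] at this
    simpa using this.symm
  rw [h4, logHeight_smul_eq_logHeight _ hgr] at h3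
  have h5 := hsym P Q
  have h6 := hsym (P + Q) (P - Q)
  rw [abs_le] at *
  constructor <;> linarith

end SpecialHeight

end KubertFamilies

end

open WeierstrassCurve

noncomputable section

namespace KubertFamilies

open WeierstrassCurve.Affine Polynomial Height

/-! ### From E = H + 2E to odd multiples in H -/

section Descent

/-- If `G = H + 2G` with `H` finite and `G` carries enough height functions satisfying the
approximate parallelogram law, then every element has an odd multiple in `H`. -/
theorem exists_odd_nsmul_mem {G : Type*} [AddCommGroup G] {H : AddSubgroup G}
    (hH : (H : Set G).Finite) (hdiv : ∀ P : G, ∃ τ ∈ H, ∃ R, P = τ + 2 • R) {ι : Type*}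
    (h : ι → G → ℝ) (h0 : ∀ i P, 0 ≤ h i P)
    (hpar : ∀ i, ∃ C, ∀ P Q, |h i (P + Q) + h i (P - Q) - 2 * (h i P + h i Q)| ≤ C)
    (hfin : ∀ c : ι → ℝ, ∃ s : Finset ι, {P | ∀ i ∈ s, h i P ≤ c i}.Finite) (P : G) :
    ∃ r : ℕ, Odd r ∧ r • P ∈ H := by
  choose τ hτ f hf using hdiv
  -- The parallelogram law gives 4h(fQ) ≤ h(Q - τ) + O(1) and h(Q - τ) ≤ 2h(Q) + O(1), on dropping
  -- h(Q + τ) ≥ 0. The error is uniform because τ ranges over the finite set H.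
  have hcontr : ∀ i, ∃ D : ℝ, ∀ Q, h i (f Q) ≤ h i Q / 2 + D := by
    intro i
    obtain ⟨C, hC⟩ := hpar i
    obtain ⟨M, hM⟩ := (hH.image (h i)).bddAbove
    refine ⟨(2 * M + 2 * C + h i 0) / 4, fun Q => ?_⟩
    have h1 := (abs_le.1 (hC (f Q) (f Q))).1
    have h2 := (abs_le.1 (hC Q (τ Q))).2
    have h3 : h i (τ Q) ≤ M := hM ⟨_, hτ Q, rfl⟩
    have h4 : Q - τ Q = f Q + f Q := by
      rw [← two_nsmul, sub_eq_iff_eq_add']; exact hf Q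
    rw [h4] at h2
    rw [sub_self] at h1
    have h5 := h0 i (Q + τ Q)
    linarith
  choose D hD using hcontr
  have hiter : ∀ i n, h i (f^[n] P) ≤ h i P / 2 ^ n + 2 * max (D i) 0 := by
    intro i n
    induction n with
    | zero => simp
    | succ n ih =>
      rw [Function.iterate_succ_apply', pow_succ, ← div_div]
      have := hD i (f^[n] P)
      have := le_max_left (D i) 0
      linarith
  -- The constants D i vary with i without a common bound. Hence the finite index set is chosen only
  -- after all the bounds are known, and only finitely many heights have to become small.
  obtain ⟨s, hs⟩ := hfin fun i => 2 * max (D i) 0 + 1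
  have hev : ∀ᶠ n in Filter.atTop, ∀ i ∈ s, h i (f^[n] P) ≤ 2 * max (D i) 0 + 1 := by
    rw [Filter.eventually_all_finset]
    intro i _
    have ht : Filter.Tendsto (fun n : ℕ => h i P / 2 ^ n) Filter.atTop (nhds 0) :=
      tendsto_const_nhds.div_atTop (tendsto_pow_atTop_atTop_of_one_lt one_lt_two)
    filter_upwards [ht.eventually (gt_mem_nhds one_pos)] with n hn
    linarith [hiter i n]
  obtain ⟨N, hN⟩ := Filter.eventually_atTop.1 hev
  have htel : ∀ k Q, ∃ σ ∈ H, Q = σ + 2 ^ k • f^[k] Q := by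
    intro k
    induction k with
    | zero => exact fun Q => ⟨0, H.zero_mem, by simp⟩
    | succ k ih =>
      intro Q
      obtain ⟨σ, hσ, e⟩ := ih (f Q)
      refine ⟨τ Q + 2 • σ, H.add_mem (hτ Q) (H.nsmul_mem hσ 2), ?_⟩
      rw [Function.iterate_succ_apply, pow_succ', mul_smul, add_assoc, ← nsmul_add, ← e]
      exact hf Q
  have := hs.to_subtype
  -- The tail of the orbit lies in a finite set, so some iterate Q recurs. Telescoping gives Q = σ +
  -- 2ᵏ⁺¹Q with σ in H, hence an odd multiple of Q in H.
  obtain ⟨n, m, hnm, e⟩ := Finite.exists_ne_map_eq_of_infinite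
    fun n : ℕ => (⟨f^[N + n] P, hN _ (Nat.le_add_right N n)⟩ :
      {P | ∀ i ∈ s, h i P ≤ 2 * max (D i) 0 + 1})
  wlog hlt : n < m generalizing n m
  · exact this m n hnm.symm e.symm (lt_of_le_of_ne (not_lt.1 hlt) hnm.symm)
  have e' : f^[N + n] P = f^[N + m] P := congrArg Subtype.val e
  obtain ⟨k, rfl⟩ := Nat.exists_eq_add_of_lt hlt
  obtain ⟨σ, hσ, e₁⟩ := htel (k + 1) (f^[N + n] P)
  rw [← Function.iterate_add_apply, show k + 1 + (N + n) = N + (n + k + 1) by ring, ← e'] at e₁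
  obtain ⟨ρ, hρ, e₂⟩ := htel (N + n) P
  set Q := f^[N + n] P
  have hQ : (2 ^ (k + 1) - 1) • Q ∈ H := by
    have : (2 ^ (k + 1) - 1) • Q = -σ := by
      have h1 : (2 ^ (k + 1) - 1) • Q + Q = 2 ^ (k + 1) • Q := by
        rw [← succ_nsmul, Nat.sub_add_cancel Nat.one_le_two_pow]
      have h2 : 2 ^ (k + 1) • Q = Q - σ := by rw [eq_sub_iff_add_eq']; exact e₁.symm
      rw [h2] at h1
      rw [← sub_eq_of_eq_add h1.symm]
      abel
    rw [this]
    exact H.neg_mem hσ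
  refine ⟨2 ^ (k + 1) - 1, ?_, ?_⟩
  · exact Nat.Even.sub_odd Nat.one_le_two_pow (by simp [Nat.even_pow]) odd_one
  · rw [e₂, nsmul_add, smul_comm]
    exact H.add_mem (H.nsmul_mem hρ _) (H.nsmul_mem hQ _)

theorem polyRep_cross {W : Affine Qt} {P Q : W.Point}
    (h : polyRep P 0 * polyRep Q 1 = polyRep Q 0 * polyRep P 1) : P = Q ∨ P = -Q := by
  obtain ⟨c, hc, h₁⟩ := exists_xRep_eq P
  obtain ⟨d, hd, h₂⟩ := exists_xRep_eq Q
  have h3 := congrArg (algebraMap ℚ[X] Qt) h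
  rw [map_mul, map_mul, h₁, h₁, h₂, h₂] at h3
  have h4 : P.xRep 0 * Q.xRep 1 = Q.xRep 0 * P.xRep 1 := by
    have : c * d ≠ 0 := mul_ne_zero hc hd
    exact mul_left_cancel₀ this (by linear_combination h3)
  apply Point.eq_or_eq_neg_of_xRep_eq_xRep
  match P, Q with
  | .zero, .zero => rfl
  | .zero, .some .. => simp [Point.xRep] at h4
  | .some .., .zero => simp [Point.xRep] at h4
  | .some .., .some .. =>
    simp only [Point.xRep, Matrix.cons_val_zero, Matrix.cons_val_one, mul_one] at h4
    simp [Point.xRep, h4]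

variable {a b : ℚ[X]}

theorem infinite_good (d : ℚ[X]) (hd : d ≠ 0) : {r : ℚ | d.eval r ≠ 0}.Infinite := by
  have : {r : ℚ | d.eval r ≠ 0} = {r | d.IsRoot r}ᶜ := rfl
  rw [this]
  exact (finite_setOfPred_isRoot hd).infinite_compl

/-- By Northcott over ℚ, the specializations of x at S take finitely many values in ℙ¹(ℚ), with
`none` standing for ∞. Two rational functions of degree at most D that agree at more than 2D points
are equal, so each fibre is contained in {P, -P}. -/
theorem finite_of_bounded_heights (D : ℕ) (c : ℚ → ℝ) (S : Finset ℚ) (hS : 2 * D < S.card) :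
    {P : (polyCurve a b).Point | maxDegree (polyRep P) ≤ D ∧
      ∀ r ∈ S, specHeight r P ≤ c r}.Finite := by
  classical
  let Φ : (polyCurve a b).Point → S → Option ℚ := fun P r =>
    if (polyRep P 1).eval r.1 = 0 then none
    else some ((polyRep P 0).eval r.1 / (polyRep P 1).eval r.1)
  refine Set.Finite.of_finite_fibers Φ ?_ ?_
  · refine (Set.Finite.pi (t := fun r : S => insert none (some '' {q : ℚ | logHeight₁ q ≤ c r}))
      fun r => (((NumberField.finite_setOfPred_logHeight₁_le ℚ) _).image _).insert _).subset ?_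
    rintro _ ⟨P, ⟨-, hP⟩, rfl⟩ r -
    by_cases h : (polyRep P 1).eval r.1 = 0
    · simp [Φ, h]
    · refine Set.mem_insert_of_mem _ ⟨_, ?_, (if_neg h).symm⟩
      have := hP r.1 r.2
      rw [Set.mem_ofPred_eq, logHeight₁_div_eq_logHeight]
      refine le_trans (le_of_eq ?_) this
      rw [specHeight]
      congr 1
      ext i; fin_cases i <;> rfl
  · rintro _ ⟨P, ⟨hP, -⟩, rfl⟩
    refine ((Set.finite_singleton P).insert (-P)).subset ?_
    rintro Q ⟨⟨hQ, -⟩, hQP⟩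
    have key : polyRep Q 0 * polyRep P 1 = polyRep P 0 * polyRep Q 1 := by
      rw [← sub_eq_zero]
      by_contra hne
      refine hne (eq_zero_of_natDegree_lt_card_of_eval_eq_zero' _ S (fun r hr => ?_) ?_)
      · have h1 : Φ Q ⟨r, hr⟩ = Φ P ⟨r, hr⟩ := congrFun hQP ⟨r, hr⟩
        simp only [Φ] at h1
        simp only [eval_sub, eval_mul]
        split_ifs at h1 with h2 h3 h3
        · simp [h2, h3]
        · rw [Option.some.injEq, div_eq_div_iff h2 h3] at h1
          linear_combination h1
      · refine lt_of_le_of_lt ((natDegree_sub_le _ _).trans ?_) hS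
        have := natDegree_mul_le (p := polyRep Q 0) (q := polyRep P 1)
        have := natDegree_mul_le (p := polyRep P 0) (q := polyRep Q 1)
        have := natDegree_le_maxDegree (polyRep P) 0
        have := natDegree_le_maxDegree (polyRep P) 1
        have := natDegree_le_maxDegree (polyRep Q) 0
        have := natDegree_le_maxDegree (polyRep Q) 1
        omega
    rcases polyRep_cross key with h | h
    · exact .inr h
    · exact .inl h

theorem exists_odd_nsmul_mem_curve [(polyCurve a b).IsElliptic] [DecidableEq Qt]
    {H : AddSubgroup (polyCurve a b).Point}
    (hH : (H : Set (polyCurve a b).Point).Finite)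
    (hdiv : ∀ P : (polyCurve a b).Point, ∃ τ ∈ H, ∃ R, P = τ + 2 • R)
    (P : (polyCurve a b).Point) : ∃ r : ℕ, Odd r ∧ r • P ∈ H := by
  obtain ⟨d, hd⟩ : ∃ d, d = 16 * b ^ 2 * (a ^ 2 - 4 * b) := ⟨_, rfl⟩
  have hd0 : d ≠ 0 := hd ▸ disc_poly_ne_zero
  -- The index `none` carries the degree height, and `some r` the height of the specialization at r.
  refine exists_odd_nsmul_mem hH hdiv (ι := Option {r : ℚ | d.eval r ≠ 0})
    (fun i P => i.elim (maxDegree (polyRep P) : ℝ) fun r => specHeight r.1 P) ?_ ?_ ?_ P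
  · rintro (_ | r) P
    · exact Nat.cast_nonneg _
    · exact specHeight_nonneg _ _
  · rintro (_ | r)
    · exact degree_parallelogram a b
    · exact specHeight_parallelogram (hd ▸ r.2)
  · intro c
    obtain ⟨S, hS, hcard⟩ := (infinite_good d hd0).exists_subset_card_eq (2 * ⌊c none⌋₊ + 1)
    classical
    refine ⟨insert none ((S.subtype fun r => d.eval r ≠ 0).map Function.Embedding.some), ?_⟩
    refine (finite_of_bounded_heights ⌊c none⌋₊
      (fun r => if hr : d.eval r ≠ 0 then c (some ⟨r, hr⟩) else 0) S (by omega)).subset ?_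
    intro P hP
    refine ⟨Nat.le_floor (hP none (Finset.mem_insert_self _ _)), fun r hr => ?_⟩
    have hr' : d.eval r ≠ 0 := hS hr
    rw [dif_pos hr']
    exact hP (some ⟨r, hr'⟩) 
      (Finset.mem_insert_of_mem (Finset.mem_map_of_mem _ (Finset.mem_subtype.2 hr)))

end Descent

end KubertFamilies

end

open WeierstrassCurve

noncomputable section

namespace KubertFamilies

open WeierstrassCurve.Affine Polynomial

/-! ### Doubling cycles of odd torsion points; integrality -/

section Cycles

/-- The coordinates of the points `2ᵏ P` for a point `P` of odd order. -/
structure DoublingCycle {R : Type*} [CommRing R] (a b : R) (x y : ℕ → R) (p : ℕ) : Prop where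
  pos : 0 < p
  periodic : ∀ k, x (k + p) = x k
  eqn : ∀ k, y k ^ 2 = x k * (x k ^ 2 + a * x k + b)
  ne_zero : ∀ k, y k ≠ 0
  double : ∀ k, x (k + 1) * (4 * y k ^ 2) = (x k ^ 2 - b) ^ 2

theorem DoublingCycle.map {R S : Type*} [CommRing R] [CommRing S] {a b : R} {x y : ℕ → R} {p : ℕ}
    (h : DoublingCycle a b x y p) (f : R →+* S) (hf : Function.Injective f) :
    DoublingCycle (f a) (f b) (fun k => f (x k)) (fun k => f (y k)) p where
  pos := h.pos
  periodic k := by rw [h.periodic]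
  eqn k := by simpa using congrArg f (h.eqn k)
  ne_zero k := by simpa using hf.ne (h.ne_zero k)
  double k := by simpa [map_ofNat f] using congrArg f (h.double k)

theorem DoublingCycle.of_map {R S : Type*} [CommRing R] [CommRing S] {a b : R} {x y : ℕ → R}
    {p : ℕ} (f : R →+* S) (hf : Function.Injective f)
    (h : DoublingCycle (f a) (f b) (fun k => f (x k)) (fun k => f (y k)) p) :
    DoublingCycle a b x y p where
  pos := h.pos
  periodic k := hf (h.periodic k)
  eqn k := hf (by simpa using h.eqn k)
  ne_zero k := fun h0 => h.ne_zero k (by simp [h0])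
  double k := hf (by simpa [map_ofNat f] using h.double k)

/-- Both cofactors are cubic in x, so 4x(2P) - x(P) stays bounded where x(P) has a pole: near the
origin of the group, doubling divides x by 4. -/
theorem DoublingCycle.four_mul_sub {R : Type*} [CommRing R] {a b : R} {x y : ℕ → R} {p : ℕ}
    (h : DoublingCycle a b x y p) (k : ℕ) :
    (4 * x (k + 1) - x k) * (x k * (x k ^ 2 + a * x k + b)) =
      -a * x k ^ 3 - 3 * b * x k ^ 2 + b ^ 2 := by
  have h1 := h.double k
  rw [h.eqn] at h1
  linear_combination h1

theorem exists_doublingCycle {A B : Qt} [(curve A B).IsElliptic] [DecidableEq Qt]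
    {P : (curve A B).Point} (hP : P ≠ 0) {N : ℕ} (hN : Odd N) (hNP : N • P = 0) :
    ∃ (x y : ℕ → Qt) (p : ℕ), DoublingCycle A B x y p ∧
      ∀ k, ∃ h : y k ^ 2 = x k * (x k ^ 2 + A * x k + B), 2 ^ k • P = pt h := by
  -- By Euler's theorem 2^φ(N) ≡ 1 modulo the odd number N, so the doublings of P repeat with period
  -- φ(N).
  obtain ⟨p, hp⟩ : ∃ p, p = N.totient := ⟨_, rfl⟩
  have hp0 : 0 < p := hp ▸ Nat.totient_pos.2 hN.pos
  have hmod : 2 ^ p • P = P := by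
    have h1 : 2 ^ p ≡ 1 [MOD N] := hp ▸ Nat.ModEq.pow_totient (Nat.coprime_two_left.2 hN)
    obtain ⟨c, hc⟩ := (Nat.modEq_iff_dvd' Nat.one_le_two_pow).1 h1.symm
    have h2 : 2 ^ p = N * c + 1 := by
      have := Nat.one_le_two_pow (n := p)
      omega
    rw [h2, add_smul, one_smul, mul_comm, mul_smul, hNP, nsmul_zero, zero_add]
  have hne : ∀ k, 2 ^ k • P ≠ 0 := by
    intro k hk
    have h1 : ∀ j, 2 ^ (p * j) • P = P := by
      intro j
      induction j with
      | zero => simp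
      | succ j ih => rw [mul_add, mul_one, pow_add, mul_smul, hmod, ih]
    apply hP
    rw [← h1 k, ← Nat.sub_add_cancel (Nat.le_mul_of_pos_left k hp0), pow_add, mul_smul, hk,
      nsmul_zero]
  have hpt : ∀ k, ∃ (x y : Qt) (h : y ^ 2 = x * (x ^ 2 + A * x + B)), 2 ^ k • P = pt h :=
    fun k => (eq_zero_or_eq_pt _).resolve_left (hne k)
  choose x y h e using hpt
  have hy : ∀ k, y k ≠ 0 := by
    intro k h0
    apply hne (k + 1)
    rw [pow_succ', mul_smul, e, two_nsmul, pt_add_self_of_eq_zero _ h0]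
  refine ⟨x, y, p, ⟨hp0, fun k => ?_, h, hy, fun k => ?_⟩, fun k => ⟨h k, e k⟩⟩
  · have h1 : 2 ^ (k + p) • P = 2 ^ k • P := by rw [pow_add, mul_smul, hmod]
    rw [e, e] at h1
    exact (pt_inj h1).1
  · obtain ⟨x', y', h', e', hx'⟩ := pt_add_self (h k) (hy k)
    have h1 : pt (h (k + 1)) = pt h' := by
      rw [← e, ← e', ← e, pow_succ', mul_smul, two_nsmul]
    rw [(pt_inj h1).1, hx']

/-- At a pole, 4ʲxₖ₊ⱼ - xₖ is integral for every j. After one period this reads (4ᵖ - 1)xₖ, and 4ᵖ -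
1 is a unit because nonzero integers have valuation 1. This is the absence of torsion in the formal
group in residue characteristic zero. -/
theorem DoublingCycle.valuation_le_one {K Γ : Type*} [Field K]
    [LinearOrderedCommGroupWithZero Γ] (v : Valuation K Γ) (hv : ∀ n : ℕ, n ≠ 0 → v n = 1)
    {a b : K} (ha : v a ≤ 1) (hb : v b ≤ 1) {x y : ℕ → K} {p : ℕ}
    (h : DoublingCycle a b x y p) (k : ℕ) : v (x k) ≤ 1 := by
  by_contra! hk
  have v4 : v 4 = 1 := by simpa using hv 4 (by norm_num)
  have v3 : v 3 = 1 := by simpa using hv 3 (by norm_num)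
  have step : ∀ j, 1 < v (x j) → v (4 * x (j + 1) - x j) ≤ 1 := by
    intro j hj
    have h0 : 0 < v (x j) := zero_lt_one.trans hj
    have h1 := congrArg v (h.four_mul_sub j)
    have h2 : v (x j ^ 2 + a * x j + b) = v (x j) ^ 2 := by
      rw [add_assoc, Valuation.map_add_eq_of_lt_left, map_pow]
      rw [map_pow]
      refine (v.map_add _ _).trans_lt (max_lt ?_ ?_)
      · rw [map_mul, sq]
        exact mul_lt_mul_of_pos_right (ha.trans_lt hj) h0
      · exact hb.trans_lt (one_lt_pow₀ hj two_ne_zero)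
    rw [map_mul, map_mul, h2, ← pow_succ'] at h1
    have h3 : v (-a * x j ^ 3 - 3 * b * x j ^ 2 + b ^ 2) ≤ v (x j) ^ 3 := by
      refine (v.map_add _ _).trans (max_le ((v.map_sub _ _).trans (max_le ?_ ?_)) ?_)
      · rw [map_mul, map_pow, Valuation.map_neg]
        exact mul_le_of_le_one_left' ha
      · rw [map_mul, map_mul, map_pow, v3, one_mul]
        exact (mul_le_of_le_one_left' hb).trans (pow_le_pow_right₀ hj.le (by norm_num))
      · rw [map_pow]
        exact (pow_le_one₀ zero_le hb).trans (one_le_pow₀ hj.le)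
    rw [← h1] at h3
    exact le_of_mul_le_mul_right (by rwa [one_mul]) (pow_pos h0 3)
  have main : ∀ j, 1 < v (x (k + j)) ∧ v (4 ^ j * x (k + j) - x k) ≤ 1 := by
    intro j
    induction j with
    | zero => simpa using hk
    | succ j ih =>
      have h1 := step _ ih.1
      have h2 : v (4 ^ (j + 1) * x (k + (j + 1)) - x k) ≤ 1 := by
        rw [show 4 ^ (j + 1) * x (k + (j + 1)) - x k =
          4 ^ j * (4 * x (k + j + 1) - x (k + j)) + (4 ^ j * x (k + j) - x k) by
            rw [← add_assoc]; ring]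
        refine (v.map_add _ _).trans (max_le ?_ ih.2)
        rw [map_mul, map_pow, v4, one_pow, one_mul]
        exact h1
      refine ⟨?_, h2⟩
      have h3 := Valuation.map_add_eq_of_lt_left v (h2.trans_lt hk)
      rw [add_comm, sub_add_cancel, map_mul, map_pow, v4, one_pow, one_mul] at h3
      rwa [h3]
  have hp := (main p).2
  rw [h.periodic, ← sub_one_mul, map_mul] at hp
  have h4 : v ((4 : K) ^ p - 1) = 1 := by
    have := hv (4 ^ p - 1) (by have := Nat.one_lt_pow h.pos.ne' (show 1 < 4 by norm_num); omega)
    rwa [Nat.cast_sub (Nat.one_le_pow p 4 (by norm_num)), Nat.cast_pow, Nat.cast_one, Nat.cast_ofNat] at this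
  rw [h4, one_mul] at hp
  exact hk.not_ge hp

theorem DoublingCycle.exists_polynomial {a b : ℚ[X]} {x y : ℕ → Qt} {p : ℕ}
    (h : DoublingCycle (algebraMap ℚ[X] Qt a) (algebraMap ℚ[X] Qt b) x y p) :
    ∃ f g : ℕ → ℚ[X], DoublingCycle a b f g p ∧ (∀ k, x k = algebraMap ℚ[X] Qt (f k)) ∧
      ∀ k, y k = algebraMap ℚ[X] Qt (g k) := by
  have hx : ∀ k, ∃ f : ℚ[X], algebraMap ℚ[X] Qt f = x k := by
    intro k
    refine IsDedekindDomain.HeightOneSpectrum.mem_integers_of_valuation_le_one Qt _ fun v => ?_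
    refine h.valuation_le_one (v.valuation Qt) (fun n hn => ?_) (v.valuation_le_one _)
      (v.valuation_le_one _) k
    have h1 : v.valuation Qt (algebraMap ℚ[X] Qt (C (n : ℚ))) *
        v.valuation Qt (algebraMap ℚ[X] Qt (C (n : ℚ)⁻¹)) = 1 := by
      rw [← map_mul, ← map_mul, ← C_mul, mul_inv_cancel₀ (Nat.cast_ne_zero.2 hn), C_1, map_one,
        map_one]
    have h2 : algebraMap ℚ[X] Qt (C (n : ℚ)) = n := by simp
    rw [h2] at h1
    have h3 := v.valuation_le_one (K := Qt) (C (n : ℚ)⁻¹)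
    have h4 : v.valuation Qt (n : Qt) ≤ 1 :=
      (congrArg _ h2.symm).trans_le (v.valuation_le_one (K := Qt) (C (n : ℚ)))
    refine le_antisymm h4 ?_
    rw [← h1]
    exact mul_le_of_le_one_right' h3
  choose f hf using hx
  have hy : ∀ k, ∃ g : ℚ[X], algebraMap ℚ[X] Qt g = y k := by
    intro k
    refine IsIntegrallyClosed.exists_algebraMap_eq_of_isIntegral_pow (n := 2) two_pos ?_
    rw [h.eqn k, ← hf]
    simp only [← map_mul, ← map_pow, ← map_add]
    exact isIntegral_algebraMap
  choose g hg using hy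
  refine ⟨f, g, ?_, fun k => (hf k).symm, fun k => (hg k).symm⟩
  refine DoublingCycle.of_map (algebraMap ℚ[X] Qt) (IsFractionRing.injective ℚ[X] Qt) ?_
  simpa only [hf, hg] using h

end Cycles

end KubertFamilies

end

open WeierstrassCurve

noncomputable section

namespace KubertFamilies

open WeierstrassCurve.Affine Polynomial

/-! ### Cycles at infinity and at nodal fibres -/

section LocalCycles

variable {a b : ℚ[X]} {x y : ℕ → ℚ[X]} {p : ℕ}

theorem DoublingCycle.x_ne_zero (h : DoublingCycle a b x y p) (k : ℕ) : x k ≠ 0 := by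
  intro h0
  have := h.eqn k
  rw [h0, zero_mul] at this
  exact h.ne_zero k (pow_eq_zero_iff two_ne_zero |>.1 this)

/-- The integrality argument at the place at infinity, where a, b and x carry the weights 2n, 4n and
2n. -/
theorem DoublingCycle.natDegree_le (h : DoublingCycle a b x y p) {n : ℕ}
    (ha : a.natDegree ≤ 2 * n) (hb : b.natDegree ≤ 4 * n) (k : ℕ) :
    (x k).natDegree ≤ 2 * n := by
  by_contra! hk
  have step : ∀ j, 2 * n < (x j).natDegree → (4 * x (j + 1) - x j).natDegree ≤ 2 * n := by
    intro j hj
    by_cases h0 : 4 * x (j + 1) - x j = 0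
    · simp [h0]
    have h1 := congrArg natDegree (h.four_mul_sub j)
    have h2 : (a * x j + b).natDegree < (x j ^ 2).natDegree := by
      refine (natDegree_add_le _ _).trans_lt ?_
      have := natDegree_mul_le (p := a) (q := x j)
      rw [natDegree_pow]
      omega
    have h3 : (x j ^ 2 + a * x j + b).natDegree = 2 * (x j).natDegree := by
      rw [add_assoc, natDegree_add_eq_left_of_natDegree_lt h2, natDegree_pow]
    have h4 : x j ^ 2 + a * x j + b ≠ 0 := by
      rintro h5
      rw [h5, natDegree_zero] at h3
      omega
    rw [natDegree_mul h0 (mul_ne_zero (h.x_ne_zero j) h4), natDegree_mul (h.x_ne_zero j) h4,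
      h3] at h1
    have e1 : (-a * x j ^ 3).natDegree ≤ 2 * n + 3 * (x j).natDegree := by
      refine natDegree_mul_le.trans ?_
      rw [natDegree_neg, natDegree_pow]
      omega
    have e2 : (3 * b * x j ^ 2).natDegree ≤ 2 * n + 3 * (x j).natDegree := by
      rw [mul_assoc]
      refine natDegree_mul_le.trans ?_
      rw [natDegree_ofNat, zero_add]
      refine natDegree_mul_le.trans ?_
      rw [natDegree_pow]
      omega
    have e3 : (b ^ 2).natDegree ≤ 2 * n + 3 * (x j).natDegree := by
      rw [natDegree_pow]
      omega
    have e4 := natDegree_add_le (-a * x j ^ 3 - 3 * b * x j ^ 2) (b ^ 2)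
    have e5 := natDegree_sub_le (-a * x j ^ 3) (3 * b * x j ^ 2)
    omega
  have main : ∀ j, (x (k + j)).natDegree = (x k).natDegree ∧
      (4 ^ j * x (k + j) - x k).natDegree ≤ 2 * n := by
    intro j
    induction j with
    | zero => simp
    | succ j ih =>
      have h1 := step _ (hk.trans_eq ih.1.symm)
      have h4 : ∀ (i : ℕ) (f : ℚ[X]), (4 ^ i * f).natDegree = f.natDegree := by
        intro i f
        rw [show (4 ^ i : ℚ[X]) = C (4 ^ i) by rw [C_pow]; rfl, natDegree_C_mul (by positivity)]
      have h2 : (4 ^ (j + 1) * x (k + (j + 1)) - x k).natDegree ≤ 2 * n := by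
        rw [show 4 ^ (j + 1) * x (k + (j + 1)) - x k =
          4 ^ j * (4 * x (k + j + 1) - x (k + j)) + (4 ^ j * x (k + j) - x k) by
            rw [← add_assoc]; ring]
        refine (natDegree_add_le _ _).trans (max_le ?_ ih.2)
        rwa [h4]
      refine ⟨?_, h2⟩
      have h3 := natDegree_add_eq_left_of_natDegree_lt (h2.trans_lt hk)
      rwa [add_sub_cancel, h4] at h3
  have hp := (main p).2
  rw [h.periodic, ← sub_one_mul] at hp
  have h4 : (4 ^ p - 1 : ℚ) ≠ 0 := sub_ne_zero.2 (one_lt_pow₀ (by norm_num) h.pos.ne').ne'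
  rw [show (4 ^ p - 1 : ℚ[X]) = C (4 ^ p - 1) by rw [C_sub, C_pow, C_1]; rfl, natDegree_C_mul h4] at hp
  omega

/-- The reduction y² = x²(x + α), with α = a(0) > 0, has its node at x = 0. Off the node doubling is
ξ ↦ ξ²/(4(ξ + α)), where ξ + α is a rational square. So the values are positive after one step and
then strictly decrease, which a periodic sequence cannot do. -/
theorem DoublingCycle.eval_zero_eq_zero (h : DoublingCycle a b x y p) (ha : 0 < a.eval 0)
    (hb : b.eval 0 = 0) (k : ℕ) : (x k).eval 0 = 0 := by
  by_contra hk
  obtain ⟨ξ, hξ⟩ : ∃ ξ : ℕ → ℚ, ∀ j, (x j).eval 0 = ξ j := ⟨_, fun _ => rfl⟩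
  obtain ⟨α, hα⟩ : ∃ α, a.eval 0 = α := ⟨_, rfl⟩
  rw [hα] at ha
  rw [hξ] at hk
  have step : ∀ j, ξ j ≠ 0 → 0 < ξ (j + 1) ∧ (0 < ξ j → ξ (j + 1) < ξ j) := by
    intro j hj
    have h1 := congrArg (eval 0) (h.double j)
    have h2 := congrArg (eval 0) (h.eqn j)
    simp only [eval_mul, eval_pow, eval_add, eval_sub, eval_ofNat, hξ, hα, hb] at h1 h2
    rw [h2] at h1
    have hs : 0 ≤ ξ j + α := by
      have : ξ j + α = ((y j).eval 0 / ξ j) ^ 2 := by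
        rw [div_pow, h2]
        field_simp
        ring
      rw [this]
      positivity
    have h3 : ξ (j + 1) * (4 * (ξ j + α)) = ξ j ^ 2 := by
      have : ξ j ^ 2 ≠ 0 := pow_ne_zero 2 hj
      refine mul_right_cancel₀ this ?_
      linear_combination h1
    have h4 : 0 < ξ j ^ 2 := by positivity
    have h5 : 0 < ξ (j + 1) := by
      rw [← h3] at h4
      exact pos_of_mul_pos_left h4 (by linarith)
    refine ⟨h5, fun h6 => ?_⟩
    by_contra! h7
    nlinarith [mul_le_mul_of_nonneg_right h7 (show 0 ≤ 4 * (ξ j + α) by linarith), mul_pos h6 ha]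
  have hpos : ∀ j, 0 < ξ (k + 1 + j) := by
    intro j
    induction j with
    | zero => exact (step k hk).1
    | succ j ih => exact (step _ ih.ne').1
  have hanti : StrictAnti fun j => ξ (k + 1 + j) :=
    strictAnti_nat_of_succ_lt fun j => (step _ (hpos j).ne').2 (hpos j)
  have := hanti h.pos
  simp only [add_zero] at this
  rw [← hξ, ← hξ, h.periodic] at this
  exact lt_irrefl _ this

theorem eq_of_X_pow_mul_eq {f g : ℚ[X]} {i j : ℕ} (h : X ^ i * f = X ^ j * g)
    (hf : f.eval 0 ≠ 0) (hg : g.eval 0 ≠ 0) : i = j := by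
  wlog hij : i ≤ j generalizing i j f g
  · exact (this h.symm hg hf (le_of_not_ge hij)).symm
  obtain ⟨d, rfl⟩ := Nat.exists_eq_add_of_le hij
  rw [pow_add, mul_assoc] at h
  have h1 := mul_left_cancel₀ (pow_ne_zero i X_ne_zero) h
  rcases Nat.eq_zero_or_pos d with rfl | hd
  · rfl
  · refine absurd ?_ hf
    rw [h1]
    simp [hd.ne']

/-- The components met by an odd-order cycle at a place where `b` vanishes to order `e`. -/
theorem DoublingCycle.exists_order (h : DoublingCycle a b x y p) (ha : 0 < a.eval 0) {e : ℕ}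
    (he : 0 < e) {b₀ : ℚ[X]} (hb : b = X ^ e * b₀) (hb₀ : b₀.eval 0 ≠ 0) :
    ∃ m : ℕ → ℕ, ∀ k, X ^ m k ∣ x k ∧ 1 ≤ m k ∧ m k < e ∧ 2 * m k ≠ e ∧
      m (k + 1) + 2 * m k = 2 * min (2 * m k) e := by
  have hx0 := h.eval_zero_eq_zero ha (by rw [hb]; simp [he.ne'])
  have hfac : ∀ k, ∃ (m : ℕ) (ξ : ℚ[X]), x k = X ^ m * ξ ∧ ξ.eval 0 ≠ 0 := by
    intro k
    obtain ⟨ξ, e1, e2⟩ := exists_eq_pow_rootMultiplicity_mul_and_not_dvd (x k) (h.x_ne_zero k) 0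
    rw [C_0, sub_zero] at e1 e2
    exact ⟨_, ξ, e1, fun h0 => e2 (X_dvd_iff.2 (by rwa [coeff_zero_eq_eval_zero]))⟩
  choose m ξ hm hξ using hfac
  have hm1 : ∀ k, 1 ≤ m k := by
    intro k
    rw [Nat.one_le_iff_ne_zero]
    intro h0
    apply hξ k
    have := hx0 k
    rwa [hm, h0, pow_zero, one_mul] at this
  have hF : ∀ k, x (k + 1) * (4 * (x k * (x k ^ 2 + a * x k + b))) = (x k ^ 2 - b) ^ 2 := by
    intro k; rw [← h.eqn, h.double]
  -- If Xᵉ divided x, cancelling X²ᵉ in the duplication formula would leave b₀(0)² on the right at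
  -- 0, against a zero on the left.
  have hlt : ∀ k, m k < e := by
    intro k
    by_contra! hk
    obtain ⟨d, hd⟩ := Nat.exists_eq_add_of_le hk
    have h1 : x k = X ^ e * (X ^ d * ξ k) := by rw [hm k, hd, pow_add, mul_assoc]
    have h2 := hF k
    rw [h1, hb] at h2
    have h3 : x (k + 1) * (4 * (X ^ d * ξ k) * (X ^ e * (X ^ d * ξ k) ^ 2 +
        a * (X ^ d * ξ k) + b₀)) = (X ^ e * (X ^ d * ξ k) ^ 2 - b₀) ^ 2 := by
      refine mul_left_cancel₀ (pow_ne_zero (2 * e) (X_ne_zero (R := ℚ))) ?_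
      linear_combination h2
    have h4 := congrArg (eval 0) h3
    rw [eval_mul, hx0, zero_mul] at h4
    simp only [eval_pow, eval_sub, eval_mul, eval_X, zero_pow he.ne', zero_mul, zero_sub] at h4
    exact hb₀ (by simpa using h4.symm)
  have hexp : ∀ k, ∃ u : ℚ[X], u.eval 0 ≠ 0 ∧
      X ^ (m (k + 1) + 2 * m k) * u = (x k ^ 2 - b) ^ 2 := by
    intro k
    obtain ⟨d, hd⟩ := Nat.exists_eq_add_of_lt (hlt k)
    refine ⟨ξ (k + 1) * (4 * ξ k * (X ^ m k * ξ k ^ 2 + a * ξ k + X ^ (d + 1) * b₀)), ?_, ?_⟩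
    · have hmk : m k ≠ 0 := Nat.one_le_iff_ne_zero.1 (hm1 k)
      simp only [eval_mul, eval_add, eval_pow, eval_X, zero_pow hmk, zero_pow d.succ_ne_zero,
        zero_mul, zero_add, add_zero, eval_ofNat]
      exact mul_ne_zero (hξ _) (mul_ne_zero (mul_ne_zero (by norm_num) (hξ k))
        (mul_ne_zero ha.ne' (hξ k)))
    · rw [← hF k, hb, hd, hm (k + 1), hm k]
      ring
  refine ⟨m, fun k => ?_⟩
  have hd : X ^ m k ∣ x k := ⟨_, hm k⟩
  obtain ⟨u, hu, hu'⟩ := hexp k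
  -- The fibre has type I₂ₑ, m is the component up to sign, and the recurrence is doubling in ℤ/2e.
  -- Equality would send the next point to component e, that is m(k + 1) ≥ e.
  have hne : 2 * m k ≠ e := by
    intro h2
    have h3 : X ^ (m (k + 1) + 2 * m k) * u = X ^ (2 * e) * (ξ k ^ 2 - b₀) ^ 2 := by
      rw [hu', hb, hm k, ← h2]
      ring
    have h4 : 2 * e ≤ m (k + 1) + 2 * m k := by
      by_contra! h5
      obtain ⟨d, hd⟩ := Nat.exists_eq_add_of_lt h5
      rw [hd, show m (k + 1) + 2 * m k + d + 1 = (m (k + 1) + 2 * m k) + (d + 1) by ring,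
        pow_add X _ (d + 1), mul_assoc] at h3
      have h6 := mul_left_cancel₀ (pow_ne_zero _ X_ne_zero) h3
      apply hu
      rw [h6]
      simp
    have := hlt (k + 1)
    omega
  refine ⟨hd, hm1 k, hlt k, hne, ?_⟩
  rcases lt_or_gt_of_ne hne with h2 | h2
  · obtain ⟨d, hd⟩ := Nat.exists_eq_add_of_lt h2
    rw [min_eq_left h2.le]
    refine eq_of_X_pow_mul_eq (g := (ξ k ^ 2 - X ^ (d + 1) * b₀) ^ 2) ?_ hu ?_
    · rw [hu', hb, hd, hm k]
      ring
    · simpa using hξ k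
  · obtain ⟨d, hd⟩ := Nat.exists_eq_add_of_lt h2
    rw [min_eq_right h2.le]
    refine eq_of_X_pow_mul_eq (g := (X ^ (d + 1) * ξ k ^ 2 - b₀) ^ 2) ?_ hu ?_
    · rw [hu', hb, hm k]
      have : (X ^ m k * ξ k) ^ 2 = X ^ e * (X ^ (d + 1) * ξ k ^ 2) := by
        rw [mul_pow, ← pow_mul, mul_comm (m k), hd]
        ring
      rw [this]
      ring
    · simpa using hb₀

theorem DoublingCycle.comp (h : DoublingCycle a b x y p) (r : ℚ) :
    DoublingCycle (a.comp (X + C r)) (b.comp (X + C r)) (fun k => (x k).comp (X + C r))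
      (fun k => (y k).comp (X + C r)) p := by
  refine h.map (compRingHom (X + C r)) fun f g hfg => ?_
  have := congrArg (fun q => q.comp (X - C r)) hfg
  simpa [comp_assoc] using this

theorem DoublingCycle.natDegree_y_le (h : DoublingCycle a b x y p) {n : ℕ}
    (ha : a.natDegree ≤ 2 * n) (hb : b.natDegree ≤ 4 * n) (k : ℕ) :
    (y k).natDegree ≤ 3 * n := by
  have h1 := congrArg natDegree (h.eqn k)
  have h2 := h.natDegree_le ha hb k
  rw [natDegree_pow] at h1
  have h3 := natDegree_mul_le (p := x k) (q := x k ^ 2 + a * x k + b)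
  have h4 : (x k ^ 2 + a * x k + b).natDegree ≤ 4 * n := by
    refine (natDegree_add_le _ _).trans (max_le ((natDegree_add_le _ _).trans (max_le ?_ ?_)) hb)
    · rw [natDegree_pow]; omega
    · refine natDegree_mul_le.trans ?_; omega
  omega

/-- The substitution t ↦ 1/t, with weight 2n for x and 3n for y, carries the place at infinity to 0,
so that the analysis of orders at 0 applies there. -/
theorem DoublingCycle.reflect (h : DoublingCycle a b x y p) {n : ℕ}
    (ha : a.natDegree ≤ 2 * n) (hb : b.natDegree ≤ 4 * n) :
    DoublingCycle (Polynomial.reflect (2 * n) a) (Polynomial.reflect (4 * n) b)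
      (fun k => Polynomial.reflect (2 * n) (x k)) (fun k => Polynomial.reflect (3 * n) (y k)) p := by
  have hx := h.natDegree_le ha hb
  have hy := h.natDegree_y_le ha hb
  have hx2 : ∀ k, Polynomial.reflect (4 * n) (x k ^ 2) = Polynomial.reflect (2 * n) (x k) ^ 2 := by
    intro k
    rw [sq, sq, ← reflect_mul _ _ (hx k) (hx k)]
    congr 1; ring
  have hy2 : ∀ k, Polynomial.reflect (6 * n) (y k ^ 2) = Polynomial.reflect (3 * n) (y k) ^ 2 := by
    intro k
    rw [sq, sq, ← reflect_mul _ _ (hy k) (hy k)]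
    congr 1; ring
  have dx2 : ∀ k, (x k ^ 2).natDegree ≤ 4 * n := by
    intro k; rw [natDegree_pow]; have := hx k; omega
  have dy2 : ∀ k, (y k ^ 2).natDegree ≤ 6 * n := by
    intro k; rw [natDegree_pow]; have := hy k; omega
  refine ⟨h.pos, fun k => by rw [h.periodic], fun k => ?_, fun k => ?_, fun k => ?_⟩
  · have d1 : (a * x k).natDegree ≤ 4 * n := by
      refine natDegree_mul_le.trans ?_; have := hx k; omega
    have d2 : (x k ^ 2 + a * x k + b).natDegree ≤ 4 * n :=
      (natDegree_add_le _ _).trans (max_le ((natDegree_add_le _ _).trans (max_le (dx2 k) d1)) hb)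
    have e1 : Polynomial.reflect (4 * n) (a * x k) =
        Polynomial.reflect (2 * n) a * Polynomial.reflect (2 * n) (x k) := by
      rw [← reflect_mul _ _ ha (hx k)]
      congr 1; ring
    rw [← hy2, h.eqn, ← hx2, ← e1, ← reflect_add, ← reflect_add, ← reflect_mul _ _ (hx k) d2]
    congr 1; ring
  · rw [Ne, reflect_eq_zero_iff]
    exact h.ne_zero k
  · have d1 : (x k ^ 2 - b).natDegree ≤ 4 * n :=
      (natDegree_sub_le _ _).trans (max_le (dx2 k) hb)
    have d2 : (4 * y k ^ 2).natDegree ≤ 6 * n := by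
      refine natDegree_mul_le.trans ?_
      rw [natDegree_ofNat, zero_add]
      exact dy2 k
    have e4 : 4 * Polynomial.reflect (3 * n) (y k) ^ 2 = Polynomial.reflect (6 * n) (4 * y k ^ 2) := by
      rw [← hy2, show (4 : ℚ[X]) = C 4 from rfl, reflect_C_mul]
    have e5 : Polynomial.reflect (2 * n) (x k) ^ 2 - Polynomial.reflect (4 * n) b =
        Polynomial.reflect (4 * n) (x k ^ 2 - b) := by
      rw [reflect_sub, hx2]
    rw [e4, e5, ← reflect_mul _ _ (hx (k + 1)) d2, h.double, sq (x k ^ 2 - b),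
      sq (Polynomial.reflect (4 * n) (x k ^ 2 - b)), ← reflect_mul _ _ d1 d1]
    congr 1; ring

end LocalCycles

end KubertFamilies

end

open WeierstrassCurve

noncomputable section

namespace KubertFamilies

open WeierstrassCurve.Affine Polynomial

/-! ### Descent by 2-isogeny: torsors and local conditions -/

section TwoIsogenyDescent

theorem exists_eq_squarefree_mul_sq {m : ℚ[X]} (hm : m ≠ 0) :
    ∃ d M : ℚ[X], Squarefree d ∧ m = d * M ^ 2 := by
  induction hn : m.natDegree using Nat.strong_induction_on generalizing m with
  | _ n ih =>
    by_cases hsq : Squarefree m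
    · exact ⟨m, 1, hsq, by ring⟩
    · simp only [Squarefree, not_forall] at hsq
      obtain ⟨u, ⟨v, hv⟩, hu⟩ := hsq
      have hu0 : u ≠ 0 := by rintro rfl; simp at hv; exact hm hv
      have hv0 : v ≠ 0 := by rintro rfl; simp at hv; exact hm hv
      have hud : 0 < u.natDegree := by
        rw [Nat.pos_iff_ne_zero]
        intro h0
        exact hu (isUnit_iff_degree_eq_zero.2 (by rw [degree_eq_natDegree hu0, h0]; rfl))
      have hlt : v.natDegree < n := by
        rw [← hn, hv, natDegree_mul (mul_ne_zero hu0 hu0) hv0, natDegree_mul hu0 hu0]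
        omega
      obtain ⟨d, M, hd, rfl⟩ := ih _ hlt hv0 rfl
      exact ⟨d, u * M, hd, by rw [hv]; ring⟩

/-- The first step of a descent by 2-isogeny. -/
theorem exists_descent_datum {a b : ℚ[X]} {x y : Qt} (hx : x ≠ 0)
    (h : y ^ 2 = x * (x ^ 2 + algebraMap ℚ[X] Qt a * x + algebraMap ℚ[X] Qt b)) :
    ∃ d M N W : ℚ[X], Squarefree d ∧ d ∣ b ∧ M ≠ 0 ∧ N ≠ 0 ∧ IsCoprime M N ∧
      x = algebraMap ℚ[X] Qt d * (algebraMap ℚ[X] Qt M / algebraMap ℚ[X] Qt N) ^ 2 ∧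
      4 * d * W ^ 2 = (2 * d * M ^ 2 + a * N ^ 2) ^ 2 - (a ^ 2 - 4 * b) * N ^ 4 := by
  obtain ⟨ι, hι⟩ : ∃ ι, ι = algebraMap ℚ[X] Qt := ⟨_, rfl⟩
  have hinj : Function.Injective ι := hι ▸ IsFractionRing.injective ℚ[X] Qt
  rw [← hι] at h ⊢
  obtain ⟨m, hm⟩ : ∃ m, m = x.num := ⟨_, rfl⟩
  obtain ⟨n, hn⟩ : ∃ n, n = x.denom := ⟨_, rfl⟩
  have hmn : IsCoprime m n := hm ▸ hn ▸ RatFunc.isCoprime_num_denom x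
  have hn0 : n ≠ 0 := hn ▸ x.denom_ne_zero
  have hm0 : m ≠ 0 := hm ▸ (RatFunc.num_ne_zero hx)
  have hn0' : ι n ≠ 0 := (map_ne_zero_iff ι hinj).2 hn0
  have hxe : x = ι m / ι n := by rw [hm, hn, hι]; exact (RatFunc.num_div_denom x).symm
  obtain ⟨q, hq⟩ : ∃ q, q = m ^ 2 + a * m * n + b * n ^ 2 := ⟨_, rfl⟩
  have hsq : (y * ι n ^ 2) ^ 2 = ι (n * (m * q)) := by
    rw [mul_pow, h, hxe, hq]
    simp only [map_mul, map_add, map_pow]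
    field_simp
  obtain ⟨Y, hY⟩ : ∃ Y, ι Y = y * ι n ^ 2 := by
    rw [hι]
    refine IsIntegrallyClosed.exists_algebraMap_eq_of_isIntegral_pow (n := 2) two_pos ?_
    rw [← hι, hsq, hι]
    exact isIntegral_algebraMap
  have hY2 : n * (m * q) = Y ^ 2 := hinj (by rw [map_pow, hY, hsq])
  have hcop : IsCoprime n (m * q) := by
    refine hmn.symm.mul_right ?_
    have : IsCoprime n (m ^ 2 + n * (a * m + b * n)) :=
      (IsCoprime.pow_right hmn.symm).add_mul_left_right _
    rw [hq]
    convert this using 1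
    ring
  -- The denominator is coprime to mq and their product is a square, so it is a square up to a unit.
  -- The unit is then absorbed into the numerator.
  obtain ⟨N, u, hN⟩ := exists_associated_pow_of_mul_eq_pow' hcop hY2
  obtain ⟨c, hc, hcu⟩ := Polynomial.isUnit_iff.1 u.isUnit
  have hc0 : c ≠ 0 := hc.ne_zero
  rw [← hcu] at hN
  have hN0 : N ≠ 0 := by rintro rfl; simp at hN; exact hn0 hN.symm
  obtain ⟨m', hm'⟩ : ∃ m', m = C c * m' :=
    ⟨C c⁻¹ * m, by rw [← mul_assoc, ← C_mul, mul_inv_cancel₀ hc0, C_1, one_mul]⟩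
  have hm'0 : m' ≠ 0 := by rintro rfl; simp at hm'; exact hm0 hm'
  have hC0 : (C c : ℚ[X]) ≠ 0 := C_ne_zero.2 hc0
  have hmN : IsCoprime m' N := by
    rw [hm', ← hN] at hmn
    exact (IsCoprime.of_mul_left_right hmn).of_isCoprime_of_dvd_right
      ((dvd_pow_self N two_ne_zero).mul_right _)
  have hxe' : x = ι m' / ι N ^ 2 := by
    rw [hxe, hm', ← hN, map_mul, map_mul, map_pow, mul_comm,
      mul_div_mul_right _ _ ((map_ne_zero_iff ι hinj).2 hC0)]
  have hN0' : ι N ≠ 0 := (map_ne_zero_iff ι hinj).2 hN0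
  obtain ⟨q', hq'⟩ : ∃ q', q' = m' ^ 2 + a * m' * N ^ 2 + b * N ^ 4 := ⟨_, rfl⟩
  have hsq' : (y * ι N ^ 3) ^ 2 = ι (m' * q') := by
    rw [mul_pow, h, hxe', hq']
    simp only [map_mul, map_add, map_pow]
    field_simp
  obtain ⟨Z, hZ⟩ : ∃ Z, ι Z = y * ι N ^ 3 := by
    rw [hι]
    refine IsIntegrallyClosed.exists_algebraMap_eq_of_isIntegral_pow (n := 2) two_pos ?_
    rw [← hι, hsq', hι]
    exact isIntegral_algebraMap
  have hZ2 : m' * q' = Z ^ 2 := hinj (by rw [map_pow, hZ, hsq'])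
  obtain ⟨d, M, hd, hdM⟩ := exists_eq_squarefree_mul_sq hm'0
  have hM0 : M ≠ 0 := by rintro rfl; simp at hdM; exact hm'0 hdM
  have hd0 : d ≠ 0 := hd.ne_zero
  have hMZ : M ∣ Z := by
    refine (IsIntegrallyClosed.pow_dvd_pow_iff two_ne_zero).1 ?_
    rw [← hZ2, hdM]
    exact ((dvd_mul_left _ _).mul_right _)
  obtain ⟨Z', rfl⟩ := hMZ
  have hZ' : d * q' = Z' ^ 2 := by
    refine mul_left_cancel₀ (pow_ne_zero 2 hM0) ?_
    rw [hdM] at hZ2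
    linear_combination hZ2
  have hdZ : d ∣ Z' := (hd.dvd_pow_iff_dvd two_ne_zero).1 (hZ' ▸ dvd_mul_right _ _)
  obtain ⟨W, rfl⟩ := hdZ
  -- With m' = dM² this is the torsor dW² = d²M⁴ + adM²N² + bN⁴. Multiplying by 4 and completing the
  -- square gives the final equation, while d coprime to N gives d ∣ b.
  have hW : q' = d * W ^ 2 := mul_left_cancel₀ hd0 (by linear_combination hZ')
  have hdN : IsCoprime d N := by
    rw [hdM] at hmN
    exact IsCoprime.of_mul_left_left hmN
  refine ⟨d, M, N, W, hd, ?_, hM0, hN0, ?_, ?_, ?_⟩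
  · refine (IsCoprime.pow_right hdN (n := 4)).dvd_of_dvd_mul_right ?_
    have : b * N ^ 4 = d * (W ^ 2 - d * M ^ 4 - a * M ^ 2 * N ^ 2) := by
      rw [hq', hdM] at hW
      linear_combination hW
    exact ⟨_, this⟩
  · rw [hdM] at hmN
    exact (IsCoprime.of_mul_left_right hmN).of_isCoprime_of_dvd_left (dvd_pow_self M two_ne_zero)
  · rw [hxe', hdM, map_mul, map_pow, div_pow, mul_div_assoc]
  · rw [hq', hdM] at hW
    linear_combination -4 * hW

/-- A squarefree divisor of `p ^ k * r` either divides `r` or is `p` times a divisor of `r`. -/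
theorem squarefree_dvd_cases {p d r : ℚ[X]} {k : ℕ} (hp : Irreducible p) (hd : Squarefree d)
    (h : d ∣ p ^ k * r) :
    (d ∣ r) ∨ ∃ d', Squarefree d' ∧ d = p * d' ∧ d' ∣ r := by
  by_cases hpd : p ∣ d
  · obtain ⟨d', rfl⟩ := hpd
    refine .inr ⟨d', hd.of_mul_right, rfl, ?_⟩
    have hcop : IsCoprime d' (p ^ k) := by
      refine IsCoprime.pow_right ((hp.coprime_iff_not_dvd.2 fun hpd' => ?_).symm)
      exact hp.not_isUnit (hd p (mul_dvd_mul_left p hpd'))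
    exact hcop.dvd_of_dvd_mul_left ((dvd_mul_left d' p).trans h)
  · exact .inl ((IsCoprime.pow_right (hp.coprime_iff_not_dvd.2 hpd).symm).dvd_of_dvd_mul_left h)

/-- The local condition at a place of multiplicative reduction away from the kernel. -/
theorem isSquare_or_of_node {F : Type*} [Field F] [NeZero (2 : F)] (ev : ℚ[X] →+* F)
    {a D d M N W : ℚ[X]}
    (h : 4 * d * W ^ 2 = (2 * d * M ^ 2 + a * N ^ 2) ^ 2 - D * N ^ 4) (hMN : IsCoprime M N)
    (hD : ev D = 0) (ha : ev a ≠ 0) (hd : ev d ≠ 0) :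
    (∃ z, z ≠ 0 ∧ ev d = z ^ 2) ∨ ∃ z, z ≠ 0 ∧ ev d = -2 * ev a * z ^ 2 := by
  have h2 : (2 : F) ≠ 0 := NeZero.ne 2
  have h1 := congrArg ev h
  simp only [map_mul, map_add, map_sub, map_pow, map_ofNat, hD] at h1
  -- Where D vanishes the torsor reads 4dW² = S². If S ≠ 0 then d is a square there; if S = 0 then
  -- 2dM² = -aN², so d is -2a times a square.
  by_cases hS : 2 * ev d * ev M ^ 2 + ev a * ev N ^ 2 = 0
  · right
    have hMN' : ¬(ev M = 0 ∧ ev N = 0) := by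
      rintro ⟨hM, hN⟩
      obtain ⟨u, v, huv⟩ := hMN
      have := congrArg ev huv
      simp [hM, hN] at this
    have hM : ev M ≠ 0 := by
      intro hM
      rw [hM] at hS
      have : ev N = 0 := by simpa [ha] using hS
      exact hMN' ⟨hM, this⟩
    have hN : ev N ≠ 0 := by
      intro hN
      rw [hN] at hS
      exact hM (by simpa [hd, h2] using hS)
    refine ⟨ev N / (2 * ev M), div_ne_zero hN (mul_ne_zero h2 hM), ?_⟩
    field_simp
    linear_combination hS
  · left
    have hW : ev W ≠ 0 := by
      intro hW
      rw [hW] at h1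
      apply hS
      have : (2 * ev d * ev M ^ 2 + ev a * ev N ^ 2) ^ 2 = 0 := by linear_combination -h1
      exact pow_eq_zero_iff two_ne_zero |>.1 this
    refine ⟨(2 * ev d * ev M ^ 2 + ev a * ev N ^ 2) / (2 * ev W),
      div_ne_zero hS (mul_ne_zero h2 hW), ?_⟩
    field_simp
    linear_combination h1

/-- The local condition at infinity. -/
theorem even_natDegree_of_node_infinity {a D d M N W : ℚ[X]} {n : ℕ}
    (h : 4 * d * W ^ 2 = (2 * d * M ^ 2 + a * N ^ 2) ^ 2 - D * N ^ 4) (hd : d ≠ 0) (hM : M ≠ 0)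
    (hN : N ≠ 0) (ha : a.natDegree = 2 * n) {c : ℚ} (hc : c ≠ 0)
    (hac : -2 * a.leadingCoeff = c ^ 2) (hD : D.natDegree < 4 * n) :
    Even d.natDegree ∧ ∃ z, z ≠ 0 ∧ d.leadingCoeff = z ^ 2 := by
  have ha0 : a ≠ 0 := by
    rintro rfl
    rw [leadingCoeff_zero, mul_zero] at hac
    exact hc (pow_eq_zero_iff two_ne_zero |>.1 hac.symm)
  obtain ⟨S, hS⟩ : ∃ S, S = 2 * d * M ^ 2 + a * N ^ 2 := ⟨_, rfl⟩
  have hDN : (D * N ^ 4).natDegree < 4 * n + 4 * N.natDegree := by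
    have := natDegree_mul_le (p := D) (q := N ^ 4)
    rw [natDegree_pow] at this
    omega
  rw [← hS] at h
  -- The same dichotomy at infinity. If S has small degree, the leading terms of 2dM² and aN²
  -- cancel; otherwise S² dominates DN⁴ and determines the leading term of 4dW².
  by_cases hlt : S.natDegree < 2 * n + 2 * N.natDegree
  · have e1 : (a * N ^ 2).natDegree = 2 * n + 2 * N.natDegree := by
      rw [natDegree_mul ha0 (pow_ne_zero 2 hN), natDegree_pow, ha]
    have e2 : 2 * d * M ^ 2 = S - a * N ^ 2 := by rw [hS]; ring
    have e3 : (2 * d * M ^ 2).natDegree = 2 * n + 2 * N.natDegree := by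
      rw [e2, natDegree_sub_eq_right_of_natDegree_lt (by omega), e1]
    have e4 : (2 * d * M ^ 2).leadingCoeff = -(a * N ^ 2).leadingCoeff := by
      rw [e2, sub_eq_add_neg, leadingCoeff_add_of_degree_lt, leadingCoeff_neg]
      rw [degree_neg]
      exact degree_lt_degree (by omega)
    have h2 : (2 : ℚ[X]) = C 2 := rfl
    rw [h2, mul_assoc, natDegree_C_mul two_ne_zero, natDegree_mul hd (pow_ne_zero 2 hM),
      natDegree_pow] at e3
    rw [h2] at e4
    simp only [leadingCoeff_mul, leadingCoeff_C, leadingCoeff_pow] at e4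
    have hM' : M.leadingCoeff ≠ 0 := leadingCoeff_ne_zero.2 hM
    refine ⟨⟨n + N.natDegree - M.natDegree, by omega⟩,
      c * N.leadingCoeff / (2 * M.leadingCoeff), ?_, ?_⟩
    · exact div_ne_zero (mul_ne_zero hc (leadingCoeff_ne_zero.2 hN)) (mul_ne_zero two_ne_zero hM')
    · rw [div_pow, mul_pow, mul_pow, ← hac]
      field_simp
      linear_combination e4
  · have hlt' : (D * N ^ 4).natDegree < (S ^ 2).natDegree := by
      rw [natDegree_pow]; omega
    have hS0 : S ≠ 0 := by
      rintro rfl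
      simp at hlt'
    have e1 : (4 * d * W ^ 2).natDegree = 2 * S.natDegree := by
      rw [h, natDegree_sub_eq_left_of_natDegree_lt hlt', natDegree_pow]
    have e2 : (4 * d * W ^ 2).leadingCoeff = S.leadingCoeff ^ 2 := by
      rw [h, sub_eq_add_neg, leadingCoeff_add_of_degree_lt', leadingCoeff_pow]
      rw [degree_neg]
      exact degree_lt_degree hlt'
    have hW : W ≠ 0 := by
      rintro rfl
      rw [zero_pow two_ne_zero, mul_zero, leadingCoeff_zero] at e2
      exact hS0 (leadingCoeff_eq_zero.1 (pow_eq_zero_iff two_ne_zero |>.1 e2.symm))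
    have h4 : (4 : ℚ[X]) = C 4 := rfl
    rw [h4, mul_assoc, natDegree_C_mul (by norm_num), natDegree_mul hd (pow_ne_zero 2 hW),
      natDegree_pow] at e1
    rw [h4] at e2
    simp only [leadingCoeff_mul, leadingCoeff_C, leadingCoeff_pow] at e2
    have hW' : W.leadingCoeff ≠ 0 := leadingCoeff_ne_zero.2 hW
    have hS' : S.leadingCoeff ≠ 0 := leadingCoeff_ne_zero.2 hS0
    refine ⟨⟨S.natDegree - W.natDegree, by omega⟩, S.leadingCoeff / (2 * W.leadingCoeff),
      div_ne_zero hS' (mul_ne_zero two_ne_zero hW'), ?_⟩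
    field_simp
    linear_combination e2

end TwoIsogenyDescent

end KubertFamilies

end

open WeierstrassCurve

noncomputable section

namespace KubertFamilies

open WeierstrassCurve.Affine Polynomial

/-! ### Translating classes modulo squares into E = H + 2E -/

section TwoDivisibility

variable {A B : Qt} [(curve A B).IsElliptic]

/-- The point `(0, 0)`. -/
def twoTorsionPt (A B : Qt) [(curve A B).IsElliptic] : (curve A B).Point :=
  pt (x := 0) (y := 0) (by ring)

theorem pt_eq_twoTorsionPt {x y : Qt} (h : y ^ 2 = x * (x ^ 2 + A * x + B)) (hx : x = 0) :
    pt h = twoTorsionPt A B := by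
  refine pt_congr _ _ hx ?_
  rw [hx, zero_mul] at h
  exact pow_eq_zero_iff two_ne_zero |>.1 h

variable [DecidableEq Qt]

theorem twoTorsionPt_add_self : twoTorsionPt A B + twoTorsionPt A B = 0 :=
  pt_add_self_of_eq_zero _ rfl

theorem pt_add_twoTorsionPt {x y : Qt} (h : y ^ 2 = x * (x ^ 2 + A * x + B)) (hx : x ≠ 0) :
    ∃ (x' y' : Qt) (h' : y' ^ 2 = x' * (x' ^ 2 + A * x' + B)),
      pt h = twoTorsionPt A B + pt h' ∧ x' = B / x := by
  obtain ⟨x', y', h', e, hx'⟩ := pt_add_pt h (x₂ := 0) (y₂ := 0) (by ring) hx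
  refine ⟨x', y', h', ?_, ?_⟩
  · rw [← e, add_left_comm]
    change _ = pt h + (twoTorsionPt A B + twoTorsionPt A B)
    rw [twoTorsionPt_add_self, add_zero]
  · rw [hx', sub_zero, sub_zero, sub_zero, div_pow, h]
    field_simp
    ring

/-- A point whose `x`-coordinate is a nonzero square is divisible by two if the first coordinates
of the points of the isogenous curve lie in two classes only. -/
theorem exists_two_nsmul_of_dual
    (hdual : ∀ X Y : Qt, X ≠ 0 → Y ^ 2 = X * (X ^ 2 + -2 * A * X + (A ^ 2 - 4 * B)) →
      ∃ z, z ≠ 0 ∧ (X = z ^ 2 ∨ X = (A ^ 2 - 4 * B) * z ^ 2))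
    {w y : Qt} (hw : w ≠ 0) (h : y ^ 2 = (w ^ 2) * ((w ^ 2) ^ 2 + A * (w ^ 2) + B)) :
    ∃ R : (curve A B).Point, pt h = 2 • R := by
  have hD : A ^ 2 - 4 * B ≠ 0 := disc_ne_zero
  obtain ⟨v, hv'⟩ : ∃ v, v = y / w := ⟨_, rfl⟩
  have hv : v ^ 2 = w ^ 4 + A * w ^ 2 + B := by
    rw [hv', div_pow, h]
    field_simp
  -- X is the first coordinate of a preimage (X, 2wX) under the dual isogeny; the other preimage has
  -- first coordinate (A² - 4B)/X.
  obtain ⟨X, hX⟩ : ∃ X, X = 2 * w ^ 2 + A + 2 * v := ⟨_, rfl⟩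
  have hXX : X * (2 * w ^ 2 + A - 2 * v) = A ^ 2 - 4 * B := by
    rw [hX]; linear_combination -4 * hv
  have hX0 : X ≠ 0 := by rintro h0; rw [h0, zero_mul] at hXX; exact hD hXX.symm
  obtain ⟨z, hz, hz' | hz'⟩ := hdual X (2 * w * X) hX0 (by
    rw [← hXX, hX]; ring)
  · exact exists_two_nsmul_of_sq hz hv (hX.symm.trans hz') h
  -- If X is A² - 4B times a square, the other preimage, obtained from -v, has a square first
  -- coordinate.
  · refine exists_two_nsmul_of_sq (w := w) (v := -v) (z := z⁻¹) (inv_ne_zero hz)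
      (by rw [neg_sq, hv]) ?_ h
    refine mul_left_cancel₀ hX0 ?_
    rw [mul_neg, ← sub_eq_add_neg, hXX, hz']
    field_simp

/-- The class of x is additive, so subtracting a point of H with the same class leaves a point whose
x-coordinate is a square. The exceptions P = ±P₀ and x(P - P₀) = 0 already lie in H. -/
theorem exists_square_of_class {H : AddSubgroup (curve A B).Point} (hT : twoTorsionPt A B ∈ H)
    {x y x₀ y₀ z : Qt} (h : y ^ 2 = x * (x ^ 2 + A * x + B))
    (h₀ : y₀ ^ 2 = x₀ * (x₀ ^ 2 + A * x₀ + B)) (hH : pt h₀ ∈ H) (hx₀ : x₀ ≠ 0) (hz : z ≠ 0)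
    (hx : x = x₀ * z ^ 2) :
    pt h ∈ H ∨ ∃ τ ∈ H, ∃ (w y' : Qt) (h' : y' ^ 2 = w ^ 2 * ((w ^ 2) ^ 2 + A * w ^ 2 + B)),
      w ≠ 0 ∧ pt h = τ + pt h' := by
  obtain e | e | ⟨x', y', u, h', e, hu⟩ := sub_pt_cases h h₀
  · exact .inl (e ▸ hH)
  · exact .inl (e ▸ H.neg_mem hH)
  · by_cases hx' : x' = 0
    · rw [pt_eq_twoTorsionPt h' hx'] at e
      exact .inl (by rw [← sub_add_cancel (pt h) (pt h₀), e]; exact H.add_mem hT hH)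
    · have hw : x' = (u / (x₀ * z)) ^ 2 := by
        rw [div_pow, ← hu, hx]
        field_simp
      refine .inr ⟨pt h₀, hH, u / (x₀ * z), y', hw ▸ h', ?_, ?_⟩
      · intro h0
        rw [h0, zero_pow two_ne_zero] at hw
        exact hx' hw
      · rw [← sub_add_cancel (pt h) (pt h₀), e, add_comm]
        congr 1
        exact pt_congr _ _ hw rfl

theorem exists_square_of_twoTorsionPt_class {H : AddSubgroup (curve A B).Point}
    (hT : twoTorsionPt A B ∈ H)
    {x y z : Qt} (h : y ^ 2 = x * (x ^ 2 + A * x + B)) (hz : z ≠ 0) (hx : x = B * z ^ 2) :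
    pt h ∈ H ∨ ∃ τ ∈ H, ∃ (w y' : Qt) (h' : y' ^ 2 = w ^ 2 * ((w ^ 2) ^ 2 + A * w ^ 2 + B)),
      w ≠ 0 ∧ pt h = τ + pt h' := by
  have hB : B ≠ 0 := B_ne_zero (A := A)
  obtain ⟨x', y', h', e, hx'⟩ := pt_add_twoTorsionPt h
    (hx ▸ mul_ne_zero hB (pow_ne_zero 2 hz))
  have hw : x' = z⁻¹ ^ 2 := by
    rw [hx', hx]; field_simp
  refine .inr ⟨_, hT, z⁻¹, y', hw ▸ h', inv_ne_zero hz, ?_⟩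
  rw [e]
  congr 1
  exact pt_congr _ _ hw rfl

theorem exists_square_of_square {H : AddSubgroup (curve A B).Point}
    {x y z : Qt} (h : y ^ 2 = x * (x ^ 2 + A * x + B)) (hz : z ≠ 0) (hx : x = z ^ 2) :
    pt h ∈ H ∨ ∃ τ ∈ H, ∃ (w y' : Qt) (h' : y' ^ 2 = w ^ 2 * ((w ^ 2) ^ 2 + A * w ^ 2 + B)),
      w ≠ 0 ∧ pt h = τ + pt h' :=
  .inr ⟨0, H.zero_mem, z, y, hx ▸ h, hz, by rw [zero_add]; exact pt_congr _ _ hx rfl⟩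

theorem exists_add_two_nsmul {H : AddSubgroup (curve A B).Point} (hT : twoTorsionPt A B ∈ H)
    (hclass : ∀ (x y : Qt) (h : y ^ 2 = x * (x ^ 2 + A * x + B)), x ≠ 0 →
      pt h ∈ H ∨ ∃ τ ∈ H, ∃ (w y' : Qt) (h' : y' ^ 2 = w ^ 2 * ((w ^ 2) ^ 2 + A * w ^ 2 + B)),
        w ≠ 0 ∧ pt h = τ + pt h')
    (hdual : ∀ X Y : Qt, X ≠ 0 → Y ^ 2 = X * (X ^ 2 + -2 * A * X + (A ^ 2 - 4 * B)) →
      ∃ z, z ≠ 0 ∧ (X = z ^ 2 ∨ X = (A ^ 2 - 4 * B) * z ^ 2))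
    (P : (curve A B).Point) : ∃ τ ∈ H, ∃ R, P = τ + 2 • R := by
  have key : P ∈ H → ∃ τ ∈ H, ∃ R, P = τ + 2 • R := fun hP => ⟨P, hP, 0, by simp⟩
  obtain rfl | ⟨x, y, h, rfl⟩ := eq_zero_or_eq_pt P
  · exact key H.zero_mem
  by_cases hx : x = 0
  · exact key (pt_eq_twoTorsionPt h hx ▸ hT)
  obtain hP | ⟨τ, hτ, w, y', h', hw, e⟩ := hclass x y h hx
  · exact key hP
  obtain ⟨R, hR⟩ := exists_two_nsmul_of_dual hdual hw h'
  exact ⟨τ, hτ, R, by rw [e, hR]⟩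

end TwoDivisibility

end KubertFamilies

end

open WeierstrassCurve

noncomputable section

namespace KubertFamilies

open WeierstrassCurve.Affine Polynomial

/-! ### Auxiliary criteria for the descents -/

section DescentTools

theorem exists_sq_of_node {F : Type*} [Field F] [NeZero (2 : F)] (ev : ℚ[X] →+* F)
    {a D d M N W : ℚ[X]} {s : F}
    (h : 4 * d * W ^ 2 = (2 * d * M ^ 2 + a * N ^ 2) ^ 2 - D * N ^ 4) (hMN : IsCoprime M N)
    (hD : ev D = 0) (hs : s ≠ 0) (ha : -2 * ev a = s ^ 2) (hd : ev d ≠ 0) :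
    ∃ z, z ≠ 0 ∧ ev d = z ^ 2 := by
  have ha' : ev a ≠ 0 := by
    intro h0
    rw [h0, mul_zero] at ha
    exact hs (pow_eq_zero_iff two_ne_zero |>.1 ha.symm)
  obtain h | ⟨z, hz, e⟩ := isSquare_or_of_node ev h hMN hD ha' hd
  · exact h
  · exact ⟨s * z, mul_ne_zero hs hz, by rw [e, ha, mul_pow]⟩

theorem exists_sq_eval_of_node {a D d M N W : ℚ[X]} (r s : ℚ)
    (h : 4 * d * W ^ 2 = (2 * d * M ^ 2 + a * N ^ 2) ^ 2 - D * N ^ 4) (hMN : IsCoprime M N)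
    (hD : D.eval r = 0) (hs : s ≠ 0) (ha : -2 * a.eval r = s ^ 2) (hd : d.eval r ≠ 0) :
    ∃ z, z ≠ 0 ∧ d.eval r = z ^ 2 :=
  exists_sq_of_node (evalRingHom r) h hMN hD hs ha hd

theorem exists_eq_C_of_dvd_C {d : ℚ[X]} {k : ℚ} (hk : k ≠ 0) (h : d ∣ C k) :
    ∃ c, c ≠ 0 ∧ d = C c := by
  obtain ⟨c, hc, rfl⟩ := Polynomial.isUnit_iff.1
    (isUnit_of_dvd_unit h (isUnit_C.2 hk.isUnit))
  exact ⟨c, hc.ne_zero, rfl⟩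

/-- The relation k²d = l²e says that d and e agree modulo squares; k and l are supplied explicitly
in each application. -/
theorem exists_sq_of_datum {x : Qt} {d M N : ℚ[X]} (hM : M ≠ 0) (hN : N ≠ 0)
    (hx : x = algebraMap ℚ[X] Qt d * (algebraMap ℚ[X] Qt M / algebraMap ℚ[X] Qt N) ^ 2)
    (e k l : ℚ[X]) (hk : k ≠ 0) (hl : l ≠ 0) (hd : k ^ 2 * d = l ^ 2 * e) :
    ∃ w, w ≠ 0 ∧ x = algebraMap ℚ[X] Qt e * w ^ 2 := by
  have inj : ∀ {f : ℚ[X]}, f ≠ 0 → algebraMap ℚ[X] Qt f ≠ 0 := fun hf =>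
    (map_ne_zero_iff _ (IsFractionRing.injective ℚ[X] Qt)).2 hf
  have hk' := inj hk
  refine ⟨algebraMap ℚ[X] Qt l / algebraMap ℚ[X] Qt k *
    (algebraMap ℚ[X] Qt M / algebraMap ℚ[X] Qt N),
    mul_ne_zero (div_ne_zero (inj hl) hk') (div_ne_zero (inj hM) (inj hN)), ?_⟩
  have := congrArg (algebraMap ℚ[X] Qt) hd
  simp only [map_mul, map_pow] at this
  rw [hx, mul_pow, ← mul_assoc]
  congr 1
  rw [div_pow]
  field_simp
  linear_combination this

theorem irreducible_quadratic {u v w : ℚ} (hu : u ≠ 0) (h : ∀ r : ℚ, r ^ 2 ≠ v ^ 2 - 4 * u * w) :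
    Irreducible (C u * X ^ 2 + C v * X + C w) := by
  have hdeg := natDegree_quadratic (b := v) (c := w) hu
  rw [irreducible_iff_roots_eq_zero_of_degree_le_three (by omega) (by omega)]
  rw [Multiset.eq_zero_iff_forall_notMem]
  intro r hr
  have := (mem_roots'.1 hr).2
  simp only [IsRoot, eval_add, eval_mul, eval_C, eval_pow, eval_X] at this
  exact h (2 * u * r + v) (by linear_combination 4 * u * this)

theorem sq_ne_natCast {n k : ℕ} (h₁ : k ^ 2 < n) (h₂ : n < (k + 1) ^ 2) (r : ℚ) : r ^ 2 ≠ n := by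
  intro h
  obtain ⟨m, hm⟩ := Rat.isSquare_natCast_iff.1 (⟨r, by rw [← h, sq]⟩ : IsSquare (n : ℚ))
  rw [hm, ← sq] at h₁ h₂
  have := lt_of_pow_lt_pow_left₀ 2 (Nat.zero_le _) h₁
  have := lt_of_pow_lt_pow_left₀ 2 (Nat.zero_le _) h₂
  omega

end DescentTools

/-! ### Descent for the ℤ/10 family -/

section DescentTen

/-- The polynomial `a` of Kubert's family with torsion `ℤ/10ℤ`. -/
def a₁₀ : ℚ[X] :=
  -((2 * X ^ 2 - 2 * X + 1) * (4 * X ^ 4 - 12 * X ^ 3 + 6 * X ^ 2 + 2 * X - 1))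

/-- The polynomial `b` of Kubert's family with torsion `ℤ/10ℤ`. -/
def b₁₀ : ℚ[X] := 16 * X ^ 5 * (X - 1) ^ 5 * (X ^ 2 - 3 * X + 1)

theorem disc₁₀ : a₁₀ ^ 2 - 4 * b₁₀ = (2 * X - 1) ^ 5 * (4 * X ^ 2 - 2 * X - 1) := by
  rw [a₁₀, b₁₀]; ring

/-- Candidates are constants times products of X, X - 1 and X² - 3X + 1. The place at infinity
forces even degree and a square leading coefficient. At 1/2 both X(X - 1) and X² - 3X + 1 equal
-1/4, so only 1 and the full product, the class of b, remain. -/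
theorem class₁₀ {x y : Qt} (hx : x ≠ 0)
    (h : y ^ 2 = x * (x ^ 2 + algebraMap ℚ[X] Qt a₁₀ * x + algebraMap ℚ[X] Qt b₁₀)) :
    ∃ z, z ≠ 0 ∧ (x = z ^ 2 ∨ x = algebraMap ℚ[X] Qt b₁₀ * z ^ 2) := by
  obtain ⟨d, M, N, W, hd, hdb, hM, hN, hMN, hxe, hW⟩ := exists_descent_datum hx h
  have hq : Irreducible (X ^ 2 - 3 * X + 1 : ℚ[X]) := by
    convert irreducible_quadratic (u := 1) (v := -3) (w := 1) one_ne_zero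
      (fun r h => sq_ne_natCast (n := 5) (k := 2) (by norm_num) (by norm_num) r
        (by rw [h]; norm_num)) using 1
    simp only [map_neg, map_one, map_ofNat]; ring
  have hinf : Even d.natDegree ∧ ∃ z, z ≠ 0 ∧ d.leadingCoeff = z ^ 2 := by
    have e : a₁₀ = -8 * X ^ 6 + 32 * X ^ 5 + -40 * X ^ 4 + 20 * X ^ 3 + -4 * X + 1 := by
      rw [a₁₀]; ring
    have e' : a₁₀.natDegree = 6 := by rw [e]; compute_degree!
    refine even_natDegree_of_node_infinity hW hd.ne_zero hM hN (n := 3) e' (c := 4) (by norm_num)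
      ?_ ?_
    · rw [leadingCoeff, e', e]
      have : (-8 * X ^ 6 + 32 * X ^ 5 + -40 * X ^ 4 + 20 * X ^ 3 + -4 * X + 1 : ℚ[X]).coeff 6
        = -8 := by compute_degree!
      rw [this]; norm_num
    · rw [disc₁₀]
      have : ((2 * X - 1) ^ 5 * (4 * X ^ 2 - 2 * X - 1) : ℚ[X]).natDegree ≤ 7 := by compute_degree
      omega
  have hhalf : d.eval (1 / 2) ≠ 0 → ∃ z, z ≠ 0 ∧ d.eval (1 / 2) = z ^ 2 :=
    exists_sq_eval_of_node (1 / 2) (1 / 2) hW hMN (by rw [disc₁₀]; norm_num [eval_pow])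
      (by norm_num) (by rw [a₁₀]; norm_num)
  have hb : b₁₀ = X ^ 5 * ((X - 1) ^ 5 * ((X ^ 2 - 3 * X + 1) ^ 1 * C 16)) := by
    rw [b₁₀, show (C 16 : ℚ[X]) = 16 from rfl]; ring
  have hX1 : Irreducible (X - 1 : ℚ[X]) := irreducible_X_sub_C 1
  have hX1m : (X - 1 : ℚ[X]).Monic := monic_X_sub_C 1
  have hqm : (X ^ 2 - 3 * X + 1 : ℚ[X]).Monic := by monicity!
  rw [hb] at hdb
  obtain h₁ | ⟨d₁, hd₁, rfl, h₁⟩ := squarefree_dvd_cases irreducible_X hd hdb <;>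
  obtain h₂ | ⟨d₂, hd₂, rfl, h₂⟩ := squarefree_dvd_cases hX1 ‹_› h₁ <;>
  obtain h₃ | ⟨d₃, hd₃, rfl, h₃⟩ := squarefree_dvd_cases hq ‹_› h₂ <;>
  obtain ⟨c, hc, rfl⟩ := exists_eq_C_of_dvd_C (by norm_num) h₃
  · obtain ⟨-, z, hz, e⟩ := hinf
    rw [leadingCoeff_C] at e
    obtain ⟨w, hw, e'⟩ := exists_sq_of_datum hM hN hxe 1 1 (C z) one_ne_zero (C_ne_zero.2 hz)
      (by rw [e, C_pow]; ring)
    exact ⟨w, hw, .inl (by rw [e', map_one, one_mul])⟩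
  · obtain ⟨z, hz, e⟩ := hinf.2
    rw [leadingCoeff_mul, hqm.leadingCoeff, leadingCoeff_C, one_mul] at e
    obtain ⟨w, hw, e'⟩ := hhalf (by simp [hc]; norm_num)
    simp only [eval_mul, eval_C, eval_add, eval_sub, eval_pow, eval_X, eval_ofNat, eval_one, e] at e'
    nlinarith [sq_nonneg w, sq_pos_of_ne_zero hz]
  · exact absurd hinf.1 (by
      rw [show ((X - 1) * C c : ℚ[X]).natDegree = 1 by compute_degree!]
      decide)
  · exact absurd hinf.1 (by
      rw [show ((X - 1) * ((X ^ 2 - 3 * X + 1) * C c) : ℚ[X]).natDegree = 3 by compute_degree!]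
      decide)
  · exact absurd hinf.1 (by
      rw [show (X * C c : ℚ[X]).natDegree = 1 by compute_degree!]
      decide)
  · exact absurd hinf.1 (by
      rw [show (X * ((X ^ 2 - 3 * X + 1) * C c) : ℚ[X]).natDegree = 3 by compute_degree!]
      decide)
  · obtain ⟨z, hz, e⟩ := hinf.2
    rw [leadingCoeff_mul, leadingCoeff_mul, hX1m.leadingCoeff, leadingCoeff_C, leadingCoeff_X,
      one_mul, one_mul] at e
    obtain ⟨w, hw, e'⟩ := hhalf (by simp [hc]; norm_num)
    simp only [eval_mul, eval_C, eval_sub, eval_X, eval_one, e] at e'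
    nlinarith [sq_nonneg w, sq_pos_of_ne_zero hz]
  · obtain ⟨z, hz, e⟩ := hinf.2
    rw [leadingCoeff_mul, leadingCoeff_mul, leadingCoeff_mul, hX1m.leadingCoeff, leadingCoeff_C,
      leadingCoeff_X, hqm.leadingCoeff, one_mul, one_mul, one_mul] at e
    obtain ⟨w, hw, e'⟩ := exists_sq_of_datum hM hN hxe b₁₀ (4 * X ^ 2 * (X - 1) ^ 2) (C z)
      (mul_ne_zero (mul_ne_zero (by norm_num) (pow_ne_zero 2 X_ne_zero))
        (pow_ne_zero 2 hX1.ne_zero)) (C_ne_zero.2 hz) (by rw [e, b₁₀, C_pow]; ring)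
    exact ⟨w, hw, .inr e'⟩

/-- The dual is nodal at 0 and 1. The factors 2X - 1 and 4X² - 2X - 1 both equal 1 at 1, so the
constant is a square, and both equal -1 at 0, so they occur together or not at all. -/
theorem dual_class₁₀ {x y : Qt} (hx : x ≠ 0)
    (h : y ^ 2 = x * (x ^ 2 + algebraMap ℚ[X] Qt (-2 * a₁₀) * x +
      algebraMap ℚ[X] Qt (a₁₀ ^ 2 - 4 * b₁₀))) :
    ∃ z, z ≠ 0 ∧ (x = z ^ 2 ∨ x = algebraMap ℚ[X] Qt (a₁₀ ^ 2 - 4 * b₁₀) * z ^ 2) := by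
  obtain ⟨d, M, N, W, hd, hdb, hM, hN, hMN, hxe, hW⟩ := exists_descent_datum hx h
  have hq : Irreducible (4 * X ^ 2 - 2 * X - 1 : ℚ[X]) := by
    convert irreducible_quadratic (u := 4) (v := -2) (w := -1) (by norm_num)
      (fun r h => sq_ne_natCast (n := 20) (k := 4) (by norm_num) (by norm_num) r
        (by rw [h]; norm_num)) using 1
    simp only [map_neg, map_one, map_ofNat]; ring
  have hl : Irreducible (2 * X - 1 : ℚ[X]) := by
    refine irreducible_of_degree_eq_one (p := (2 * X - 1 : ℚ[X])) ?_
    compute_degree!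
  have h₀ : d.eval 0 ≠ 0 → ∃ z, z ≠ 0 ∧ d.eval 0 = z ^ 2 :=
    exists_sq_eval_of_node 0 2 hW hMN (by rw [a₁₀, b₁₀]; norm_num)
      (by norm_num) (by rw [a₁₀]; norm_num)
  have h₁ : d.eval 1 ≠ 0 → ∃ z, z ≠ 0 ∧ d.eval 1 = z ^ 2 :=
    exists_sq_eval_of_node 1 2 hW hMN (by rw [a₁₀, b₁₀]; norm_num)
      (by norm_num) (by rw [a₁₀]; norm_num)
  have hb : a₁₀ ^ 2 - 4 * b₁₀ = (2 * X - 1) ^ 5 * ((4 * X ^ 2 - 2 * X - 1) ^ 1 * C 1) := by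
    rw [disc₁₀, C_1]; ring
  rw [hb] at hdb
  obtain h₂ | ⟨d₂, hd₂, rfl, h₂⟩ := squarefree_dvd_cases hl hd hdb <;>
  obtain h₃ | ⟨d₃, hd₃, rfl, h₃⟩ := squarefree_dvd_cases hq ‹_› h₂ <;>
  obtain ⟨c, hc, rfl⟩ := exists_eq_C_of_dvd_C (by norm_num) h₃ <;>
  obtain ⟨z, hz, e⟩ := h₁ (by norm_num [hc]) <;>
  obtain ⟨w, hw, e'⟩ := h₀ (by norm_num [hc]) <;>
  norm_num at e e' <;> subst e
  · obtain ⟨w, hw, e'⟩ := exists_sq_of_datum hM hN hxe 1 1 (C z) one_ne_zero (C_ne_zero.2 hz)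
      (by rw [C_pow]; ring)
    exact ⟨w, hw, .inl (by rw [e', map_one, one_mul])⟩
  · nlinarith [sq_nonneg w, sq_pos_of_ne_zero hz]
  · nlinarith [sq_nonneg w, sq_pos_of_ne_zero hz]
  · obtain ⟨w, hw, e'⟩ := exists_sq_of_datum hM hN hxe (a₁₀ ^ 2 - 4 * b₁₀) ((2 * X - 1) ^ 2) (C z)
      (pow_ne_zero 2 hl.ne_zero) (C_ne_zero.2 hz) (by rw [disc₁₀, C_pow]; ring)
    exact ⟨w, hw, .inr e'⟩

end DescentTen

end KubertFamilies

end

open WeierstrassCurve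

noncomputable section

namespace KubertFamilies

open WeierstrassCurve.Affine Polynomial

/-! ### Places with quadratic residue field -/

section QuadraticPlace

open scoped QuadraticAlgebra

variable {r : ℚ}

instance : NeZero (2 : QuadraticAlgebra ℚ r 0) :=
  ⟨fun h => two_ne_zero (α := ℚ) (congrArg QuadraticAlgebra.re h)⟩

/-- These facts make the quadratic algebras with r = -3, -1, 2 fields: the residue fields at X² + 3,
X² + 1 and X² - 2X - 1. -/
instance : Fact (∀ s : ℚ, s ^ 2 ≠ -3 + 0 * s) := ⟨fun s h => by nlinarith [sq_nonneg s]⟩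

instance : Fact (∀ s : ℚ, s ^ 2 ≠ -1 + 0 * s) := ⟨fun s h => by nlinarith [sq_nonneg s]⟩

instance : Fact (∀ s : ℚ, s ^ 2 ≠ 2 + 0 * s) :=
  ⟨fun s h => sq_ne_natCast (n := 2) (k := 1) (by norm_num) (by norm_num) s (by rw [h]; norm_num)⟩

/-- Evaluation at an element of a quadratic field. -/
def evalQuadratic (r : ℚ) (θ : QuadraticAlgebra ℚ r 0) : ℚ[X] →+* QuadraticAlgebra ℚ r 0 :=
  eval₂RingHom (algebraMap ℚ _) θ

@[simp]
theorem evalQuadratic_X (θ : QuadraticAlgebra ℚ r 0) : evalQuadratic r θ X = θ := by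
  simp [evalQuadratic]

@[simp]
theorem evalQuadratic_C (θ : QuadraticAlgebra ℚ r 0) (c : ℚ) :
    evalQuadratic r θ (C c) = QuadraticAlgebra.C c := by
  simp [evalQuadratic, QuadraticAlgebra.C_eq_algebraMap]

end QuadraticPlace

/-! ### Descent for the ℤ/12 family -/

section DescentTwelve

open scoped QuadraticAlgebra

/-- The polynomial `a` of Kubert's family with torsion `ℤ/12ℤ`. -/
def a₁₂ : ℚ[X] :=
  X ^ 8 - 12 * X ^ 6 - 48 * X ^ 5 - 162 * X ^ 4 - 480 * X ^ 3 - 540 * X ^ 2 - 624 * X - 183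

/-- The polynomial `b` of Kubert's family with torsion `ℤ/12ℤ`. -/
def b₁₂ : ℚ[X] := 1024 * (X ^ 2 + 3) ^ 2 * (X + 1) ^ 6

theorem disc₁₂ : a₁₂ ^ 2 - 4 * b₁₂ =
    (X - 1) ^ 6 * (X + 3) ^ 2 * (X ^ 2 - 6 * X - 3) * (X ^ 2 + 2 * X + 5) ^ 3 := by
  rw [a₁₂, b₁₂]; ring

theorem irreducible_X_sq_add_three : Irreducible (X ^ 2 + 3 : ℚ[X]) := by
  convert irreducible_quadratic (u := 1) (v := 0) (w := 3) one_ne_zero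
    (fun r h => by nlinarith [sq_nonneg r]) using 1
  simp only [map_one, map_ofNat, map_zero]; ring

theorem sq_ne_three (w : ℚ) : w ^ 2 ≠ 3 :=
  fun h => sq_ne_natCast (n := 3) (k := 1) (by norm_num) (by norm_num) w (by rw [h]; norm_num)

/-- The value at 1 fixes the constant modulo squares. At -3 the allowed classes are 1 and -3, since
-2a(-3) = -3·64²; signs and the irrationality of √3 exclude X + 1 and X² + 3 taken singly. The
surviving nontrivial class is that of the point of order 4; b is a square, so (0, 0) adds none. -/
theorem class₁₂ {x y : Qt} (hx : x ≠ 0)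
    (h : y ^ 2 = x * (x ^ 2 + algebraMap ℚ[X] Qt a₁₂ * x + algebraMap ℚ[X] Qt b₁₂)) :
    ∃ z, z ≠ 0 ∧ (x = z ^ 2 ∨ x = algebraMap ℚ[X] Qt (2 * (X ^ 2 + 3) * (X + 1)) * z ^ 2) := by
  obtain ⟨d, M, N, W, hd, hdb, hM, hN, hMN, hxe, hW⟩ := exists_descent_datum hx h
  have h₁ : d.eval 1 ≠ 0 → ∃ z, z ≠ 0 ∧ d.eval 1 = z ^ 2 :=
    exists_sq_eval_of_node 1 64 hW hMN (by rw [disc₁₂]; norm_num)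
      (by norm_num) (by rw [a₁₂]; norm_num)
  have h₃ : d.eval (-3) ≠ 0 → (∃ z, z ≠ 0 ∧ d.eval (-3) = z ^ 2) ∨
      ∃ z, z ≠ 0 ∧ d.eval (-3) = -2 * a₁₂.eval (-3) * z ^ 2 :=
    isSquare_or_of_node (evalRingHom (-3)) hW hMN (by rw [disc₁₂]; norm_num)
      (by rw [a₁₂]; norm_num)
  rw [show a₁₂.eval (-3) = 6144 by rw [a₁₂]; norm_num] at h₃
  have hX1 : Irreducible (X + 1 : ℚ[X]) := by simpa using irreducible_X_sub_C (-1 : ℚ)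
  have hb : b₁₂ = (X ^ 2 + 3) ^ 2 * ((X + 1) ^ 6 * C 1024) := by
    rw [b₁₂, show (C 1024 : ℚ[X]) = 1024 from rfl]; ring
  rw [hb] at hdb
  obtain h₄ | ⟨d₁, hd₁, rfl, h₄⟩ := squarefree_dvd_cases irreducible_X_sq_add_three hd hdb <;>
  obtain h₅ | ⟨d₂, hd₂, rfl, h₅⟩ := squarefree_dvd_cases hX1 ‹_› h₄ <;>
  obtain ⟨c, hc, rfl⟩ := exists_eq_C_of_dvd_C (by norm_num) h₅ <;>
  obtain ⟨z, hz, e⟩ := h₁ (by norm_num [hc]) <;>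
  replace h₃ := h₃ (by norm_num [hc])
  · rw [eval_C] at e
    obtain ⟨w, hw, e'⟩ := exists_sq_of_datum hM hN hxe 1 1 (C z) one_ne_zero (C_ne_zero.2 hz)
      (by rw [e, C_pow]; ring)
    exact ⟨w, hw, .inl (by rw [e', map_one, one_mul])⟩
  · exfalso
    norm_num at e h₃
    obtain ⟨w, hw, e'⟩ | ⟨w, hw, e'⟩ := h₃
    · nlinarith [sq_nonneg w, sq_pos_of_ne_zero hz]
    · exact sq_ne_three (z / (64 * w)) (by
        rw [div_pow, ← e, div_eq_iff (pow_ne_zero 2 (mul_ne_zero (by norm_num) hw))]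
        linear_combination e')
  · exfalso
    norm_num at e h₃
    obtain ⟨w, hw, e'⟩ | ⟨w, hw, e'⟩ := h₃
    · exact sq_ne_three (w / z) (by
        rw [div_pow, ← e', ← e, div_eq_iff (mul_ne_zero (by norm_num) hc)]
        ring)
    · nlinarith [sq_nonneg w, sq_pos_of_ne_zero hz]
  · norm_num at e
    obtain ⟨w, hw, e'⟩ := exists_sq_of_datum hM hN hxe (2 * (X ^ 2 + 3) * (X + 1)) 1 (C (z / 4))
      one_ne_zero (C_ne_zero.2 (div_ne_zero hz (by norm_num))) (by
        rw [← C_pow, div_pow, ← e, show (4 * (2 * c) / 4 ^ 2 : ℚ) = c * 2⁻¹ by ring, C_mul]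
        have : (C 2⁻¹ * 2 : ℚ[X]) = 1 := by rw [show (2 : ℚ[X]) = C 2 from rfl, ← C_mul]; norm_num
        linear_combination -(X ^ 2 + 3) * (X + 1) * C c * this)
    exact ⟨w, hw, .inr e'⟩

theorem sq_quadratic (s : QuadraticAlgebra ℚ (-3) 0) :
    s ^ 2 = ⟨s.re ^ 2 - 3 * s.im ^ 2, 2 * s.re * s.im⟩ := by
  ext <;> simp [sq] <;> ring

/-- These are the non-squares of ℚ(√-3) needed at the place X² + 3 of the dual curve. The first two
are the residues of X² - 6X - 3 and X² + 2X + 5; the last two are what the alternative -2a times a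
square would require to be squares. -/
theorem sq_quadratic_ne (s : QuadraticAlgebra ℚ (-3) 0) :
    s ^ 2 ≠ ⟨-6, -6⟩ ∧ s ^ 2 ≠ ⟨2, 2⟩ ∧ s ^ 2 ≠ ⟨-1, 0⟩ ∧ s ^ 2 ≠ ⟨3, 0⟩ := by
  rw [sq_quadratic]
  simp only [ne_eq, QuadraticAlgebra.mk.injEq]
  refine ⟨?_, ?_, ?_, ?_⟩ <;> rintro ⟨h₁, h₂⟩
  · have h : (s.re ^ 2 + 9) * (s.re ^ 2 - 3) = 0 := by
      linear_combination s.re ^ 2 * h₁ + 3 / 4 * (2 * s.re * s.im - 6) * h₂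
    obtain h | h := mul_eq_zero.1 h
    · nlinarith [sq_nonneg s.re]
    · exact sq_ne_three s.re (by linear_combination h)
  · have h : (s.re ^ 2 + 1) * (s.re ^ 2 - 3) = 0 := by
      linear_combination s.re ^ 2 * h₁ + 3 / 4 * (2 * s.re * s.im + 2) * h₂
    obtain h | h := mul_eq_zero.1 h
    · nlinarith [sq_nonneg s.re]
    · exact sq_ne_three s.re (by linear_combination h)
  · obtain h | h := mul_eq_zero.1 h₂
    · exact sq_ne_three (3 * s.im) (by
        rw [show s.re = 0 by linear_combination h / 2] at h₁; linear_combination -3 * h₁)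
    · rw [h] at h₁; nlinarith [sq_nonneg s.re]
  · obtain h | h := mul_eq_zero.1 h₂
    · rw [show s.re = 0 by linear_combination h / 2] at h₁; nlinarith [sq_nonneg s.im]
    · exact sq_ne_three s.re (by rw [h] at h₁; linear_combination h₁)

/-- Parity of the degree at infinity ties X - 1 to X + 3, and their product is -4 at -1, so both are
excluded. The two quadratics equal 4 at -1 and pass the rational tests; only the place √-3 shows
that they must occur together. -/
theorem dual_class₁₂ {x y : Qt} (hx : x ≠ 0)
    (h : y ^ 2 = x * (x ^ 2 + algebraMap ℚ[X] Qt (-2 * a₁₂) * x +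
      algebraMap ℚ[X] Qt (a₁₂ ^ 2 - 4 * b₁₂))) :
    ∃ z, z ≠ 0 ∧ (x = z ^ 2 ∨ x = algebraMap ℚ[X] Qt (a₁₂ ^ 2 - 4 * b₁₂) * z ^ 2) := by
  obtain ⟨d, M, N, W, hd, hdb, hM, hN, hMN, hxe, hW⟩ := exists_descent_datum hx h
  have hq₁ : Irreducible (X ^ 2 - 6 * X - 3 : ℚ[X]) := by
    convert irreducible_quadratic (u := 1) (v := -6) (w := -3) (by norm_num)
      (fun r h => sq_ne_natCast (n := 48) (k := 6) (by norm_num) (by norm_num) r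
        (by rw [h]; norm_num)) using 1
    simp only [map_neg, map_one, map_ofNat]; ring
  have hq₂ : Irreducible (X ^ 2 + 2 * X + 5 : ℚ[X]) := by
    convert irreducible_quadratic (u := 1) (v := 2) (w := 5) (by norm_num)
      (fun r h => by nlinarith [sq_nonneg r]) using 1
    simp only [map_one, map_ofNat]; ring
  have hX1 : Irreducible (X - 1 : ℚ[X]) := irreducible_X_sub_C 1
  have hX3 : Irreducible (X + 3 : ℚ[X]) := by
    have := irreducible_X_sub_C (-3 : ℚ)
    rwa [C_neg, sub_neg_eq_add] at this
  have hX1m : (X - 1 : ℚ[X]).Monic := monic_X_sub_C 1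
  have hX3m : (X + 3 : ℚ[X]).Monic := monic_X_add_C 3
  have hq₁m : (X ^ 2 - 6 * X - 3 : ℚ[X]).Monic := by monicity!
  have hq₂m : (X ^ 2 + 2 * X + 5 : ℚ[X]).Monic := by monicity!
  have n₂ : (X + 3 : ℚ[X]).natDegree = 1 := by compute_degree!
  have n₃ : (X ^ 2 - 6 * X - 3 : ℚ[X]).natDegree = 2 := by compute_degree!
  have n₄ : (X ^ 2 + 2 * X + 5 : ℚ[X]).natDegree = 2 := by compute_degree!
  have hCz : ∀ z : ℚ, z ≠ 0 → (QuadraticAlgebra.C z : QuadraticAlgebra ℚ (-3) 0) ≠ 0 :=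
    fun z hz h => hz (QuadraticAlgebra.C_eq_zero_iff.1 h)
  have hdisc : (-2 * a₁₂) ^ 2 - 4 * (a₁₂ ^ 2 - 4 * b₁₂) = 16 * b₁₂ := by ring
  have hinf : Even d.natDegree ∧ ∃ z, z ≠ 0 ∧ d.leadingCoeff = z ^ 2 := by
    have em : a₁₂.Monic := by rw [a₁₂]; monicity!
    have e' : a₁₂.natDegree = 8 := by rw [a₁₂]; compute_degree!
    have e2 : (-2 : ℚ[X]) = C (-2) := by rw [C_neg]; rfl
    refine even_natDegree_of_node_infinity hW hd.ne_zero hM hN (n := 4) ?_ (c := 2) (by norm_num)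
      ?_ ?_
    · rw [e2, natDegree_C_mul (by norm_num), e']
    · rw [e2, leadingCoeff_mul, em.leadingCoeff, leadingCoeff_C]; norm_num
    · rw [hdisc, b₁₂]
      have : (16 * (1024 * (X ^ 2 + 3) ^ 2 * (X + 1) ^ 6) : ℚ[X]).natDegree ≤ 10 := by
        compute_degree
      omega
  have h₁ : d.eval (-1) ≠ 0 → ∃ z, z ≠ 0 ∧ d.eval (-1) = z ^ 2 :=
    exists_sq_eval_of_node (-1) 32 hW hMN (by rw [hdisc, b₁₂]; norm_num)
      (by norm_num) (by rw [a₁₂]; norm_num)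
  obtain ⟨θ, hθ⟩ : ∃ θ : QuadraticAlgebra ℚ (-3) 0, θ = ⟨0, 1⟩ := ⟨_, rfl⟩
  have hθ2 : θ ^ 2 = -3 := by
    rw [hθ]; ext <;> simp [sq]
  have hθa : evalQuadratic (-3) θ (-2 * a₁₂) = -768 * (1 + θ) := by
    rw [a₁₂]
    simp only [map_mul, map_sub, map_pow, map_ofNat, map_neg, evalQuadratic_X]
    linear_combination -2 * (θ ^ 6 - 15 * θ ^ 4 - 48 * θ ^ 3 - 117 * θ ^ 2 - 336 * θ - 189) * hθ2
  have hθ0 : 1 + θ ≠ 0 := by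
    rw [hθ]; intro h; exact one_ne_zero (α := ℚ) (by simpa using congrArg QuadraticAlgebra.im h)
  have hθD : evalQuadratic (-3) θ ((-2 * a₁₂) ^ 2 - 4 * (a₁₂ ^ 2 - 4 * b₁₂)) = 0 := by
    rw [hdisc, b₁₂]
    simp only [map_mul, map_add, map_pow, map_ofNat, evalQuadratic_X, hθ2]
    ring
  have h₂ := isSquare_or_of_node (evalQuadratic (-3) θ) hW hMN hθD (by
    rw [hθa]; refine mul_ne_zero ?_ hθ0
    intro h; simpa using congrArg QuadraticAlgebra.re h)
  rw [hθa] at h₂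
  have hb : a₁₂ ^ 2 - 4 * b₁₂ = (X - 1) ^ 6 * ((X + 3) ^ 2 * ((X ^ 2 - 6 * X - 3) ^ 1 *
      ((X ^ 2 + 2 * X + 5) ^ 3 * C 1))) := by
    rw [disc₁₂, C_1]; ring
  rw [hb] at hdb
  obtain h₄ | ⟨d₁, hd₁, rfl, h₄⟩ := squarefree_dvd_cases hX1 hd hdb <;>
  obtain h₅ | ⟨d₂, hd₂, rfl, h₅⟩ := squarefree_dvd_cases hX3 ‹_› h₄ <;>
  obtain h₆ | ⟨d₃, hd₃, rfl, h₆⟩ := squarefree_dvd_cases hq₁ ‹_› h₅ <;>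
  obtain h₇ | ⟨d₄, hd₄, rfl, h₇⟩ := squarefree_dvd_cases hq₂ ‹_› h₆ <;>
  obtain ⟨c, hc, rfl⟩ := exists_eq_C_of_dvd_C (by norm_num) h₇ <;>
  obtain ⟨he, z, hz, e⟩ := hinf <;>
  obtain ⟨w, hw, e'⟩ := h₁ (by norm_num [hc]) <;>
  simp only [leadingCoeff_mul, hX1m.leadingCoeff, hX3m.leadingCoeff, hq₁m.leadingCoeff,
    hq₂m.leadingCoeff, leadingCoeff_C, one_mul] at e <;>
  norm_num at e' <;> subst e
  · obtain ⟨w, hw, e'⟩ := exists_sq_of_datum hM hN hxe 1 1 (C z) one_ne_zero (C_ne_zero.2 hz)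
      (by rw [C_pow]; ring)
    exact ⟨w, hw, .inl (by rw [e', map_one, one_mul])⟩
  · exfalso
    have hev : evalQuadratic (-3) θ ((X ^ 2 + 2 * X + 5) * C (z ^ 2)) =
        2 * (1 + θ) * QuadraticAlgebra.C z ^ 2 := by
      simp only [map_mul, map_add, map_pow, map_ofNat, evalQuadratic_X, evalQuadratic_C]
      linear_combination QuadraticAlgebra.C z ^ 2 * hθ2
    rw [hev] at h₂
    have hz' := hCz z hz
    obtain ⟨v, hv, e⟩ | ⟨v, hv, e⟩ := h₂ (mul_ne_zero (mul_ne_zero two_ne_zero hθ0)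
      (pow_ne_zero 2 hz'))
    · refine (sq_quadratic_ne (v / QuadraticAlgebra.C z)).2.1 ?_
      rw [div_pow, ← e, mul_div_cancel_right₀ _ (pow_ne_zero 2 hz'), hθ]
      ext <;> simp
    · refine (sq_quadratic_ne (48 * v / QuadraticAlgebra.C z)).2.2.2 ?_
      have e' : QuadraticAlgebra.C z ^ 2 = 768 * v ^ 2 :=
        mul_left_cancel₀ (mul_ne_zero two_ne_zero hθ0) (by linear_combination e)
      trans (3 : QuadraticAlgebra ℚ (-3) 0)
      · rw [div_pow, div_eq_iff (pow_ne_zero 2 hz'), e']; ring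
      · ext <;> simp
  · exfalso
    have hev : evalQuadratic (-3) θ ((X ^ 2 - 6 * X - 3) * C (z ^ 2)) =
        -6 * (1 + θ) * QuadraticAlgebra.C z ^ 2 := by
      simp only [map_mul, map_sub, map_pow, map_ofNat, evalQuadratic_X, evalQuadratic_C]
      linear_combination QuadraticAlgebra.C z ^ 2 * hθ2
    have h6 : (-6 : QuadraticAlgebra ℚ (-3) 0) ≠ 0 := by
      intro h; simpa using congrArg QuadraticAlgebra.re h
    rw [hev] at h₂
    have hz' := hCz z hz
    obtain ⟨v, hv, e⟩ | ⟨v, hv, e⟩ := h₂ (mul_ne_zero (mul_ne_zero h6 hθ0)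
      (pow_ne_zero 2 hz'))
    · refine (sq_quadratic_ne (v / QuadraticAlgebra.C z)).1 ?_
      rw [div_pow, ← e, mul_div_cancel_right₀ _ (pow_ne_zero 2 hz'), hθ]
      ext <;> simp
    · refine (sq_quadratic_ne (16 * v / QuadraticAlgebra.C z)).2.2.1 ?_
      have e' : QuadraticAlgebra.C z ^ 2 = -256 * v ^ 2 :=
        mul_left_cancel₀ (mul_ne_zero h6 hθ0) (by linear_combination e)
      trans (-1 : QuadraticAlgebra ℚ (-3) 0)
      · rw [div_pow, div_eq_iff (pow_ne_zero 2 hz'), e']; ring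
      · ext <;> simp
  · obtain ⟨w, hw, e'⟩ := exists_sq_of_datum hM hN hxe (a₁₂ ^ 2 - 4 * b₁₂)
      ((X - 1) ^ 3 * (X + 3) * (X ^ 2 + 2 * X + 5)) (C z)
      (mul_ne_zero (mul_ne_zero (pow_ne_zero 3 hX1.ne_zero) hX3.ne_zero) hq₂.ne_zero)
      (C_ne_zero.2 hz) (by rw [disc₁₂, C_pow]; ring)
    exact ⟨w, hw, .inr e'⟩
  all_goals
    exfalso
    first
    | nlinarith [sq_nonneg w, sq_pos_of_ne_zero hz]
    | simp only [natDegree_mul, ne_eq, mul_eq_zero, hX3.ne_zero, hq₁.ne_zero, hq₂.ne_zero,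
        C_eq_zero, hc, or_self, not_false_eq_true, natDegree_C, n₂, n₃, n₄] at he
      revert he
      decide

end DescentTwelve

end KubertFamilies

end

open WeierstrassCurve

noncomputable section

namespace KubertFamilies

open WeierstrassCurve.Affine Polynomial

/-! ### Descent for the ℤ/2 × ℤ/8 family -/

section DescentTwoEight

open scoped QuadraticAlgebra

/-- The polynomial `a` of Kubert's family with torsion `ℤ/2ℤ × ℤ/8ℤ`. -/
def a₂₈ : ℚ[X] := (X ^ 2 - 1) ^ 4 + 16 * X ^ 4

/-- The polynomial `b` of Kubert's family with torsion `ℤ/2ℤ × ℤ/8ℤ`. -/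
def b₂₈ : ℚ[X] := (X ^ 2 - 1) ^ 4 * (16 * X ^ 4)

theorem disc₂₈ : a₂₈ ^ 2 - 4 * b₂₈ =
    ((X ^ 2 - 2 * X - 1) * (X ^ 2 + 2 * X - 1) * (X ^ 2 + 1) ^ 2) ^ 2 := by
  rw [a₂₈, b₂₈]; ring

theorem two_mul_sq_ne (w : ℚ) {z : ℚ} (hz : z ≠ 0) : 2 * z ^ 2 ≠ w ^ 2 := fun h =>
  sq_ne_natCast (n := 2) (k := 1) (by norm_num) (by norm_num) (w / z)
    (by rw [div_pow, ← h, mul_div_cancel_right₀ _ (pow_ne_zero 2 hz)]; norm_num)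

theorem eq_of_C_eq_sq {c : ℚ} (hc : c ≠ 0) {s : QuadraticAlgebra ℚ (-1) 0}
    (h : QuadraticAlgebra.C c = s ^ 2) : ∃ z, z ≠ 0 ∧ (c = z ^ 2 ∨ c = -z ^ 2) := by
  have h₁ := congrArg QuadraticAlgebra.re h
  have h₂ := congrArg QuadraticAlgebra.im h
  simp [sq] at h₁ h₂
  have h₃ : s.re * s.im = 0 := by linear_combination -h₂ / 2
  obtain h₄ | h₄ := mul_eq_zero.1 h₃
  · rw [h₄] at h₁
    refine ⟨s.im, ?_, .inr (by linear_combination h₁)⟩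
    intro h5; rw [h5] at h₁; exact hc (by linear_combination h₁)
  · rw [h₄] at h₁
    refine ⟨s.re, ?_, .inl (by linear_combination h₁)⟩
    intro h5; rw [h5] at h₁; exact hc (by linear_combination h₁)

theorem eq_of_omega_mul_eq_sq {c : ℚ} (hc : c ≠ 0) {s : QuadraticAlgebra ℚ (-1) 0}
    (h : (⟨0, -2 * c⟩ : QuadraticAlgebra ℚ (-1) 0) = s ^ 2) :
    ∃ z, z ≠ 0 ∧ (c = z ^ 2 ∨ c = -z ^ 2) := by
  have h₁ := congrArg QuadraticAlgebra.re h
  have h₂ := congrArg QuadraticAlgebra.im h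
  simp [sq] at h₁ h₂
  have h₃ : (s.re - s.im) * (s.re + s.im) = 0 := by linear_combination -h₁
  obtain h₄ | h₄ := mul_eq_zero.1 h₃
  · have h₄ : s.re = s.im := by linear_combination h₄
    rw [h₄] at h₂
    refine ⟨s.im, ?_, .inr (by linear_combination -h₂ / 2)⟩
    intro h5; rw [h5] at h₂; exact hc (by linear_combination -h₂ / 2)
  · have h₄ : s.re = -s.im := by linear_combination h₄
    rw [h₄] at h₂
    refine ⟨s.im, ?_, .inl (by linear_combination -h₂ / 2)⟩
    intro h5; rw [h5] at h₂; exact hc (by linear_combination -h₂ / 2)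

/-- At η = 1 + √2 both allowed classes have square norm. The norms of η, η - 1, η + 1 are -1, -2, 2,
so X, X - 1, X + 1 occur all together or not at all. At i the residue is a square in ℚ(i), and -2i =
(1 - i)², so the constant is ± a square. -/
theorem class₂₈ {x y : Qt} (hx : x ≠ 0)
    (h : y ^ 2 = x * (x ^ 2 + algebraMap ℚ[X] Qt a₂₈ * x + algebraMap ℚ[X] Qt b₂₈)) :
    ∃ z, z ≠ 0 ∧ (x = z ^ 2 ∨ x = -1 * z ^ 2 ∨
      x = algebraMap ℚ[X] Qt (X * (X - 1) * (X + 1)) * z ^ 2 ∨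
      x = algebraMap ℚ[X] Qt (-(X * (X - 1) * (X + 1))) * z ^ 2) := by
  obtain ⟨d, M, N, W, hd, hdb, hM, hN, hMN, hxe, hW⟩ := exists_descent_datum hx h
  have hX1 : Irreducible (X - 1 : ℚ[X]) := irreducible_X_sub_C 1
  have hX1' : Irreducible (X + 1 : ℚ[X]) := by simpa using irreducible_X_sub_C (-1 : ℚ)
  obtain ⟨θ, hθ⟩ : ∃ θ : QuadraticAlgebra ℚ (-1) 0, θ = ⟨0, 1⟩ := ⟨_, rfl⟩
  have hθ2 : θ ^ 2 = -1 := by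
    rw [hθ]; ext <;> simp [sq]
  have hθ0 : θ ≠ 0 := by rintro rfl; norm_num at hθ2
  have h₁ : evalQuadratic (-1) θ d ≠ 0 → ∃ z, z ≠ 0 ∧ evalQuadratic (-1) θ d = z ^ 2 := by
    refine exists_sq_of_node (evalQuadratic (-1) θ) hW hMN (s := 8 * θ) ?_ ?_ ?_
    · rw [disc₂₈]
      simp only [map_mul, map_add, map_pow, map_one, evalQuadratic_X, hθ2]
      ring
    · refine mul_ne_zero ?_ hθ0
      intro h; simpa using congrArg QuadraticAlgebra.re h
    · rw [a₂₈]
      simp only [map_mul, map_add, map_sub, map_pow, map_one, map_ofNat, evalQuadratic_X]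
      rw [show (θ ^ 4 : QuadraticAlgebra ℚ (-1) 0) = (θ ^ 2) ^ 2 by ring, mul_pow, hθ2]
      norm_num
  obtain ⟨η, hη⟩ : ∃ η : QuadraticAlgebra ℚ 2 0, η = ⟨1, 1⟩ := ⟨_, rfl⟩
  have hη2 : η ^ 2 = 2 * η + 1 := by
    rw [hη]; ext <;> simp [sq] <;> norm_num
  have hη0 : η ≠ 0 := by
    rw [hη]; intro h; simpa using congrArg QuadraticAlgebra.re h
  have hηa : evalQuadratic 2 η a₂₈ = 32 * η ^ 4 := by
    rw [a₂₈]
    simp only [map_mul, map_add, map_sub, map_pow, map_one, map_ofNat, evalQuadratic_X]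
    rw [show η ^ 2 - 1 = 2 * η by rw [hη2]; ring]
    ring
  have h₂ : evalQuadratic 2 η d ≠ 0 →
      IsSquare (QuadraticAlgebra.norm (evalQuadratic 2 η d)) := by
    intro hd0
    obtain ⟨z, hz, e⟩ | ⟨z, hz, e⟩ := isSquare_or_of_node (evalQuadratic 2 η) hW hMN (by
      rw [disc₂₈]
      simp only [map_mul, map_add, map_sub, map_pow, map_one, map_ofNat, evalQuadratic_X]
      rw [show η ^ 2 - 2 * η - 1 = 0 by rw [hη2]; ring]
      ring) (by
        rw [hηa]
        refine mul_ne_zero ?_ (pow_ne_zero 4 hη0)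
        intro h; simpa using congrArg QuadraticAlgebra.re h) hd0
    · rw [e, sq, map_mul]
      exact ⟨_, rfl⟩
    · rw [e, hηa, show -2 * (32 * η ^ 4) * z ^ 2 = -((8 * η ^ 2 * z) * (8 * η ^ 2 * z)) by ring,
        QuadraticAlgebra.norm_neg, map_mul]
      exact ⟨_, rfl⟩
  have hη1 : η - 1 ≠ 0 := by
    rw [hη]; intro h; simpa using congrArg QuadraticAlgebra.im h
  have hη1' : η + 1 ≠ 0 := by
    rw [hη]; intro h; simpa using congrArg QuadraticAlgebra.im h
  have n₀ : ∀ c : ℚ, QuadraticAlgebra.norm (QuadraticAlgebra.C c : QuadraticAlgebra ℚ 2 0) = c ^ 2 :=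
    fun c => QuadraticAlgebra.norm_algebraMap c
  have n₁ : QuadraticAlgebra.norm η = -1 := by
    rw [QuadraticAlgebra.norm_def, hη]; norm_num
  have n₂ : QuadraticAlgebra.norm (η - 1) = -2 := by
    rw [QuadraticAlgebra.norm_def, hη]; simp
  have n₃ : QuadraticAlgebra.norm (η + 1) = 2 := by
    rw [QuadraticAlgebra.norm_def, hη]; simp; norm_num
  have hb : b₂₈ = X ^ 4 * ((X - 1) ^ 4 * ((X + 1) ^ 4 * C 16)) := by
    rw [b₂₈, show (C 16 : ℚ[X]) = 16 from rfl]; ring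
  rw [hb] at hdb
  obtain h₄ | ⟨d₁, hd₁, rfl, h₄⟩ := squarefree_dvd_cases irreducible_X hd hdb <;>
  obtain h₅ | ⟨d₂, hd₂, rfl, h₅⟩ := squarefree_dvd_cases hX1 ‹_› h₄ <;>
  obtain h₆ | ⟨d₃, hd₃, rfl, h₆⟩ := squarefree_dvd_cases hX1' ‹_› h₅ <;>
  obtain ⟨c, hc, rfl⟩ := exists_eq_C_of_dvd_C (by norm_num) h₆
  · simp only [evalQuadratic_C] at h₁
    obtain ⟨s, hs, e⟩ := h₁ (fun h => hc (QuadraticAlgebra.C_eq_zero_iff.1 h))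
    obtain ⟨z, hz, rfl | rfl⟩ := eq_of_C_eq_sq hc e
    · obtain ⟨w, hw, e'⟩ := exists_sq_of_datum hM hN hxe 1 1 (C z) one_ne_zero (C_ne_zero.2 hz)
        (by rw [C_pow]; ring)
      exact ⟨w, hw, .inl (by rw [e', map_one, one_mul])⟩
    · obtain ⟨w, hw, e'⟩ := exists_sq_of_datum hM hN hxe (-1) 1 (C z) one_ne_zero
        (C_ne_zero.2 hz) (by rw [C_neg, C_pow]; ring)
      exact ⟨w, hw, .inr (.inl (by rw [e', map_neg, map_one]))⟩
  -- The last of the seven remaining cases, d = cX(X - 1)(X + 1), is the only one of them that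
  -- survives.
  pick_goal 7
  · have hev : evalQuadratic (-1) θ (X * ((X - 1) * ((X + 1) * C c))) = ⟨0, -2 * c⟩ := by
      simp only [map_mul, map_add, map_sub, map_one, evalQuadratic_X, evalQuadratic_C]
      rw [show θ * ((θ - 1) * ((θ + 1) * QuadraticAlgebra.C c)) =
        θ * (θ ^ 2 - 1) * QuadraticAlgebra.C c by ring, hθ2, hθ]
      ext <;> simp
      ring
    rw [hev] at h₁
    obtain ⟨s, hs, e⟩ := h₁ (fun h => hc (by simpa using congrArg QuadraticAlgebra.im h))
    obtain ⟨z, hz, rfl | rfl⟩ := eq_of_omega_mul_eq_sq hc e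
    · obtain ⟨w, hw, e'⟩ := exists_sq_of_datum hM hN hxe (X * (X - 1) * (X + 1)) 1 (C z)
        one_ne_zero (C_ne_zero.2 hz) (by rw [C_pow]; ring)
      exact ⟨w, hw, .inr (.inr (.inl e'))⟩
    · obtain ⟨w, hw, e'⟩ := exists_sq_of_datum hM hN hxe (-(X * (X - 1) * (X + 1))) 1 (C z)
        one_ne_zero (C_ne_zero.2 hz) (by rw [C_neg, C_pow]; ring)
      exact ⟨w, hw, .inr (.inr (.inr e'))⟩
  all_goals
    exfalso
    simp only [map_mul, map_add, map_sub, map_one, evalQuadratic_X, evalQuadratic_C, n₀, n₁, n₂,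
      n₃] at h₂
    obtain ⟨w, e⟩ := h₂ (by
      simp [hη0, hη1, hη1', hc])
    first
    | nlinarith [mul_self_nonneg w, sq_pos_of_ne_zero hc]
    | exact two_mul_sq_ne w hc (by linear_combination e)

/-- The constant is a square by the condition at infinity. The three quadratic factors take the
values -1, -1, 1 at 0 and -2, 2, 2 at 1, and no nonempty product of them is a square at both. -/
theorem dual_class₂₈ {x y : Qt} (hx : x ≠ 0)
    (h : y ^ 2 = x * (x ^ 2 + algebraMap ℚ[X] Qt (-2 * a₂₈) * x +
      algebraMap ℚ[X] Qt (a₂₈ ^ 2 - 4 * b₂₈))) :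
    ∃ z, z ≠ 0 ∧ x = z ^ 2 := by
  obtain ⟨d, M, N, W, hd, hdb, hM, hN, hMN, hxe, hW⟩ := exists_descent_datum hx h
  have hq₁ : Irreducible (X ^ 2 - 2 * X - 1 : ℚ[X]) := by
    convert irreducible_quadratic (u := 1) (v := -2) (w := -1) (by norm_num)
      (fun r h => sq_ne_natCast (n := 8) (k := 2) (by norm_num) (by norm_num) r
        (by rw [h]; norm_num)) using 1
    simp only [map_neg, map_one, map_ofNat]; ring
  have hq₂ : Irreducible (X ^ 2 + 2 * X - 1 : ℚ[X]) := by
    convert irreducible_quadratic (u := 1) (v := 2) (w := -1) (by norm_num)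
      (fun r h => sq_ne_natCast (n := 8) (k := 2) (by norm_num) (by norm_num) r
        (by rw [h]; norm_num)) using 1
    simp only [map_neg, map_one, map_ofNat]; ring
  have hq₃ : Irreducible (X ^ 2 + 1 : ℚ[X]) := by
    convert irreducible_quadratic (u := 1) (v := 0) (w := 1) one_ne_zero
      (fun r h => by nlinarith [sq_nonneg r]) using 1
    simp only [map_one, map_zero]; ring
  have hq₁m : (X ^ 2 - 2 * X - 1 : ℚ[X]).Monic := by monicity!
  have hq₂m : (X ^ 2 + 2 * X - 1 : ℚ[X]).Monic := by monicity!
  have hq₃m : (X ^ 2 + 1 : ℚ[X]).Monic := by monicity!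
  have hdisc : (-2 * a₂₈) ^ 2 - 4 * (a₂₈ ^ 2 - 4 * b₂₈) = 16 * b₂₈ := by ring
  have hinf : Even d.natDegree ∧ ∃ z, z ≠ 0 ∧ d.leadingCoeff = z ^ 2 := by
    have ha : a₂₈ = X ^ 8 - 4 * X ^ 6 + 22 * X ^ 4 - 4 * X ^ 2 + 1 := by rw [a₂₈]; ring
    have em : a₂₈.Monic := by rw [ha]; monicity!
    have e' : a₂₈.natDegree = 8 := by rw [ha]; compute_degree!
    have e2 : (-2 : ℚ[X]) = C (-2) := by rw [C_neg]; rfl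
    refine even_natDegree_of_node_infinity hW hd.ne_zero hM hN (n := 4) ?_ (c := 2) (by norm_num)
      ?_ ?_
    · rw [e2, natDegree_C_mul (by norm_num), e']
    · rw [e2, leadingCoeff_mul, em.leadingCoeff, leadingCoeff_C]; norm_num
    · rw [hdisc, b₂₈]
      have : (16 * ((X ^ 2 - 1) ^ 4 * (16 * X ^ 4)) : ℚ[X]).natDegree ≤ 12 := by
        compute_degree
      omega
  have h₀ : d.eval 0 ≠ 0 → ∃ z, z ≠ 0 ∧ d.eval 0 = z ^ 2 :=
    exists_sq_eval_of_node 0 2 hW hMN (by rw [hdisc, b₂₈]; norm_num)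
      (by norm_num) (by rw [a₂₈]; norm_num)
  have h₁ : d.eval 1 ≠ 0 → ∃ z, z ≠ 0 ∧ d.eval 1 = z ^ 2 :=
    exists_sq_eval_of_node 1 8 hW hMN (by rw [hdisc, b₂₈]; norm_num)
      (by norm_num) (by rw [a₂₈]; norm_num)
  have hb : a₂₈ ^ 2 - 4 * b₂₈ = (X ^ 2 - 2 * X - 1) ^ 2 * ((X ^ 2 + 2 * X - 1) ^ 2 *
      ((X ^ 2 + 1) ^ 4 * C 1)) := by
    rw [disc₂₈, C_1]; ring
  rw [hb] at hdb
  obtain h₄ | ⟨d₁, hd₁, rfl, h₄⟩ := squarefree_dvd_cases hq₁ hd hdb <;>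
  obtain h₅ | ⟨d₂, hd₂, rfl, h₅⟩ := squarefree_dvd_cases hq₂ ‹_› h₄ <;>
  obtain h₆ | ⟨d₃, hd₃, rfl, h₆⟩ := squarefree_dvd_cases hq₃ ‹_› h₅ <;>
  obtain ⟨c, hc, rfl⟩ := exists_eq_C_of_dvd_C (by norm_num) h₆ <;>
  obtain ⟨-, z, hz, e⟩ := hinf <;>
  obtain ⟨w, hw, e'⟩ := h₁ (by norm_num [hc]) <;>
  obtain ⟨u, hu, e''⟩ := h₀ (by norm_num [hc]) <;>
  simp only [leadingCoeff_mul, hq₁m.leadingCoeff, hq₂m.leadingCoeff, hq₃m.leadingCoeff,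
    leadingCoeff_C, one_mul] at e <;>
  norm_num at e' e'' <;> subst e
  · obtain ⟨w, hw, e'⟩ := exists_sq_of_datum hM hN hxe 1 1 (C z) one_ne_zero (C_ne_zero.2 hz)
      (by rw [C_pow]; ring)
    exact ⟨w, hw, by rw [e', map_one, one_mul]⟩
  all_goals
    exfalso
    first
    | nlinarith [sq_nonneg w, sq_nonneg u, sq_pos_of_ne_zero hz]
    | exact two_mul_sq_ne _ hz e'

end DescentTwoEight

end KubertFamilies

end

open WeierstrassCurve

noncomputable section

namespace KubertFamilies

open WeierstrassCurve.Affine Polynomial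

/-! ### Odd torsion of the three families -/

section OddCycles

variable {x y : ℕ → ℚ[X]} {p : ℕ}

theorem DoublingCycle.exists_order_at {a b : ℚ[X]} (h : DoublingCycle a b x y p) (r : ℚ)
    (ha : 0 < a.eval r) {e : ℕ} (he : 0 < e) {b₀ : ℚ[X]} (hb : b = (X - C r) ^ e * b₀)
    (hb₀ : b₀.eval r ≠ 0) :
    ∃ m : ℕ → ℕ, ∀ k, (X - C r) ^ m k ∣ x k ∧ 1 ≤ m k ∧ m k < e ∧ 2 * m k ≠ e ∧
      m (k + 1) + 2 * m k = 2 * min (2 * m k) e := by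
  obtain ⟨m, hm⟩ := (h.comp r).exists_order (by simpa using ha) he
    (b₀ := b₀.comp (X + C r)) (by rw [hb]; simp) (by simpa using hb₀)
  refine ⟨m, fun k => ⟨?_, (hm k).2⟩⟩
  obtain ⟨q, hq⟩ := (hm k).1
  refine ⟨q.comp (X - C r), ?_⟩
  have := congrArg (fun f => f.comp (X - C r)) hq
  simpa [comp_assoc] using this

/-- At 0 the exponent is e = 4, and the orders 1 and 3 both double to the forbidden order 2: the
component group ℤ/8 has no odd torsion. -/
theorem DoublingCycle.false_of_twoEight (h : DoublingCycle a₂₈ b₂₈ x y p) : False := by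
  obtain ⟨m, hm⟩ := h.exists_order_at 0 (by rw [a₂₈]; norm_num) (e := 4) (by norm_num)
    (b₀ := 16 * (X ^ 2 - 1) ^ 4) (by rw [b₂₈, C_0]; ring) (by norm_num)
  have h0 := hm 0
  have h1 := hm 1
  rw [zero_add] at h0
  omega

theorem DoublingCycle.exists_eq_of_ten (h : DoublingCycle a₁₀ b₁₀ x y p) :
    ∃ k, x k = 4 * X ^ 4 * (X - 1) ^ 2 := by
  obtain ⟨m, hm⟩ := h.exists_order_at 0 (by rw [a₁₀]; norm_num) (e := 5) (by norm_num)
    (b₀ := 16 * (X - 1) ^ 5 * (X ^ 2 - 3 * X + 1)) (by rw [b₁₀, C_0]; ring) (by norm_num)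
  obtain ⟨m', hm'⟩ := h.exists_order_at 1 (by rw [a₁₀]; norm_num) (e := 5) (by norm_num)
    (b₀ := 16 * X ^ 5 * (X ^ 2 - 3 * X + 1)) (by rw [b₁₀, C_1]; ring) (by norm_num)
  have hdeg : ∀ k, (x k).natDegree ≤ 6 := by
    refine fun k => h.natDegree_le (n := 3) ?_ ?_ k
    · rw [a₁₀]; compute_degree
    · rw [b₁₀]; compute_degree
  have hcop : IsCoprime (X - C 0 : ℚ[X]) (X - C 1) :=
    isCoprime_X_sub_C_of_isUnit_sub (by norm_num)
  have hdvd : ∀ k i j, i ≤ m k → j ≤ m' k →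
      ∃ q, x k = (X - C 0) ^ i * (X - C 1) ^ j * q ∧ i + j + q.natDegree ≤ 6 := by
    intro k i j hi hj
    have h1 : (X - C 0) ^ i * (X - C 1) ^ j ∣ x k :=
      hcop.pow.mul_dvd ((pow_dvd_pow _ hi).trans (hm k).1) ((pow_dvd_pow _ hj).trans (hm' k).1)
    obtain ⟨q, hq⟩ := h1
    have hq0 : q ≠ 0 := by
      rintro rfl
      exact h.x_ne_zero k (by rw [hq, mul_zero])
    have hd := hdeg k
    have hmon : ((X - C 0) ^ i * (X - C 1) ^ j : ℚ[X]).Monic :=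
      ((monic_X_sub_C _).pow _).mul ((monic_X_sub_C _).pow _)
    rw [hq, hmon.natDegree_mul' hq0, ((monic_X_sub_C _).pow _).natDegree_mul
      ((monic_X_sub_C _).pow _), natDegree_pow, natDegree_pow, natDegree_X_sub_C,
      natDegree_X_sub_C] at hd
    exact ⟨q, hq, by omega⟩
  have hform : ∀ k i j, i ≤ m k → j ≤ m' k → i + j = 6 →
      ∃ c, x k = C c * (X ^ i * (X - 1) ^ j) := by
    intro k i j hi hj hij
    obtain ⟨q, hq, hd⟩ := hdvd k i j hi hj
    rw [eq_C_of_natDegree_eq_zero (p := q) (by omega)] at hq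
    exact ⟨q.coeff 0, by rw [hq, C_0, C_1, sub_zero]; ring⟩
  have hle : ∀ k, ¬ (4 ≤ m k ∧ 4 ≤ m' k) := by
    rintro k ⟨h1, h2⟩
    obtain ⟨q, -, hd⟩ := hdvd k 4 4 h1 h2
    omega
  -- With e = 5 the orders alternate between 2 and 4 after at most two steps. They cannot be 4 at 0
  -- and at 1 simultaneously, as deg x ≤ 6, so the two places are in opposite phase.
  obtain ⟨k, hk4, hk2, hk2', hk4'⟩ : ∃ k, 4 ≤ m k ∧ 2 ≤ m' k ∧ 2 ≤ m (k + 1) ∧ 4 ≤ m' (k + 1) := by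
    have a0 := hm 0
    have a1 := hm 1
    have a2 := hm 2
    have a3 := hm 3
    have b0 := hm' 0
    have b1 := hm' 1
    have b2 := hm' 2
    have b3 := hm' 3
    have l2 := hle 2
    have l3 := hle 3
    norm_num at a0 a1 a2 a3 b0 b1 b2 b3
    by_cases h4 : 4 ≤ m 2
    · refine ⟨2, ?_⟩; norm_num; omega
    · refine ⟨3, ?_⟩; norm_num; omega
  obtain ⟨c, hc⟩ := hform k 4 2 hk4 hk2 rfl
  obtain ⟨κ, hκ⟩ := hform (k + 1) 2 4 hk2' hk4' rfl
  have hc0 : c ≠ 0 := by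
    rintro rfl
    exact h.x_ne_zero k (by rw [hc, C_0, zero_mul])
  have hd := h.double k
  rw [h.eqn, hc, hκ, b₁₀] at hd
  have hd' : 4 * C c * C κ * (C c ^ 2 * X ^ 4 * (X - 1) ^ 2 + a₁₀ * C c
      + 16 * X * (X - 1) ^ 3 * (X ^ 2 - 3 * X + 1)) =
      (C c ^ 2 * X ^ 3 - 16 * (X - 1) * (X ^ 2 - 3 * X + 1)) ^ 2 := by
    have hX : (X ^ 10 * (X - 1) ^ 8 : ℚ[X]) ≠ 0 :=
      mul_ne_zero (pow_ne_zero _ X_ne_zero) (pow_ne_zero _ (monic_X_sub_C (1 : ℚ)).ne_zero)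
    refine mul_left_cancel₀ hX ?_
    linear_combination hd
  -- At the root 1/2 of the discriminant the equation factors as (c - 4)²(4cκ - (c + 4)²) = 0.
  -- Combined with the value at 0 it leaves a cubic in c whose only rational root is 4.
  have e0 := congrArg (eval 0) hd'
  have e1 := congrArg (eval (1 / 2)) hd'
  rw [a₁₀] at e0 e1
  norm_num at e0 e1
  have hc4 : c = 4 := by
    by_contra hc4
    have hc4' : c - 4 ≠ 0 := sub_ne_zero.2 hc4
    have h1 : 4 * c * κ = (c + 4) ^ 2 := by
      refine mul_left_cancel₀ (pow_ne_zero 2 hc4') ?_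
      linear_combination 64 * e1
    have h2 : (c - 4) * ((c + 6) ^ 2 + 28) = 0 := by linear_combination e0 - c * h1
    obtain h3 | h3 := mul_eq_zero.1 h2
    · exact hc4' h3
    · nlinarith [sq_nonneg (c + 6)]
  refine ⟨k, ?_⟩
  rw [hc, hc4, show (C 4 : ℚ[X]) = 4 from rfl]
  ring

theorem DoublingCycle.exists_eq_of_twelve (h : DoublingCycle a₁₂ b₁₂ x y p) :
    ∃ k, x k = 64 * (X + 1) ^ 4 := by
  have ha8 : a₁₂.natDegree ≤ 2 * 4 := by rw [a₁₂]; compute_degree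
  have hb10 : b₁₂.natDegree ≤ 10 := by rw [b₁₂]; compute_degree
  have hb16 : b₁₂.natDegree ≤ 4 * 4 := hb10.trans (by norm_num)
  obtain ⟨m, hm⟩ := h.exists_order_at (-1) (by rw [a₁₂]; norm_num) (e := 6) (by norm_num)
    (b₀ := 1024 * (X ^ 2 + 3) ^ 2) (by rw [b₁₂, C_neg, C_1]; ring) (by norm_num)
  have hac : a₁₂.coeff 8 = 1 := by rw [a₁₂]; compute_degree!
  have hbc : b₁₂.coeff 10 = 1024 := by rw [b₁₂]; compute_degree!
  obtain ⟨m', hm'⟩ := (h.reflect ha8 hb16).exists_order (e := 6)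
    (b₀ := Polynomial.reflect 10 b₁₂) (by rw [← coeff_zero_eq_eval_zero, coeff_reflect]; simp [hac])
    (by norm_num) (by
      have := reflect_mul b₁₂ (1 : ℚ[X]) hb10 (by simp : (1 : ℚ[X]).natDegree ≤ 6)
      rw [mul_one] at this
      rw [this, reflect_one]; ring)
    (by rw [← coeff_zero_eq_eval_zero, coeff_reflect]; simp [hbc])
  -- For e = 6 and m ≠ 3 the recurrence reaches its fixed point 4 within two steps, both at -1 and
  -- at infinity. Hence (X + 1)⁴ divides x and deg x ≤ 8 - 4.
  have h4 : ∀ k, m (k + 2) = 4 ∧ m' (k + 2) = 4 := by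
    intro k
    have a0 := hm k
    have a1 := hm (k + 1)
    have b0 := hm' k
    have b1 := hm' (k + 1)
    rw [add_assoc] at a1 b1
    norm_num at a1 b1
    omega
  have hform : ∀ k, ∃ c, x (k + 2) = C c * (X + 1) ^ 4 := by
    intro k
    have hd : (x (k + 2)).natDegree ≤ 4 := by
      refine natDegree_le_iff_coeff_eq_zero.2 fun i hi => ?_
      by_cases hi8 : 8 < i
      · exact coeff_eq_zero_of_natDegree_lt ((h.natDegree_le ha8 hb16 _).trans_lt hi8)
      · have h1 := (hm' (k + 2)).1
        rw [(h4 k).2] at h1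
        have h2 := X_pow_dvd_iff.1 h1 (8 - i) (by omega)
        rw [coeff_reflect, revAt_le (by omega)] at h2
        rwa [show 2 * 4 - (8 - i) = i by omega] at h2
    have h1 := (hm (k + 2)).1
    rw [(h4 k).1] at h1
    obtain ⟨q, hq⟩ := h1
    have hq0 : q ≠ 0 := by
      rintro rfl
      exact h.x_ne_zero _ (by rw [hq, mul_zero])
    rw [hq, ((monic_X_sub_C _).pow _).natDegree_mul' hq0, natDegree_pow, natDegree_X_sub_C] at hd
    rw [eq_C_of_natDegree_eq_zero (p := q) (by omega)] at hq
    exact ⟨q.coeff 0, by rw [hq, C_neg, C_1]; ring⟩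
  obtain ⟨c, hc⟩ := hform 0
  obtain ⟨κ, hκ⟩ := hform 1
  have hc0 : c ≠ 0 := by
    rintro rfl
    exact h.x_ne_zero _ (by rw [hc, C_0, zero_mul])
  have hd := h.double 2
  rw [h.eqn] at hd
  norm_num at hc hκ
  rw [hc, hκ, b₁₂] at hd
  have hd' : 4 * C c * C κ * (C c ^ 2 * (X + 1) ^ 4 + a₁₂ * C c
      + 1024 * (X ^ 2 + 3) ^ 2 * (X + 1) ^ 2) =
      (C c ^ 2 * (X + 1) ^ 2 - 1024 * (X ^ 2 + 3) ^ 2) ^ 2 := by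
    have hX : ((X + 1) ^ 12 : ℚ[X]) ≠ 0 := pow_ne_zero _ (monic_X_add_C (1 : ℚ)).ne_zero
    refine mul_left_cancel₀ hX ?_
    linear_combination hd
  -- The values at -1 and at the root 1 of the discriminant determine c as in the ℤ/10 family, now
  -- with 64 as the only rational root.
  have e0 := congrArg (eval (-1)) hd'
  have e1 := congrArg (eval 1) hd'
  rw [a₁₂] at e0 e1
  norm_num at e0 e1
  have hc4 : c = 64 := by
    by_contra hc4
    have hc4' : c - 64 ≠ 0 := sub_ne_zero.2 hc4
    have h1 : 4 * c * κ = (c + 64) ^ 2 := by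
      refine mul_left_cancel₀ (pow_ne_zero 2 hc4') ?_
      linear_combination e1 / 16
    have h2 : (c - 64) * ((c + 96) ^ 2 + 7168) = 0 := by linear_combination e0 / 256 - c * h1
    obtain h3 | h3 := mul_eq_zero.1 h2
    · exact hc4' h3
    · nlinarith [sq_nonneg (c + 96)]
  refine ⟨2, ?_⟩
  rw [hc, hc4]
  rfl

end OddCycles

end KubertFamilies

end

open WeierstrassCurve

noncomputable section

namespace KubertFamilies

open WeierstrassCurve.Affine Polynomial

/-! ### Abstract group theory: orders and generators -/

section GroupStructure

variable {G : Type*} [AddCommGroup G]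

theorem mem_of_odd_nsmul_of_two_pow_nsmul {Z : AddSubgroup G} {P : G} {N k : ℕ} (hN : Odd N)
    (hNP : N • P ∈ Z) (hk : 2 ^ k • P ∈ Z) : P ∈ Z := by
  have hcop : IsCoprime (N : ℤ) ((2 ^ k : ℕ) : ℤ) :=
    Nat.isCoprime_iff_coprime.2 ((Nat.coprime_two_left.2 hN).symm.pow_right k)
  obtain ⟨u, v, huv⟩ := hcop
  have : P = u • (N • P) + v • (2 ^ k • P) := by
    rw [← natCast_zsmul, ← natCast_zsmul, ← mul_zsmul, ← mul_zsmul, ← add_zsmul, huv, one_zsmul]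
  rw [this]
  exact Z.add_mem (Z.zsmul_mem hNP u) (Z.zsmul_mem hk v)

/-- Since rP lies in H, the point 2ᵐP is killed by the odd number r and so lies in Z; Bézout for r
and 2ᵐ then recovers P. -/
theorem mem_of_odd_nsmul_mem {H Z : AddSubgroup G} (hHZ : H ≤ Z) {m : ℕ}
    (hH : ∀ P ∈ H, 2 ^ m • P = 0) (hZ : ∀ (P : G) (N : ℕ), Odd N → N • P = 0 → P ∈ Z)
    {P : G} {r : ℕ} (hr : Odd r) (hrP : r • P ∈ H) : P ∈ Z := by
  refine mem_of_odd_nsmul_of_two_pow_nsmul (k := m) hr (hHZ hrP) (hZ _ r hr ?_)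
  rw [smul_comm]
  exact hH _ hrP

theorem torsion_equiv_and_rank_of_equiv {M : Type*} [AddCommGroup M] [Finite M] (e : G ≃+ M) :
    Nonempty (AddCommGroup.torsion G ≃+ M) ∧ Module.rank ℤ G = 0 := by
  have : Finite G := Finite.of_equiv M e.symm.toEquiv
  constructor
  · have htop : AddCommGroup.torsion G = ⊤ :=
      top_unique fun x _ => isOfFinAddOrder_of_finite x
    exact ⟨(AddEquiv.addSubgroupCongr htop).trans (AddSubgroup.topEquiv.trans e)⟩
  · rw [rank_eq_zero_iff]
    intro x
    exact ⟨addOrderOf x, by exact_mod_cast (addOrderOf_pos x).ne', by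
      rw [natCast_zsmul, addOrderOf_nsmul_eq_zero]⟩

theorem exists_equiv_zmod {g : G} (hg : ∀ x : G, x ∈ AddSubgroup.zmultiples g) {n : ℕ}
    (ho : addOrderOf g = n) : Nonempty (G ≃+ ZMod n) := by
  have hc : IsAddCyclic G := ⟨g, hg⟩
  refine ⟨(zmodAddCyclicAddEquiv hc).symm.trans ?_⟩
  rw [← ho, addOrderOf_eq_card_of_forall_mem_zmultiples hg]

theorem exists_equiv_zmod_two_prod {s g : G} {n : ℕ}
    (hs : 2 • s = 0) (hg : addOrderOf g = n) (hsg : s ∉ AddSubgroup.zmultiples g)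
    (h : ∀ x : G, x ∈ AddSubgroup.zmultiples s ⊔ AddSubgroup.zmultiples g) :
    Nonempty (G ≃+ ZMod 2 × ZMod n) := by
  have hs' : (zmultiplesHom G s) (2 : ℕ) = 0 := by
    rw [zmultiplesHom_apply, natCast_zsmul, hs]
  have hg' : (zmultiplesHom G g) n = 0 := by
    rw [zmultiplesHom_apply, natCast_zsmul, ← hg, addOrderOf_nsmul_eq_zero]
  obtain ⟨φ, hφ⟩ : ∃ φ : ZMod 2 × ZMod n →+ G, φ = (ZMod.lift 2 ⟨zmultiplesHom G s, hs'⟩).coprod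
    (ZMod.lift n ⟨zmultiplesHom G g, hg'⟩) := ⟨_, rfl⟩
  have hφv : ∀ i j : ℤ, φ ((i : ZMod 2), (j : ZMod n)) = i • s + j • g := by
    intro i j
    rw [hφ, AddMonoidHom.coprod_apply, ZMod.lift_coe, ZMod.lift_coe]
    rfl
  refine ⟨(AddEquiv.ofBijective φ ⟨?_, ?_⟩).symm⟩
  · rw [injective_iff_map_eq_zero]
    rintro ⟨i, j⟩ hij
    obtain ⟨i, rfl⟩ := ZMod.intCast_surjective i
    obtain ⟨j, rfl⟩ := ZMod.intCast_surjective j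
    rw [hφv] at hij
    have hi : Even i := by
      by_contra hi
      obtain ⟨k, rfl⟩ := Int.not_even_iff_odd.1 hi
      refine hsg (AddSubgroup.mem_zmultiples_iff.2 ⟨-j, ?_⟩)
      have h2 : (2 * k : ℤ) • s = 0 := by
        rw [mul_comm, mul_zsmul, ofNat_zsmul, hs, zsmul_zero]
      rw [add_zsmul, h2, one_zsmul, zero_add] at hij
      rw [neg_zsmul, neg_eq_iff_add_eq_zero, add_comm, hij]
    have hi0 : i • s = 0 := by
      obtain ⟨k, rfl⟩ := hi.two_dvd
      rw [mul_comm, mul_zsmul, ofNat_zsmul, hs, zsmul_zero]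
    rw [hi0, zero_add] at hij
    have hj : (n : ℤ) ∣ j := by
      rw [← hg]; exact addOrderOf_dvd_iff_zsmul_eq_zero.2 hij
    rw [Prod.mk_eq_zero]
    exact ⟨(ZMod.intCast_zmod_eq_zero_iff_dvd i 2).2 (by exact_mod_cast hi.two_dvd),
      (ZMod.intCast_zmod_eq_zero_iff_dvd j n).2 hj⟩
  · intro x
    obtain ⟨a, ha, b, hb, rfl⟩ := AddSubgroup.mem_sup.1 (h x)
    obtain ⟨i, rfl⟩ := AddSubgroup.mem_zmultiples_iff.1 ha
    obtain ⟨j, rfl⟩ := AddSubgroup.mem_zmultiples_iff.1 hb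
    exact ⟨(i, j), hφv i j⟩

theorem finite_zmultiples_of_nsmul_eq_zero {g : G} {n : ℕ} (hn : 0 < n) (h : n • g = 0) :
    (AddSubgroup.zmultiples g : Set G).Finite :=
  _root_.finite_zmultiples.2 (isOfFinAddOrder_iff_nsmul_eq_zero.2 ⟨n, hn, h⟩)

theorem nsmul_eq_zero_of_mem_zmultiples {g P : G} {n : ℕ} (h : n • g = 0)
    (hP : P ∈ AddSubgroup.zmultiples g) : n • P = 0 := by
  obtain ⟨k, rfl⟩ := AddSubgroup.mem_zmultiples_iff.1 hP
  rw [smul_comm, h, zsmul_zero]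

theorem mem_zmultiples_add {g₁ g₂ : G} (h : (addOrderOf g₁).Coprime (addOrderOf g₂)) :
    g₁ ∈ AddSubgroup.zmultiples (g₁ + g₂) ∧ g₂ ∈ AddSubgroup.zmultiples (g₁ + g₂) := by
  have h₂ : g₂ ∈ AddSubgroup.zmultiples (g₁ + g₂) := by
    obtain ⟨u, v, huv⟩ := Nat.isCoprime_iff_coprime.2 h
    refine AddSubgroup.mem_zmultiples_iff.2 ⟨u * addOrderOf g₁, ?_⟩
    have e₁ : (u * addOrderOf g₁ : ℤ) • g₁ = 0 := by
      rw [mul_zsmul, natCast_zsmul, addOrderOf_nsmul_eq_zero, zsmul_zero]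
    have e₂ : (v * addOrderOf g₂ : ℤ) • g₂ = 0 := by
      rw [mul_zsmul, natCast_zsmul, addOrderOf_nsmul_eq_zero, zsmul_zero]
    calc (u * addOrderOf g₁ : ℤ) • (g₁ + g₂)
        = (u * addOrderOf g₁ : ℤ) • g₂ + (v * addOrderOf g₂ : ℤ) • g₂ := by
          rw [zsmul_add, e₁, e₂, zero_add, add_zero]
      _ = g₂ := by rw [← add_zsmul, huv, one_zsmul]
  refine ⟨?_, h₂⟩
  have := AddSubgroup.sub_mem _ (AddSubgroup.mem_zmultiples (g₁ + g₂)) h₂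
  rwa [add_sub_cancel_right] at this

/-- Doubles are known only through x-coordinates, hence up to sign, and this suffices: 4Q = Q would
give 2Q = -Q and so Q = ±R, which leaves 4Q = -Q. -/
theorem addOrderOf_eq_five {Q R : G} (hQ : Q ≠ 0) (h₁ : 2 • Q = R ∨ 2 • Q = -R)
    (h₂ : 2 • R = Q ∨ 2 • R = -Q) (hne : Q ≠ R) (hne' : Q ≠ -R) : addOrderOf Q = 5 := by
  have : Fact (Nat.Prime 5) := ⟨Nat.prime_five⟩
  refine addOrderOf_eq_prime ?_ hQ
  have h4 : 4 • Q = Q ∨ 4 • Q = -Q := by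
    rw [show 4 • Q = 2 • (2 • Q) by rw [smul_smul]; rfl]
    obtain h | h := h₁ <;> obtain h' | h' := h₂ <;> rw [h] <;> simp [h']
  obtain h | h := h4
  · have h3 : 2 • Q = -Q := by
      rw [eq_neg_iff_add_eq_zero]
      have e : 4 • Q = (2 • Q + Q) + Q := by abel
      rw [h] at e
      exact right_eq_add.1 e
    rw [h3] at h₁
    obtain h | h := h₁
    · exact absurd (by rw [← h, neg_neg]) hne'
    · exact absurd (neg_injective h) hne
  · rw [show 5 • Q = 4 • Q + Q by abel, h, neg_add_cancel]

theorem addOrderOf_eq_three {Q : G} (hQ : Q ≠ 0) (h : 2 • Q = Q ∨ 2 • Q = -Q) :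
    addOrderOf Q = 3 := by
  have : Fact (Nat.Prime 3) := ⟨Nat.prime_three⟩
  refine addOrderOf_eq_prime ?_ hQ
  obtain h | h := h
  · exact absurd (by rw [two_nsmul] at h; simpa using h) hQ
  · rw [show 3 • Q = 2 • Q + Q by abel, h, neg_add_cancel]

theorem addOrderOf_eq_four {S T : G} (h : 2 • S = T) (hT : 2 • T = 0) (hT0 : T ≠ 0) :
    addOrderOf S = 4 := by
  have : Fact (Nat.Prime 2) := ⟨Nat.prime_two⟩
  refine addOrderOf_eq_prime_pow (p := 2) (n := 1) (by rw [pow_one, h]; exact hT0) ?_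
  rw [← hT, ← h, smul_smul]
  rfl

theorem addOrderOf_eq_eight {P Q T : G} (h₁ : 2 • Q = P ∨ 2 • Q = -P) (h₂ : 2 • P = T)
    (hT : 2 • T = 0) (hT0 : T ≠ 0) : 4 • Q = T ∧ addOrderOf Q = 8 := by
  have h4 : 4 • Q = T := by
    rw [show 4 • Q = 2 • (2 • Q) by rw [smul_smul]; rfl]
    obtain h | h := h₁
    · rw [h, h₂]
    · rw [h, smul_neg, h₂, neg_eq_iff_add_eq_zero, ← two_nsmul, hT]
  have : Fact (Nat.Prime 2) := ⟨Nat.prime_two⟩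
  refine ⟨h4, addOrderOf_eq_prime_pow (p := 2) (n := 2) ?_ ?_⟩
  · rw [show 2 ^ 2 = 4 from rfl, h4]; exact hT0
  · rw [← hT, ← h4, smul_smul]
    rfl

theorem notMem_zmultiples_of_two_nsmul {S T Q : G} (hS : 2 • S = 0) (hS0 : S ≠ 0) (hST : S ≠ T)
    (hT : 2 • T = 0) (h4 : 4 • Q = T) (h8 : addOrderOf Q = 8) :
    S ∉ AddSubgroup.zmultiples Q := by
  intro h
  obtain ⟨j, rfl⟩ := AddSubgroup.mem_zmultiples_iff.1 h
  rw [← natCast_zsmul, ← mul_zsmul, ← addOrderOf_dvd_iff_zsmul_eq_zero, h8] at hS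
  obtain ⟨k, rfl⟩ : ∃ k, j = 4 * k := by
    obtain ⟨k, hk⟩ := hS
    push_cast at hk
    exact ⟨k, by omega⟩
  have e : (4 * k) • Q = k • T := by
    rw [← h4, mul_comm, mul_zsmul, ofNat_zsmul]
  rw [e] at hST hS0
  obtain ⟨i, rfl⟩ | ⟨i, rfl⟩ := Int.even_or_odd k
  · refine hS0 ?_
    rw [← two_mul, mul_comm, mul_zsmul, ofNat_zsmul, hT, zsmul_zero]
  · refine hST ?_
    rw [add_zsmul, mul_comm, mul_zsmul, ofNat_zsmul, hT, zsmul_zero, one_zsmul, zero_add]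

theorem nsmul_eq_zero_of_mem_sup {s g P : G} {n : ℕ} (hs : n • s = 0) (hg : n • g = 0)
    (hP : P ∈ AddSubgroup.zmultiples s ⊔ AddSubgroup.zmultiples g) : n • P = 0 := by
  obtain ⟨u, hu, v, hv, rfl⟩ := AddSubgroup.mem_sup.1 hP
  rw [smul_add, nsmul_eq_zero_of_mem_zmultiples hs hu, nsmul_eq_zero_of_mem_zmultiples hg hv,
    add_zero]

end GroupStructure

/-! ### Points with polynomial coordinates -/

section PolynomialPoints

variable {a b : ℚ[X]}

theorem algebraMap_ne_zero {f : ℚ[X]} (hf : f ≠ 0) : algebraMap ℚ[X] Qt f ≠ 0 :=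
  (map_ne_zero_iff _ (IsFractionRing.injective ℚ[X] Qt)).2 hf

theorem polyCurve_isElliptic (hb : b ≠ 0) (hd : a ^ 2 - 4 * b ≠ 0) :
    (polyCurve a b).IsElliptic := by
  refine curve_isElliptic (algebraMap_ne_zero hb) ?_
  have := algebraMap_ne_zero hd
  rwa [map_sub, map_pow, map_mul, map_ofNat] at this

theorem equation_algebraMap {f g : ℚ[X]} (h : g ^ 2 = f * (f ^ 2 + a * f + b)) :
    algebraMap ℚ[X] Qt g ^ 2 = algebraMap ℚ[X] Qt f * (algebraMap ℚ[X] Qt f ^ 2 +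
      algebraMap ℚ[X] Qt a * algebraMap ℚ[X] Qt f + algebraMap ℚ[X] Qt b) := by
  simpa using congrArg (algebraMap ℚ[X] Qt) h

variable [(polyCurve a b).IsElliptic]

/-- A point with polynomial coordinates. -/
def polyPt {f g : ℚ[X]} (h : g ^ 2 = f * (f ^ 2 + a * f + b)) : (polyCurve a b).Point :=
  pt (equation_algebraMap h)

theorem eq_polyPt_or_neg {f g : ℚ[X]} (h : g ^ 2 = f * (f ^ 2 + a * f + b)) {x y : Qt}
    (h' : y ^ 2 = x * (x ^ 2 + algebraMap ℚ[X] Qt a * x + algebraMap ℚ[X] Qt b))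
    (hx : x = algebraMap ℚ[X] Qt f) : pt h' = polyPt h ∨ pt h' = -polyPt h := by
  subst hx
  exact pt_eq_or_eq_neg h' (equation_algebraMap h)

theorem polyPt_ne {f g f' g' : ℚ[X]} (h : g ^ 2 = f * (f ^ 2 + a * f + b))
    (h' : g' ^ 2 = f' * (f' ^ 2 + a * f' + b)) (hf : f ≠ f') : polyPt h ≠ polyPt h' := fun e =>
  hf (IsFractionRing.injective ℚ[X] Qt (pt_inj e).1)

theorem polyPt_ne_neg {f g f' g' : ℚ[X]} (h : g ^ 2 = f * (f ^ 2 + a * f + b))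
    (h' : g' ^ 2 = f' * (f' ^ 2 + a * f' + b)) (hf : f ≠ f') : polyPt h ≠ -polyPt h' := by
  intro e
  rw [polyPt, polyPt, neg_pt] at e
  exact hf (IsFractionRing.injective ℚ[X] Qt (pt_inj e).1)

variable [DecidableEq Qt]

theorem two_nsmul_polyPt_of_eq_zero {f g : ℚ[X]} (h : g ^ 2 = f * (f ^ 2 + a * f + b))
    (hg : g = 0) : 2 • polyPt h = 0 := by
  rw [two_nsmul]
  exact pt_add_self_of_eq_zero _ (by rw [hg, map_zero])

theorem two_nsmul_polyPt {f g f' g' : ℚ[X]} (h : g ^ 2 = f * (f ^ 2 + a * f + b))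
    (h' : g' ^ 2 = f' * (f' ^ 2 + a * f' + b)) (hg : g ≠ 0)
    (hf : f' * (4 * g ^ 2) = (f ^ 2 - b) ^ 2) :
    2 • polyPt h = polyPt h' ∨ 2 • polyPt h = -polyPt h' := by
  have hg' := algebraMap_ne_zero hg
  obtain ⟨x, y, hxy, e, hx⟩ := pt_add_self (equation_algebraMap h) hg'
  rw [two_nsmul, polyPt, e]
  refine eq_polyPt_or_neg h' hxy ?_
  have := congrArg (algebraMap ℚ[X] Qt) hf
  simp only [map_mul, map_pow, map_sub, map_ofNat] at this
  rw [← this] at hx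
  exact mul_right_cancel₀ (mul_ne_zero (by norm_num) (pow_ne_zero 2 hg')) hx

theorem two_nsmul_polyPt_eq_twoTorsionPt {f g : ℚ[X]} (h : g ^ 2 = f * (f ^ 2 + a * f + b))
    (hg : g ≠ 0) (hf : f ^ 2 = b) : 2 • polyPt h = twoTorsionPt _ _ := by
  have h0 : (0 : ℚ[X]) ^ 2 = 0 * (0 ^ 2 + a * 0 + b) := by ring
  have h0' : polyPt h0 = twoTorsionPt _ _ := pt_eq_twoTorsionPt _ (map_zero _)
  obtain e | e := two_nsmul_polyPt h h0 hg (by rw [hf]; ring)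
  · rw [e, h0']
  · rw [e, h0', neg_eq_iff_add_eq_zero, twoTorsionPt_add_self]

end PolynomialPoints

section ClassProducts

variable {A B : Qt} [(curve A B).IsElliptic] [DecidableEq Qt]

/-- Subtracting the first point leaves the class of the second, so the single-class case applies and
no formula for the sum of the two points is required. -/
theorem exists_square_of_class_mul {H : AddSubgroup (curve A B).Point} (hT : twoTorsionPt A B ∈ H)
    {x y x₀ y₀ x₁ y₁ z : Qt} (h : y ^ 2 = x * (x ^ 2 + A * x + B))
    (h₀ : y₀ ^ 2 = x₀ * (x₀ ^ 2 + A * x₀ + B)) (hH : pt h₀ ∈ H) (hx₀ : x₀ ≠ 0)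
    (h₁ : y₁ ^ 2 = x₁ * (x₁ ^ 2 + A * x₁ + B)) (hH₁ : pt h₁ ∈ H) (hx₁ : x₁ ≠ 0) (hz : z ≠ 0)
    (hx : x = x₀ * x₁ * z ^ 2) :
    pt h ∈ H ∨ ∃ τ ∈ H, ∃ (w y' : Qt) (h' : y' ^ 2 = w ^ 2 * ((w ^ 2) ^ 2 + A * w ^ 2 + B)),
      w ≠ 0 ∧ pt h = τ + pt h' := by
  obtain e | e | ⟨x', y', u, h', e, hu⟩ := sub_pt_cases h h₀
  · exact .inl (e ▸ hH)
  · exact .inl (e ▸ H.neg_mem hH)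
  have e' : pt h = pt h₀ + pt h' := by rw [← e]; abel
  by_cases hx' : x' = 0
  · rw [pt_eq_twoTorsionPt h' hx'] at e'
    exact .inl (e' ▸ H.add_mem hH hT)
  have hu0 : u ≠ 0 := by
    rintro rfl
    rw [hx] at hu
    have : x₀ * x₁ * z ^ 2 * x₀ * x' ≠ 0 := by positivity
    exact this (by rw [hu]; ring)
  obtain h₂ | ⟨τ, hτ, w, y'', h'', hw, e''⟩ := exists_square_of_class hT h' h₁ hH₁ hx₁
    (z := u / (x₀ * x₁ * z)) (by positivity) (by
      rw [div_pow, ← hu, hx]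
      field_simp)
  · exact .inl (e' ▸ H.add_mem hH h₂)
  · exact .inr ⟨pt h₀ + τ, H.add_mem hH hτ, w, y'', h'', hw, by rw [e', e'', add_assoc]⟩

end ClassProducts

section OddTorsion

variable {a b : ℚ[X]} [(polyCurve a b).IsElliptic] [DecidableEq Qt]

/-- Odd torsion points give doubling cycles of polynomials. -/
theorem exists_polynomial_doublingCycle {P : (polyCurve a b).Point} (hP : P ≠ 0) {N : ℕ}
    (hN : Odd N) (hNP : N • P = 0) :
    ∃ (x y : ℕ → ℚ[X]) (p : ℕ), DoublingCycle a b x y p ∧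
      ∀ k, ∃ h : y k ^ 2 = x k * (x k ^ 2 + a * x k + b), 2 ^ k • P = polyPt h := by
  obtain ⟨x, y, p, h, hpt⟩ := exists_doublingCycle hP hN hNP
  obtain ⟨f, g, hfg, hx, hy⟩ := h.exists_polynomial
  refine ⟨f, g, p, hfg, fun k => ⟨hfg.eqn k, ?_⟩⟩
  obtain ⟨h', e⟩ := hpt k
  rw [e]
  exact pt_congr _ _ (hx k) (hy k)

/-- Some 2ᵏP is ± the known point, hence lies in Z; P itself is recovered by Bézout because its
order is odd. -/
theorem mem_of_odd_nsmul_eq_zero {Z : AddSubgroup (polyCurve a b).Point} {f g : ℚ[X]}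
    (h : g ^ 2 = f * (f ^ 2 + a * f + b)) (hZ : polyPt h ∈ Z)
    (hcyc : ∀ (x y : ℕ → ℚ[X]) (p : ℕ), DoublingCycle a b x y p → ∃ k, x k = f)
    (P : (polyCurve a b).Point) (N : ℕ) (hN : Odd N) (hNP : N • P = 0) : P ∈ Z := by
  by_cases hP : P = 0
  · rw [hP]; exact Z.zero_mem
  obtain ⟨x, y, p, hc, hpt⟩ := exists_polynomial_doublingCycle hP hN hNP
  obtain ⟨k, hk⟩ := hcyc x y p hc
  obtain ⟨h', e⟩ := hpt k
  refine mem_of_odd_nsmul_of_two_pow_nsmul (k := k) hN (hNP ▸ Z.zero_mem) ?_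
  rw [e]
  obtain e | e := eq_polyPt_or_neg h (equation_algebraMap h') (by rw [hk])
  · rw [polyPt, e]; exact hZ
  · rw [polyPt, e]; exact Z.neg_mem hZ

end OddTorsion

end KubertFamilies

end

open WeierstrassCurve

noncomputable section

namespace KubertFamilies

open WeierstrassCurve.Affine Polynomial

/-! ### Assembly of the descent and the three groups -/

section Descent

variable {a b : ℚ[X]} [(polyCurve a b).IsElliptic] [DecidableEq Qt]

/-- The outcome of the descent: the subgroup `Z` is everything. -/
theorem mem_of_descent {H Z : AddSubgroup (polyCurve a b).Point}
    (hfin : (H : Set (polyCurve a b).Point).Finite) (hT : twoTorsionPt _ _ ∈ H) (hHZ : H ≤ Z)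
    {m : ℕ} (hH : ∀ P ∈ H, 2 ^ m • P = 0)
    (hZ : ∀ (P : (polyCurve a b).Point) (N : ℕ), Odd N → N • P = 0 → P ∈ Z)
    (hclass : ∀ (x y : Qt)
      (h : y ^ 2 = x * (x ^ 2 + algebraMap ℚ[X] Qt a * x + algebraMap ℚ[X] Qt b)), x ≠ 0 →
      pt h ∈ H ∨ ∃ τ ∈ H, ∃ (w y' : Qt) (h' : y' ^ 2 = w ^ 2 * ((w ^ 2) ^ 2 +
        algebraMap ℚ[X] Qt a * w ^ 2 + algebraMap ℚ[X] Qt b)), w ≠ 0 ∧ pt h = τ + pt h')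
    (hdual : ∀ x y : Qt, x ≠ 0 → y ^ 2 = x * (x ^ 2 + algebraMap ℚ[X] Qt (-2 * a) * x +
        algebraMap ℚ[X] Qt (a ^ 2 - 4 * b)) →
      ∃ z, z ≠ 0 ∧ (x = z ^ 2 ∨ x = algebraMap ℚ[X] Qt (a ^ 2 - 4 * b) * z ^ 2))
    (P : (polyCurve a b).Point) : P ∈ Z := by
  have e₁ : algebraMap ℚ[X] Qt (-2 * a) = -2 * algebraMap ℚ[X] Qt a := by
    rw [map_mul, map_neg, map_ofNat]
  have e₂ : algebraMap ℚ[X] Qt (a ^ 2 - 4 * b) =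
      algebraMap ℚ[X] Qt a ^ 2 - 4 * algebraMap ℚ[X] Qt b := by
    rw [map_sub, map_mul, map_pow, map_ofNat]
  rw [e₁, e₂] at hdual
  obtain ⟨r, hr, hrP⟩ := exists_odd_nsmul_mem_curve hfin
    (exists_add_two_nsmul hT hclass hdual) P
  exact mem_of_odd_nsmul_mem hHZ hH hZ hr hrP

end Descent

section Ten

theorem E10_eq : E10 = polyCurve a₁₀ b₁₀ := by
  simp only [E10, polyCurve, a₁₀, b₁₀, map_neg, map_add, map_sub, map_mul, map_pow, map_one,
    map_ofNat, RatFunc.algebraMap_X]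

instance isElliptic₁₀ : (polyCurve a₁₀ b₁₀).IsElliptic := by
  refine polyCurve_isElliptic ?_ ?_
  · intro h
    have := congrArg (eval 2) h
    rw [b₁₀] at this
    norm_num at this
  · intro h
    have := congrArg (eval 0) h
    rw [disc₁₀] at this
    norm_num at this

theorem exists_equiv₁₀ [DecidableEq Qt] : Nonempty ((polyCurve a₁₀ b₁₀).Point ≃+ ZMod 10) := by
  have hQ : (4 * X ^ 4 * (X - 1) ^ 2 * (2 * X - 1) ^ 2 : ℚ[X]) ^ 2 = (4 * X ^ 4 * (X - 1) ^ 2) *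
      ((4 * X ^ 4 * (X - 1) ^ 2) ^ 2 + a₁₀ * (4 * X ^ 4 * (X - 1) ^ 2) + b₁₀) := by
    rw [a₁₀, b₁₀]; ring
  have hR : (4 * X ^ 2 * (X - 1) ^ 4 * (2 * X - 1) : ℚ[X]) ^ 2 = (4 * X ^ 2 * (X - 1) ^ 4) *
      ((4 * X ^ 2 * (X - 1) ^ 4) ^ 2 + a₁₀ * (4 * X ^ 2 * (X - 1) ^ 4) + b₁₀) := by
    rw [a₁₀, b₁₀]; ring
  have hne : (4 * X ^ 4 * (X - 1) ^ 2 : ℚ[X]) ≠ 4 * X ^ 2 * (X - 1) ^ 4 := by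
    intro h
    have := congrArg (eval 2) h
    norm_num at this
  have h2Q := two_nsmul_polyPt hQ hR (fun h => by
    have := congrArg (eval 2) h
    norm_num at this) (by rw [b₁₀]; ring)
  have h2R := two_nsmul_polyPt hR hQ (fun h => by
    have := congrArg (eval 2) h
    norm_num at this) (by rw [b₁₀]; ring)
  have hQR := polyPt_ne hQ hR hne
  have hQR' := polyPt_ne_neg hQ hR hne
  obtain ⟨Q, hQe⟩ : ∃ Q, Q = polyPt hQ := ⟨_, rfl⟩
  obtain ⟨R, hRe⟩ : ∃ R, R = polyPt hR := ⟨_, rfl⟩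
  obtain ⟨T, hTe⟩ : ∃ T, T = twoTorsionPt (algebraMap ℚ[X] Qt a₁₀) (algebraMap ℚ[X] Qt b₁₀) :=
    ⟨_, rfl⟩
  have hQ0 : Q ≠ 0 := hQe ▸ pt_ne_zero _
  have hT0 : T ≠ 0 := hTe ▸ pt_ne_zero _
  have hT2 : 2 • T = 0 := by rw [two_nsmul, hTe, twoTorsionPt_add_self]
  rw [← hQe, ← hRe] at h2Q h2R hQR hQR'
  have : Fact (Nat.Prime 2) := ⟨Nat.prime_two⟩
  have oT : addOrderOf T = 2 := addOrderOf_eq_prime hT2 hT0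
  have oQ : addOrderOf Q = 5 := addOrderOf_eq_five hQ0 h2Q h2R hQR hQR'
  have hcop : (addOrderOf T).Coprime (addOrderOf Q) := by rw [oT, oQ]; decide
  have o : addOrderOf (T + Q) = 10 := by
    rw [(AddCommute.all T Q).addOrderOf_add_eq_mul_addOrderOf_of_coprime hcop, oT, oQ]
  obtain ⟨hTZ, hQZ⟩ := mem_zmultiples_add hcop
  refine exists_equiv_zmod (g := T + Q) ?_ o
  -- H = {0, T} is the 2-power torsion that covers the descent classes; the point Q of order 5
  -- enters only through Z, the group generated by T + Q.
  refine mem_of_descent (H := AddSubgroup.zmultiples T) (m := 1)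
    (finite_zmultiples_of_nsmul_eq_zero two_pos hT2) (hTe ▸ AddSubgroup.mem_zmultiples _)
    (by rwa [AddSubgroup.zmultiples_le]) (fun P hP => nsmul_eq_zero_of_mem_zmultiples hT2 hP)
    (mem_of_odd_nsmul_eq_zero hQ (hQe ▸ hQZ) fun x y p h => h.exists_eq_of_ten) ?_
    fun x y hx h => dual_class₁₀ hx h
  · intro x y h hx
    obtain ⟨z, hz, e | e⟩ := class₁₀ hx h
    · exact exists_square_of_square h hz e
    · exact exists_square_of_twoTorsionPt_class (hTe ▸ AddSubgroup.mem_zmultiples _) h hz e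

end Ten

section Twelve

theorem E12_eq : E12 = polyCurve a₁₂ b₁₂ := by
  simp only [E12, polyCurve, a₁₂, b₁₂, map_add, map_sub, map_mul, map_pow, map_one,
    map_ofNat, RatFunc.algebraMap_X]

instance isElliptic₁₂ : (polyCurve a₁₂ b₁₂).IsElliptic := by
  refine polyCurve_isElliptic ?_ ?_
  · intro h
    have := congrArg (eval 0) h
    rw [b₁₂] at this
    norm_num at this
  · intro h
    have := congrArg (eval 0) h
    rw [disc₁₂] at this
    norm_num at this

theorem exists_equiv₁₂ [DecidableEq Qt] : Nonempty ((polyCurve a₁₂ b₁₂).Point ≃+ ZMod 12) := by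
  have hQ : (64 * (X + 1) ^ 4 * (X ^ 4 + 2 * X ^ 2 - 8 * X + 5) : ℚ[X]) ^ 2 = (64 * (X + 1) ^ 4) *
      ((64 * (X + 1) ^ 4) ^ 2 + a₁₂ * (64 * (X + 1) ^ 4) + b₁₂) := by
    rw [a₁₂, b₁₂]; ring
  have hP : (32 * (X ^ 2 + 3) * (X + 1) ^ 3 * ((X - 1) ^ 3 * (X + 3)) : ℚ[X]) ^ 2
      = (32 * (X ^ 2 + 3) * (X + 1) ^ 3) * ((32 * (X ^ 2 + 3) * (X + 1) ^ 3) ^ 2 +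
        a₁₂ * (32 * (X ^ 2 + 3) * (X + 1) ^ 3) + b₁₂) := by
    rw [a₁₂, b₁₂]; ring
  have h2Q := two_nsmul_polyPt hQ hQ (fun h => by
    have := congrArg (eval 0) h
    norm_num at this) (by rw [b₁₂]; ring)
  have h2P := two_nsmul_polyPt_eq_twoTorsionPt hP (fun h => by
    have := congrArg (eval 0) h
    norm_num at this) (by rw [b₁₂]; ring)
  obtain ⟨Q, hQe⟩ : ∃ Q, Q = polyPt hQ := ⟨_, rfl⟩
  obtain ⟨S, hSe⟩ : ∃ S, S = polyPt hP := ⟨_, rfl⟩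
  obtain ⟨T, hTe⟩ : ∃ T, T = twoTorsionPt (algebraMap ℚ[X] Qt a₁₂) (algebraMap ℚ[X] Qt b₁₂) :=
    ⟨_, rfl⟩
  have hQ0 : Q ≠ 0 := hQe ▸ pt_ne_zero _
  have hT0 : T ≠ 0 := hTe ▸ pt_ne_zero _
  have hT2 : 2 • T = 0 := by rw [two_nsmul, hTe, twoTorsionPt_add_self]
  rw [← hQe] at h2Q
  rw [← hSe, ← hTe] at h2P
  have oS : addOrderOf S = 4 := addOrderOf_eq_four h2P hT2 hT0
  have oQ : addOrderOf Q = 3 := addOrderOf_eq_three hQ0 h2Q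
  have h4 : 4 • S = 0 := by rw [← oS, addOrderOf_nsmul_eq_zero]
  have hcop : (addOrderOf S).Coprime (addOrderOf Q) := by rw [oS, oQ]; decide
  have o : addOrderOf (S + Q) = 12 := by
    rw [(AddCommute.all S Q).addOrderOf_add_eq_mul_addOrderOf_of_coprime hcop, oS, oQ]
  obtain ⟨hSZ, hQZ⟩ := mem_zmultiples_add hcop
  have hTH : T ∈ AddSubgroup.zmultiples S := by
    rw [← h2P]; exact AddSubgroup.nsmul_mem _ (AddSubgroup.mem_zmultiples S) 2
  refine exists_equiv_zmod (g := S + Q) ?_ o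
  refine mem_of_descent (H := AddSubgroup.zmultiples S) (m := 2)
    (finite_zmultiples_of_nsmul_eq_zero (by norm_num) h4) (hTe ▸ hTH)
    (by rwa [AddSubgroup.zmultiples_le]) (fun P hP => nsmul_eq_zero_of_mem_zmultiples h4 hP)
    (mem_of_odd_nsmul_eq_zero hQ (hQe ▸ hQZ) fun x y p h => h.exists_eq_of_twelve) ?_
    fun x y hx h => dual_class₁₂ hx h
  · intro x y h hx
    have hne : (X + 1 : ℚ[X]) ≠ 0 := (monic_X_add_C (1 : ℚ)).ne_zero
    have h0 := algebraMap_ne_zero (mul_ne_zero (by norm_num : (4 : ℚ[X]) ≠ 0) hne)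
    obtain ⟨z, hz, e | e⟩ := class₁₂ hx h
    · exact exists_square_of_square h hz e
    · refine exists_square_of_class (hTe ▸ hTH) h (equation_algebraMap hP)
        (show polyPt hP ∈ _ from hSe ▸ AddSubgroup.mem_zmultiples _)
        (algebraMap_ne_zero fun h => ?_) (div_ne_zero hz h0) ?_
      · have := congrArg (eval 0) h
        norm_num at this
      -- The x-coordinate of the point of order 4 differs from the class representative by the
      -- square (4(X + 1))².
      · rw [e, show (32 * (X ^ 2 + 3) * (X + 1) ^ 3 : ℚ[X]) =
          2 * (X ^ 2 + 3) * (X + 1) * (4 * (X + 1)) ^ 2 by ring, map_mul _ _ (_ ^ 2), map_pow]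
        field_simp

end Twelve

section TwoEight

theorem E2x8_eq : E2x8 = polyCurve a₂₈ b₂₈ := by
  simp only [E2x8, polyCurve, a₂₈, b₂₈, map_add, map_sub, map_mul, map_pow, map_one,
    map_ofNat, RatFunc.algebraMap_X]

instance isElliptic₂₈ : (polyCurve a₂₈ b₂₈).IsElliptic := by
  refine polyCurve_isElliptic ?_ ?_
  · intro h
    have := congrArg (eval 2) h
    rw [b₂₈] at this
    norm_num at this
  · intro h
    have := congrArg (eval 0) h
    rw [disc₂₈] at this
    norm_num at this

theorem exists_equiv₂₈ [DecidableEq Qt] :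
    Nonempty ((polyCurve a₂₈ b₂₈).Point ≃+ ZMod 2 × ZMod 8) := by
  have hS : (0 : ℚ[X]) ^ 2 = -(X ^ 2 - 1) ^ 4 *
      ((-(X ^ 2 - 1) ^ 4) ^ 2 + a₂₈ * -(X ^ 2 - 1) ^ 4 + b₂₈) := by
    rw [a₂₈, b₂₈]; ring
  have hP : (4 * X ^ 2 * (X ^ 2 - 1) ^ 2 * ((X ^ 2 - 1) ^ 2 + 4 * X ^ 2) : ℚ[X]) ^ 2 =
      4 * X ^ 2 * (X ^ 2 - 1) ^ 2 * ((4 * X ^ 2 * (X ^ 2 - 1) ^ 2) ^ 2 +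
        a₂₈ * (4 * X ^ 2 * (X ^ 2 - 1) ^ 2) + b₂₈) := by
    rw [a₂₈, b₂₈]; ring
  have hQ : (4 * X ^ 3 * (X - 1) * (X + 1) ^ 3 * ((X ^ 2 + 1) * (X ^ 2 + 2 * X - 1)) : ℚ[X]) ^ 2 =
      4 * X ^ 3 * (X - 1) * (X + 1) ^ 3 * ((4 * X ^ 3 * (X - 1) * (X + 1) ^ 3) ^ 2 +
        a₂₈ * (4 * X ^ 3 * (X - 1) * (X + 1) ^ 3) + b₂₈) := by
    rw [a₂₈, b₂₈]; ring
  have h2S := two_nsmul_polyPt_of_eq_zero hS rfl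
  have h2P := two_nsmul_polyPt_eq_twoTorsionPt hP (fun h => by
    have := congrArg (eval 2) h
    norm_num at this) (by rw [b₂₈]; ring)
  have h2Q := two_nsmul_polyPt hQ hP (fun h => by
    have := congrArg (eval 2) h
    norm_num at this) (by rw [b₂₈]; ring)
  have hS0 : (-(X ^ 2 - 1) ^ 4 : ℚ[X]) ≠ 0 := fun h => by
    have := congrArg (eval 0) h
    norm_num at this
  obtain ⟨S, hSe⟩ : ∃ S, S = polyPt hS := ⟨_, rfl⟩
  obtain ⟨P, hPe⟩ : ∃ P, P = polyPt hP := ⟨_, rfl⟩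
  obtain ⟨Q, hQe⟩ : ∃ Q, Q = polyPt hQ := ⟨_, rfl⟩
  obtain ⟨T, hTe⟩ : ∃ T, T = twoTorsionPt (algebraMap ℚ[X] Qt a₂₈) (algebraMap ℚ[X] Qt b₂₈) :=
    ⟨_, rfl⟩
  have hST : S ≠ T := by
    intro h
    rw [hSe, hTe] at h
    exact algebraMap_ne_zero hS0 (pt_inj h).1
  have hSz : S ≠ 0 := hSe ▸ pt_ne_zero _
  have hT0 : T ≠ 0 := hTe ▸ pt_ne_zero _
  have hT2 : 2 • T = 0 := by rw [two_nsmul, hTe, twoTorsionPt_add_self]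
  rw [← hSe] at h2S
  rw [← hPe, ← hTe] at h2P
  rw [← hPe, ← hQe] at h2Q
  obtain ⟨h4Q, oQ⟩ := addOrderOf_eq_eight h2Q h2P hT2 hT0
  have h8Q : 8 • Q = 0 := by rw [← oQ, addOrderOf_nsmul_eq_zero]
  have h8S : 8 • S = 0 := by rw [show 8 = 4 * 2 from rfl, mul_nsmul', h2S, nsmul_zero]
  have hSQ := notMem_zmultiples_of_two_nsmul h2S hSz hST hT2 h4Q oQ
  refine exists_equiv_zmod_two_prod h2S oQ hSQ ?_
  obtain ⟨H, hH⟩ : ∃ H, H = AddSubgroup.zmultiples S ⊔ AddSubgroup.zmultiples Q := ⟨_, rfl⟩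
  have hSH : S ∈ H := hH ▸ AddSubgroup.mem_sup_left (AddSubgroup.mem_zmultiples S)
  have hQH : Q ∈ H := hH ▸ AddSubgroup.mem_sup_right (AddSubgroup.mem_zmultiples Q)
  have hTH : T ∈ H := h4Q ▸ H.nsmul_mem hQH 4
  have hfin : (H : Set (polyCurve a₂₈ b₂₈).Point).Finite := by
    rw [hH, AddSubgroup.add_normal]
    exact (finite_zmultiples_of_nsmul_eq_zero two_pos h2S).add
      (finite_zmultiples_of_nsmul_eq_zero (by norm_num) h8Q)
  rw [← hH]
  refine mem_of_descent (m := 3) hfin (hTe ▸ hTH) le_rfl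
    (fun R hR => nsmul_eq_zero_of_mem_sup h8S h8Q (hH ▸ hR)) ?_ ?_ ?_
  · intro R N hN hNR
    by_cases hR : R = 0
    · rw [hR]; exact H.zero_mem
    obtain ⟨x, y, p, hc, -⟩ := exists_polynomial_doublingCycle hR hN hNR
    exact hc.false_of_twoEight.elim
  · intro x y h hx
    have hQx : algebraMap ℚ[X] Qt (4 * X ^ 3 * (X - 1) * (X + 1) ^ 3) =
        algebraMap ℚ[X] Qt (X * (X - 1) * (X + 1)) *
          algebraMap ℚ[X] Qt (2 * X * (X + 1)) ^ 2 := by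
      rw [← map_pow, ← map_mul]; congr 1; ring
    have hSx : algebraMap ℚ[X] Qt (-(X ^ 2 - 1) ^ 4) =
        - algebraMap ℚ[X] Qt ((X ^ 2 - 1) ^ 2) ^ 2 := by
      rw [← map_pow, ← map_neg]; congr 1; ring
    have hne1 := algebraMap_ne_zero (f := 2 * X * (X + 1)) fun h => by
      have := congrArg (eval 1) h
      norm_num at this
    have hne2 := algebraMap_ne_zero (f := (X ^ 2 - 1) ^ 2) fun h => by
      have := congrArg (eval 0) h
      norm_num at this
    have hSH' : pt (equation_algebraMap hS) ∈ H := (hSe ▸ hSH : polyPt hS ∈ H)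
    have hQH' : pt (equation_algebraMap hQ) ∈ H := (hQe ▸ hQH : polyPt hQ ∈ H)
    have hQ0 : algebraMap ℚ[X] Qt (4 * X ^ 3 * (X - 1) * (X + 1) ^ 3) ≠ 0 :=
      algebraMap_ne_zero fun h => by
        have := congrArg (eval 2) h
        norm_num at this
    have hTH' := hTe ▸ hTH
    -- The four classes come from 0, from the 2-torsion point S (class -1), from the point Q of
    -- order 8 (class X(X - 1)(X + 1)), and from S and Q together.
    obtain ⟨z, hz, e | e | e | e⟩ := class₂₈ hx h
    · exact exists_square_of_square h hz e
    · exact exists_square_of_class hTH' h _ hSH' (algebraMap_ne_zero hS0) (div_ne_zero hz hne2) (by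
        rw [e, hSx]; field_simp)
    · exact exists_square_of_class hTH' h _ hQH' hQ0 (div_ne_zero hz hne1) (by
        rw [e, hQx]; field_simp)
    · exact exists_square_of_class_mul hTH' h _ hSH' (algebraMap_ne_zero hS0) _ hQH' hQ0
        (div_ne_zero hz (mul_ne_zero hne1 hne2)) (by
          rw [e, hQx, hSx, map_neg]; field_simp)
  · intro x y hx h
    obtain ⟨z, hz, e⟩ := dual_class₂₈ hx h
    exact ⟨z, hz, .inl e⟩

end TwoEight

end KubertFamilies

end

theorem mainTheorem2 [DecidableEq (RatFunc ℚ)] :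
    (KubertFamilies.E10.IsElliptic ∧
      Nonempty (AddCommGroup.torsion KubertFamilies.E10.Point ≃+ ZMod 10) ∧
      Module.rank ℤ KubertFamilies.E10.Point = 0) ∧
    (KubertFamilies.E12.IsElliptic ∧
      Nonempty (AddCommGroup.torsion KubertFamilies.E12.Point ≃+ ZMod 12) ∧
      Module.rank ℤ KubertFamilies.E12.Point = 0) ∧
    (KubertFamilies.E2x8.IsElliptic ∧
      Nonempty (AddCommGroup.torsion KubertFamilies.E2x8.Point ≃+ ZMod 2 × ZMod 8) ∧
      Module.rank ℤ KubertFamilies.E2x8.Point = 0) := by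
  rw [KubertFamilies.E10_eq, KubertFamilies.E12_eq, KubertFamilies.E2x8_eq]
  exact ⟨⟨inferInstance, KubertFamilies.torsion_equiv_and_rank_of_equiv
      KubertFamilies.exists_equiv₁₀.some⟩,
    ⟨inferInstance, KubertFamilies.torsion_equiv_and_rank_of_equiv
      KubertFamilies.exists_equiv₁₂.some⟩,
    ⟨inferInstance, KubertFamilies.torsion_equiv_and_rank_of_equiv
      KubertFamilies.exists_equiv₂₈.some⟩⟩
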